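/- Let $\omega=e^{2\pi i/3}$, $\Lambda=\mathrm{diag}(\omega,\omega^2,1)$, $\theta(y;\lambda)=y\lambda\Lambda-\tfrac{9\lambda^5}{5}\Lambda^2$, and let $r_1,r_2\in\mathbb C$ with $|r_1|,|r_2|<1$; write $r^*=\bar r$ and let $E_{ij}$ be the $3\times 3$ matrix units. Let $\Sigma^P$ be the union of the twelve rays $e^{i(2n-1)\pi/12}[0,\infty)$, $n=1,\dots,12$, all oriented away from $0$, and put $v_n(y;\lambda)=e^{\theta(y;\lambda)}(I+N_n)e^{-\theta(y;\lambda)}$ with $$N_1=-r_1E_{12},\; N_2=-r_2^*E_{23},\; N_3=r_2E_{32},\; N_4=r_1^*E_{13},\; N_5=-r_1E_{31},\; N_6=-r_2^*E_{12},$$ $$N_7=r_2E_{21},\; N_8=r_1^*E_{32},\; N_9=-r_1E_{23},\; N_{10}=-r_2^*E_{31},\; N_{11}=r_2E_{13},\; N_{12}=r_1^*E_{21}.$$ For real $y$, a solution $M^P(y;\cdot)$ of the Riemann–Hilbert problem is a $3\times3$ matrix function, analytic in $\mathbb C\setminus\Sigma^P$, with continuous boundary values on $\Sigma^P\setminus\{0\}$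 satisfying $M^P_+=M^P_-v_n$ on the $n$-th ray ($+$ is the left side), bounded near $0$, and with $M^P(y;\lambda)\to I$ as $\lambda\to\infty$. (i) For all $y\in\mathbb R$ and $\lambda\in\mathbb C$, the consistency condition $v_1v_2\cdots v_{12}=I$ holds if and only if $$r_2=\frac{(r_2^*)^2-r_1^*}{1-r_2^*r_1^*},\qquad r_1=\frac{(r_1^*)^2-r_2^*}{1-r_2^*r_1^*}.\tag{R}$$ (ii) Let $w_0$ be a real Schwartz function on $\mathbb R$ and $V_1=G^{-1}\mathrm{diag}(0,-w_0,w_0)G$ with $G=\begin{pmatrix}\omega&\omega^2&1\\ \omega^2&\omega&1\\ 1&1&1\end{pmatrix}$. Let the first two columns of $\tilde J$ and $\tilde J^A$ be bounded continuous solutions of $\tilde J(x;k)=I-\int_x^\infty e^{(x-s)k\Lambda}(V_1\tilde J)(s;k)e^{-(x-s)k\Lambda}\,ds$ (used for $k\ge0$) and $\tilde J^A(x;k)=I+\int_x^\infty e^{-(x-s)k\Lambda}(V_1^T\tilde J^A)(s;k)e^{(x-s)k\Lambda}\,ds$ (used for $k\le 0$), let $\tilde s(k)=I-\int_{\mathbb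 R}e^{-xk\Lambda}(V_1\tilde J)e^{xk\Lambda}dx$, $\tilde s^A(k)=I+\int_{\mathbb R}e^{xk\Lambda}(V_1^T\tilde J^A)e^{-xk\Lambda}dx$, and let $\tilde r_1=\tilde s_{12}/\tilde s_{11}$, $\tilde r_2=\tilde s^A_{12}/\tilde s^A_{11}$ be the reflection coefficients of the modified Sawada–Kotera equation. Then $\tilde r_1(0)$ and $\tilde r_2(0)$ exist (that is, such columns exist for $k=0$, with $\tilde s_{11}(0)\ne0\ne\tilde s^A_{11}(0)$), and they satisfy $|\tilde r_1(0)|,|\tilde r_2(0)|<1$, the relations (R) with $r_j=\tilde r_j(0)$, and $\tilde r_1(0)=\omega^2\tilde r_2(0)$. (iii) Let $|r_1|,|r_2|<1$ satisfy (R) and $r_1=\omega^2r_2$ (by (ii), this covers $r_j=\tilde r_j(0)$). Let $Y\subset\mathbb R$ be open and let $M^P(y;\cdot)$ be a solution of the Riemann–Hilbert problem for every $y\in Y$. Then for $y\in Y$ $$M^P(y;\lambda)=I+\frac{M_1^P(y)}{\lambda}+\mathcal O(\lambda^{-2}),\qquad \lambda\to\infty,\ \lambda\notin\Sigma^P,$$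 and $\Psi=M^Pe^{\theta}$ satisfies for $y\in Y$, $\lambda\notin\Sigma^P$ the Lax pair $$\Psi_y=\bigl(\lambda\Lambda+[M_1^P(y),\Lambda]\bigr)\Psi,\qquad \Psi_\lambda=\Bigl(\sum_{k=0}^4\lambda^kA_k(y)\Bigr)\Psi,\quad A_4=-9\Lambda^2,$$ for some matrices $A_k(y)$. Moreover $3(M_1^P(y))_{13}$ is real for $y\in Y$, and $p(s):=-3\,(M_1^P(-s))_{13}$ is four times continuously differentiable on $\{s:-s\in Y\}$ and satisfies there the F-XVIII equation $$p^{(4)}=5p(p')^2+5p'p''+sp+5p^2p''-p^5$$ (equivalently, $q(y)=3(M_1^P(y))_{13}$ satisfies $q^{(4)}=5q(q')^2+5q'q''-yq+5q^2q''-q^5$ on $Y$). -/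

import Mathlib

open Complex Filter Topology Set MeasureTheory Asymptotics
open scoped ComplexConjugate SchwartzMap Matrix

namespace PainleveModel

noncomputable section

/-- The primitive cube root of unity `ω = e^{2πi/3}`. -/
def om : ℂ := Complex.exp (2 * Real.pi * I / 3)

/-- The diagonal entries of `Λ = diag(ω, ω², 1)`. -/
def lam : Fin 3 → ℂ := ![om, om ^ 2, 1]

/-- `Λ = diag(ω, ω², 1)`. -/
def Lam : Matrix (Fin 3) (Fin 3) ℂ := Matrix.diagonal lam

/-! ### The Riemann-Hilbert problem -/

/-- The diagonal entries of the exponent `y z Λ - (9 z⁵ / 5) Λ²`. -/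
def phase (y : ℝ) (z : ℂ) (i : Fin 3) : ℂ :=
  y * z * lam i - 9 * z ^ 5 / 5 * lam i ^ 2

/-- The constant matrices of the twelve jumps (index `n` stands for ray `n + 1`). -/
def jumpConst (r₁ r₂ : ℂ) : Fin 12 → Matrix (Fin 3) (Fin 3) ℂ :=
  ![!![1, -r₁, 0; 0, 1, 0; 0, 0, 1],
    !![1, 0, 0; 0, 1, -conj r₂; 0, 0, 1],
    !![1, 0, 0; 0, 1, 0; 0, r₂, 1],
    !![1, 0, conj r₁; 0, 1, 0; 0, 0, 1],
    !![1, 0, 0; 0, 1, 0; -r₁, 0, 1],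
    !![1, -conj r₂, 0; 0, 1, 0; 0, 0, 1],
    !![1, 0, 0; r₂, 1, 0; 0, 0, 1],
    !![1, 0, 0; 0, 1, 0; 0, conj r₁, 1],
    !![1, 0, 0; 0, 1, -r₁; 0, 0, 1],
    !![1, 0, 0; 0, 1, 0; -conj r₂, 0, 1],
    !![1, 0, r₂; 0, 1, 0; 0, 0, 1],
    !![1, 0, 0; conj r₁, 1, 0; 0, 0, 1]]

/-- The jump matrix on ray `n + 1`: the constant matrix `Y` is replaced by
`e^{y z Λ - (9 z⁵ / 5) Λ²} Y e^{-(y z Λ - (9 z⁵ / 5) Λ²)}`. -/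
def jump (r₁ r₂ : ℂ) (n : Fin 12) (y : ℝ) (z : ℂ) : Matrix (Fin 3) (Fin 3) ℂ :=
  Matrix.diagonal (fun i => Complex.exp (phase y z i)) * jumpConst r₁ r₂ n *
    Matrix.diagonal (fun i => Complex.exp (-phase y z i))

/-- The direction `e^{i(2n+1)π/12}` of ray `n + 1`: the rays make the angles
`15°, 45°, 75°, …, 345°` with the positive real axis. -/
def rayDir (n : Fin 12) : ℂ := Complex.exp ((2 * (n : ℕ) + 1) * Real.pi / 12 * I)

/-- The contour: the union of the twelve closed rays. All rays are oriented away from `0`. -/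
def contour : Set ℂ := {z | ∃ n : Fin 12, ∃ t : ℝ, 0 ≤ t ∧ z = t * rayDir n}

/-- Going to infinity in the complement of the contour. -/
def atInfty : Filter ℂ := Bornology.cobounded ℂ ⊓ 𝓟 contourᶜ

/-- `M` solves the Riemann-Hilbert problem for the parameter `y`. At a point `z ≠ 0` of an
outward oriented ray the left (`+`) side is `0 < Im (ζ / z)`, the right (`-`) side is
`Im (ζ / z) < 0`. The existence of the two limits at every point of the ray implies that the
boundary values are continuous along it. -/
structure IsSolution (r₁ r₂ : ℂ) (y : ℝ) (M : ℂ → Matrix (Fin 3) (Fin 3) ℂ) : Prop where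
  analytic : ∀ i j, DifferentiableOn ℂ (fun z => M z i j) contourᶜ
  jump : ∀ (n : Fin 12) (t : ℝ), 0 < t → ∃ Mplus Mminus : Matrix (Fin 3) (Fin 3) ℂ,
    Tendsto M (𝓝[{ζ | 0 < (ζ / (t * rayDir n)).im}] (t * rayDir n)) (𝓝 Mplus) ∧
    Tendsto M (𝓝[{ζ | (ζ / (t * rayDir n)).im < 0}] (t * rayDir n)) (𝓝 Mminus) ∧
    Mplus = Mminus * jump r₁ r₂ n y (t * rayDir n)
  bounded_zero : ∃ C δ : ℝ, 0 < δ ∧ ∀ z ∈ contourᶜ, ‖z‖ < δ → ∀ i j, ‖M z i j‖ ≤ C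
  normalized : Tendsto M atInfty (𝓝 1)

/-- Consistency of the jumps at the node `0`: the ordered product `v₁ v₂ ⋯ v₁₂` is `I`. -/
def JumpsConsistent (r₁ r₂ : ℂ) (y : ℝ) (z : ℂ) : Prop :=
  (List.ofFn fun n : Fin 12 => jump r₁ r₂ n y z).prod = 1

/-- The relations between the two reflection coefficients at `0`. -/
def Relations (r₁ r₂ : ℂ) : Prop :=
  r₂ = (conj r₂ ^ 2 - conj r₁) / (1 - conj r₂ * conj r₁) ∧
  r₁ = (conj r₁ ^ 2 - conj r₂) / (1 - conj r₂ * conj r₁)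

/-- `Ψ = M e^{y z Λ - (9 z⁵ / 5) Λ²}`. -/
def wave (M : ℝ → ℂ → Matrix (Fin 3) (Fin 3) ℂ) (y : ℝ) (z : ℂ) : Matrix (Fin 3) (Fin 3) ℂ :=
  M y z * Matrix.diagonal (fun i => Complex.exp (phase y z i))

/-- The real function `p` is a (four times continuously differentiable) solution of
`p'''' = 5 p (p')² + 5 p' p'' + s p + 5 p² p'' - p⁵` on the open set `S`. -/
def SolvesFXVIII (p : ℝ → ℝ) (S : Set ℝ) : Prop :=
  ContDiffOn ℝ 4 p S ∧ ∀ s ∈ S,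
    iteratedDeriv 4 p s = 5 * p s * deriv p s ^ 2 + 5 * deriv p s * iteratedDeriv 2 p s
      + s * p s + 5 * p s ^ 2 * iteratedDeriv 2 p s - p s ^ 5

/-! ### Reflection coefficients of the modified Sawada-Kotera equation -/

/-- The gauge matrix `G(k)` at `k = 1`. In general `G(k) = diag(1, k, k²) G(1)`, so that
`G(k)⁻¹ D G(k)` with a diagonal matrix `D` does not depend on `k ≠ 0`. -/
def gauge : Matrix (Fin 3) (Fin 3) ℂ :=
  !![om, om ^ 2, 1; om ^ 2, om, 1; 1, 1, 1]

/-- `V₁(x) = G⁻¹ diag(0, -w(x), w(x)) G`. -/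
def potential (w : 𝓢(ℝ, ℝ)) (x : ℝ) : Matrix (Fin 3) (Fin 3) ℂ :=
  gauge⁻¹ * Matrix.diagonal ![0, -(w x : ℂ), (w x : ℂ)] * gauge

/-- The first two columns of `J` are the bounded continuous solutions of
`J(x) = I - ∫_x^∞ e^{(x-s)kΛ} (V₁ J)(s) e^{-(x-s)kΛ} ds`; for `k ≥ 0` the exponentials
that enter these columns are bounded. -/
def IsJost (w : 𝓢(ℝ, ℝ)) (k : ℝ) (J : ℝ → Matrix (Fin 3) (Fin 3) ℂ) : Prop :=
  ∀ i j : Fin 3, j ≠ 2 →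
    Continuous (fun x => J x i j) ∧ (∃ C : ℝ, ∀ x, ‖J x i j‖ ≤ C) ∧
    ∀ x : ℝ, J x i j = (1 : Matrix (Fin 3) (Fin 3) ℂ) i j -
      ∫ s in Ioi x, Complex.exp ((x - s) * k * (lam i - lam j)) * (potential w s * J s) i j

/-- The same for the adjoint equation,
`J(x) = I + ∫_x^∞ e^{-(x-s)kΛ} (V₁ᵀ J)(s) e^{(x-s)kΛ} ds`, where `k ≤ 0`. -/
def IsAdjointJost (w : 𝓢(ℝ, ℝ)) (k : ℝ) (J : ℝ → Matrix (Fin 3) (Fin 3) ℂ) : Prop :=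
  ∀ i j : Fin 3, j ≠ 2 →
    Continuous (fun x => J x i j) ∧ (∃ C : ℝ, ∀ x, ‖J x i j‖ ≤ C) ∧
    ∀ x : ℝ, J x i j = (1 : Matrix (Fin 3) (Fin 3) ℂ) i j +
      ∫ s in Ioi x, Complex.exp (-((x - s) * k * (lam i - lam j))) *
        ((potential w s)ᵀ * J s) i j

/-- Entries of the scattering matrix `s̃(k) = I - ∫ e^{-xkΛ} (V₁ J)(x) e^{xkΛ} dx`. -/
def scat (w : 𝓢(ℝ, ℝ)) (k : ℝ) (J : ℝ → Matrix (Fin 3) (Fin 3) ℂ) (i j : Fin 3) : ℂ :=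
  (1 : Matrix (Fin 3) (Fin 3) ℂ) i j -
    ∫ x : ℝ, Complex.exp (-(x * k * (lam i - lam j))) * (potential w x * J x) i j

/-- Entries of the adjoint scattering matrix `I + ∫ e^{xkΛ} (V₁ᵀ J)(x) e^{-xkΛ} dx`. -/
def adjointScat (w : 𝓢(ℝ, ℝ)) (k : ℝ) (J : ℝ → Matrix (Fin 3) (Fin 3) ℂ) (i j : Fin 3) : ℂ :=
  (1 : Matrix (Fin 3) (Fin 3) ℂ) i j +
    ∫ x : ℝ, Complex.exp (x * k * (lam i - lam j)) * ((potential w x)ᵀ * J x) i j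

/-- `r = s̃₁₂(k) / s̃₁₁(k)` (used for `k ≥ 0`). -/
def IsReflection₁ (w : 𝓢(ℝ, ℝ)) (k : ℝ) (r : ℂ) : Prop :=
  ∃ J, IsJost w k J ∧ scat w k J 0 0 ≠ 0 ∧ r = scat w k J 0 1 / scat w k J 0 0

/-- `r = s̃ᴬ₁₂(k) / s̃ᴬ₁₁(k)` (used for `k ≤ 0`). -/
def IsReflection₂ (w : 𝓢(ℝ, ℝ)) (k : ℝ) (r : ℂ) : Prop :=
  ∃ J, IsAdjointJost w k J ∧ adjointScat w k J 0 0 ≠ 0 ∧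
    r = adjointScat w k J 0 1 / adjointScat w k J 0 0

end

end PainleveModel

namespace PainleveModel

/-! Part (i). Conjugation by `e^θ` drops out of the ordered product, so consistency concerns twelve
constant unipotent matrices. Equating the product of the first six with the inverse of the product
of the last six leaves one scalar equation, `r₁* + r₁ r₂* + r₂ = 0`. Together with its conjugate it
is a linear system for `r₁, r₂` with determinant `1 - r₁* r₂*`, and (R) is Cramer's rule.

Part (ii). At `k = 0` the exponentials disappear and `V₁(x)` is diagonalised by the same `G` for all
`x`. The Volterra system splits into scalar equations with solutions `a exp(-d ∫_x^∞ w)`. The first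
two columns of the scattering matrix are therefore those of `G⁻¹ diag(1, e^W, e^{-W}) G`, where `W =
∫ w`, and the rest is algebra with `a = e^W`, `b = e^{-W}`, `ab = 1`.

Part (iii). The jumps of `Ψ` are constant and multiply to `I` around `0`. Hence `Ψ` times the
inverse of the partial product of the jumps is entire (Morera across the rays, a removable
singularity at `0`), and `M` continues from each sector to an entire function with the jump relation
valid in the whole plane (`IsSolution.exists_entire`). The jumps still decay on rays turned by at
most `π/60`. Cauchy's formula on turned contours therefore controls a sectionally entire function,
up to the boundary of the sectors, by the size of its jumps (`IsSectorial.norm_le`) and yields the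
expansion at infinity (`IsSectorial.exists_moment`). Consequences are `det M = 1`, uniqueness, and
bounds that are locally uniform in `y`.

No regularity in `y` is assumed; it comes from the transfer matrix `T = Ψ(y') Ψ(y)⁻¹`, which has no
jumps and is entire. On the circle `|z| = 1/|y' - y|` it is known from the expansions at infinity;
the maximum principle and Schwarz's lemma carry this inside (`norm_transfer_sub_le`) and give `T = 1
+ (y' - y)(zΛ + [m, Λ]) + O((y' - y)²)`, locally uniformly in `z`. This is the equation in `y`.
Likewise `A = Ψ_z Ψ⁻¹` is entire with growth `|z|⁴`, hence a polynomial. Differentiating `A(y') T =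
T_z + T A(y)` in `y'` gives the zero-curvature equation for its coefficients (`hasDerivAt_lax`).

By uniqueness, the symmetries `z ↦ ωz`, `z ↦ -z` with inverse transpose (here `r₁ = ω² r₂` enters)
and `z ↦ z̄` pass to all coefficients. They leave one off-diagonal scalar in each of `A₀, …, A₃` and
one diagonal scalar in `A₀`. The compatibility equations express the former through `q = 3 m₁₃` and
its first three derivatives; the latter is eliminated by a first integral, namely that the `z⁴`
coefficient of `tr A²` is `-54 y`. The remaining equation is the fourth-order one
(`scalar_identity`). -/

/-! ### Consistency of the jumps at the origin -/

theorem list_prod_map_conj {R : Type*} [Monoid R] {d e : R} (hde : d * e = 1) (hed : e * d = 1)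
    (l : List R) : (l.map fun x => d * x * e).prod = d * l.prod * e := by
  induction l with
  | nil => simp [hde]
  | cons a l ih =>
    simp only [List.map_cons, List.prod_cons, ih]
    calc d * a * e * (d * l.prod * e) = d * a * (e * d) * l.prod * e := by simp only [mul_assoc]
      _ = _ := by rw [hed]; simp only [mul_one, mul_assoc]

theorem diagonal_exp_mul_neg (f : Fin 3 → ℂ) :
    Matrix.diagonal (fun i => Complex.exp (f i)) * Matrix.diagonal (fun i => Complex.exp (-f i))
      = 1 := by
  rw [Matrix.diagonal_mul_diagonal]
  simp [← Complex.exp_add]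

theorem diagonal_exp_neg_mul (f : Fin 3 → ℂ) :
    Matrix.diagonal (fun i => Complex.exp (-f i)) * Matrix.diagonal (fun i => Complex.exp (f i))
      = 1 := by
  rw [Matrix.diagonal_mul_diagonal]
  simp [← Complex.exp_add]

theorem jumpsConsistent_iff_prod (r₁ r₂ : ℂ) (y : ℝ) (z : ℂ) :
    JumpsConsistent r₁ r₂ y z ↔ (List.ofFn (jumpConst r₁ r₂)).prod = 1 := by
  unfold JumpsConsistent
  have h1 := diagonal_exp_mul_neg (phase y z)
  have h2 := diagonal_exp_neg_mul (phase y z)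
  have : (List.ofFn fun n : Fin 12 => jump r₁ r₂ n y z) = (List.ofFn (jumpConst r₁ r₂)).map
      fun x => Matrix.diagonal (fun i => Complex.exp (phase y z i)) * x *
        Matrix.diagonal (fun i => Complex.exp (-phase y z i)) := by
    rw [List.map_ofFn]; rfl
  rw [this, list_prod_map_conj h1 h2]
  set D := Matrix.diagonal (fun i => Complex.exp (phase y z i))
  set D' := Matrix.diagonal (fun i => Complex.exp (-phase y z i))
  constructor
  · intro h
    calc (List.ofFn (jumpConst r₁ r₂)).prod
        = (D' * D) * (List.ofFn (jumpConst r₁ r₂)).prod * (D' * D) := by rw [h2]; simp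
      _ = D' * (D * (List.ofFn (jumpConst r₁ r₂)).prod * D') * D := by simp only [mul_assoc]
      _ = 1 := by rw [h]; simp [h2]
  · intro h
    rw [h, mul_one, h1]

/-- Every factor is `I + N` with `N² = 0` and inverse `I - N`, so the last six factors can be moved
to the other side explicitly. The two products of six are then compared entry by entry: the entries
differ by combinations of the one relation and its complex conjugate. -/
theorem prod_jumpConst_eq_one_iff (r₁ r₂ : ℂ) :
    (List.ofFn (jumpConst r₁ r₂)).prod = 1 ↔ conj r₁ + r₁ * conj r₂ + r₂ = 0 := by
  have hconj : conj r₁ + r₁ * conj r₂ + r₂ = 0 → r₁ + conj r₁ * r₂ + conj r₂ = 0 := fun h => by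
    have := congrArg conj h
    simpa using this
  have key : (List.ofFn (jumpConst r₁ r₂)).prod = 1 ↔
      !![1, -r₁, 0; 0, 1, 0; 0, 0, 1] * (!![1, 0, 0; 0, 1, -conj r₂; 0, 0, 1] *
      (!![1, 0, 0; 0, 1, 0; 0, r₂, 1] * (!![1, 0, conj r₁; 0, 1, 0; 0, 0, 1] *
      (!![1, 0, 0; 0, 1, 0; -r₁, 0, 1] * !![1, -conj r₂, 0; 0, 1, 0; 0, 0, 1])))) =
      !![1, 0, 0; -conj r₁, 1, 0; 0, 0, 1] * (!![1, 0, -r₂; 0, 1, 0; 0, 0, 1] *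
      (!![1, 0, 0; 0, 1, 0; conj r₂, 0, 1] * (!![1, 0, 0; 0, 1, r₁; 0, 0, 1] *
      (!![1, 0, 0; 0, 1, 0; 0, -conj r₁, 1] * !![1, 0, 0; -r₂, 1, 0; 0, 0, 1])))) := by
    set X := !![1, -r₁, 0; 0, 1, 0; 0, 0, 1] * (!![1, 0, 0; 0, 1, -conj r₂; 0, 0, 1] *
      (!![1, 0, 0; 0, 1, 0; 0, r₂, 1] * (!![1, 0, conj r₁; 0, 1, 0; 0, 0, 1] *
      (!![1, 0, 0; 0, 1, 0; -r₁, 0, 1] * !![1, -conj r₂, 0; 0, 1, 0; 0, 0, 1])))) with hX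
    set Y := !![1, 0, 0; -conj r₁, 1, 0; 0, 0, 1] * (!![1, 0, -r₂; 0, 1, 0; 0, 0, 1] *
      (!![1, 0, 0; 0, 1, 0; conj r₂, 0, 1] * (!![1, 0, 0; 0, 1, r₁; 0, 0, 1] *
      (!![1, 0, 0; 0, 1, 0; 0, -conj r₁, 1] * !![1, 0, 0; -r₂, 1, 0; 0, 0, 1])))) with hY
    set Z := !![1, 0, 0; r₂, 1, 0; 0, 0, 1] * (!![1, 0, 0; 0, 1, 0; 0, conj r₁, 1] *
      (!![1, 0, 0; 0, 1, -r₁; 0, 0, 1] * (!![1, 0, 0; 0, 1, 0; -conj r₂, 0, 1] *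
      (!![1, 0, r₂; 0, 1, 0; 0, 0, 1] * !![1, 0, 0; conj r₁, 1, 0; 0, 0, 1])))) with hZ
    have hprod : (List.ofFn (jumpConst r₁ r₂)).prod = X * Z := by
      rw [hX, hZ]
      simp only [jumpConst, List.ofFn_succ, List.ofFn_zero, List.prod_cons, List.prod_nil, mul_one,
        mul_assoc]
      rfl
    have hYZ : Z * Y = 1 := by
      have e : ∀ a b : ℂ, a + b = 0 →
          !![1, a, 0; 0, 1, 0; 0, 0, 1] * !![1, b, 0; 0, 1, 0; 0, 0, 1] =
            (1 : Matrix (Fin 3) (Fin 3) ℂ) ∧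
          !![1, 0, a; 0, 1, 0; 0, 0, 1] * !![1, 0, b; 0, 1, 0; 0, 0, 1] =
            (1 : Matrix (Fin 3) (Fin 3) ℂ) ∧
          !![1, 0, 0; 0, 1, a; 0, 0, 1] * !![1, 0, 0; 0, 1, b; 0, 0, 1] =
            (1 : Matrix (Fin 3) (Fin 3) ℂ) ∧
          !![1, 0, 0; a, 1, 0; 0, 0, 1] * !![1, 0, 0; b, 1, 0; 0, 0, 1] =
            (1 : Matrix (Fin 3) (Fin 3) ℂ) ∧
          !![1, 0, 0; 0, 1, 0; a, 0, 1] * !![1, 0, 0; 0, 1, 0; b, 0, 1] =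
            (1 : Matrix (Fin 3) (Fin 3) ℂ) ∧
          !![1, 0, 0; 0, 1, 0; 0, a, 1] * !![1, 0, 0; 0, 1, 0; 0, b, 1] =
            (1 : Matrix (Fin 3) (Fin 3) ℂ) := by
        intro a b hab
        have hba : b + a = 0 := by rw [add_comm]; exact hab
        simp [Matrix.one_fin_three, hab, hba]
      rw [hY, hZ]
      have cancel : ∀ {A B C D : Matrix (Fin 3) (Fin 3) ℂ}, A * B = 1 → A * (B * C) * D = C * D :=
        fun {A B C D} h => by rw [← mul_assoc A B C, h, one_mul]
      have c2 : ∀ {A B C D : Matrix (Fin 3) (Fin 3) ℂ}, A * B = 1 → A * (B * C) = C :=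
        fun {A B C D} h => by rw [← mul_assoc A B C, h, one_mul]
      simp only [mul_assoc]
      rw [c2 (D := 1) (e _ _ (add_neg_cancel (conj r₁))).2.2.2.1,
        c2 (D := 1) (e _ _ (add_neg_cancel r₂)).2.1,
        c2 (D := 1) (e _ _ (neg_add_cancel (conj r₂))).2.2.2.2.1,
        c2 (D := 1) (e _ _ (neg_add_cancel r₁)).2.2.1,
        c2 (D := 1) (e _ _ (add_neg_cancel (conj r₁))).2.2.2.2.2,
        (e _ _ (add_neg_cancel r₂)).2.2.2.1]
    rw [hprod]
    constructor
    · intro h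
      calc X = X * (Z * Y) := by rw [hYZ, mul_one]
        _ = Y := by rw [← mul_assoc, h, one_mul]
    · rintro h
      rw [h]
      exact mul_eq_one_comm.mp hYZ
  rw [key]
  simp only [Matrix.mul_fin_three]
  constructor
  · intro h
    -- The entry in the first row and third column alone already is the relation.
    have := congrFun (congrFun h 0) 2
    simp at this
    linear_combination this
  · intro h
    have h' := hconj h
    ext i j
    fin_cases i <;> fin_cases j <;> simp
    · linear_combination (-r₁) * h + r₂ * h'
    · linear_combination r₁ * conj r₂ * h - h'
    · linear_combination h
    · linear_combination h - r₂ * conj r₁ * h'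
    · linear_combination (-conj r₂) * h + conj r₁ * h'
    · linear_combination -h'
    · linear_combination -h'
    · linear_combination h

theorem one_sub_conj_mul_conj_ne_zero {r₁ r₂ : ℂ} (h₁ : ‖r₁‖ < 1) (h₂ : ‖r₂‖ < 1) :
    1 - conj r₂ * conj r₁ ≠ 0 := by
  intro h
  have h3 : ‖conj r₂ * conj r₁‖ = 1 := by
    rw [← sub_eq_zero.mp h, norm_one]
  rw [norm_mul, RCLike.norm_conj, RCLike.norm_conj] at h3
  nlinarith [norm_nonneg r₁, norm_nonneg r₂]

/-- The relation and its conjugate read `r₂ + r₂* r₁ = -r₁*` and `r₁ + r₁* r₂ = -r₂*`. With the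
starred quantities as coefficients this is a linear system with determinant `1 - r₂* r₁*`, nonzero
because both norms are below one; solving it gives the two fractions. -/
theorem relations_iff {r₁ r₂ : ℂ} (h₁ : ‖r₁‖ < 1) (h₂ : ‖r₂‖ < 1) :
    Relations r₁ r₂ ↔ conj r₁ + r₁ * conj r₂ + r₂ = 0 := by
  have hne := one_sub_conj_mul_conj_ne_zero h₁ h₂
  unfold Relations
  rw [eq_div_iff hne, eq_div_iff hne]
  constructor
  · rintro ⟨ha, hb⟩
    have : (1 - conj r₂ * conj r₁) * (conj r₁ + r₁ * conj r₂ + r₂) = 0 := by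
      linear_combination ha + conj r₂ * hb
    exact (mul_eq_zero.mp this).resolve_left hne
  · intro h
    have h' : r₁ + conj r₁ * r₂ + conj r₂ = 0 := by
      have := congrArg conj h
      simpa using this
    exact ⟨by linear_combination h - conj r₂ * h', by linear_combination h' - conj r₁ * h⟩

theorem jumpsConsistent_iff_relations {r₁ r₂ : ℂ} (h₁ : ‖r₁‖ < 1) (h₂ : ‖r₂‖ < 1) (y : ℝ)
    (z : ℂ) : JumpsConsistent r₁ r₂ y z ↔ Relations r₁ r₂ := by
  rw [jumpsConsistent_iff_prod, prod_jumpConst_eq_one_iff, relations_iff h₁ h₂]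

/-! ### The scattering problem at `k = 0` -/

theorem om_cube : om ^ 3 = 1 := by
  unfold om
  rw [← Complex.exp_nat_mul, Complex.exp_eq_one_iff]
  exact ⟨1, by push_cast; ring⟩

theorem om_eq : om = -1 / 2 + Real.sqrt 3 / 2 * I := by
  have : (2 * Real.pi * I / 3 : ℂ) = ((2 * Real.pi / 3 : ℝ) : ℂ) * I := by push_cast; ring
  unfold om
  rw [this, Complex.exp_mul_I, ← Complex.ofReal_cos, ← Complex.ofReal_sin]
  have h : 2 * Real.pi / 3 = Real.pi - Real.pi / 3 := by ring
  rw [h, Real.cos_pi_sub, Real.sin_pi_sub, Real.cos_pi_div_three, Real.sin_pi_div_three]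
  push_cast; ring

theorem om_sq_add : om ^ 2 + om + 1 = 0 := by
  have h3 : ((Real.sqrt 3 : ℝ) : ℂ) ^ 2 = 3 := by
    rw [← Complex.ofReal_pow, Real.sq_sqrt (by norm_num)]; norm_num
  rw [om_eq]
  linear_combination (1 / 4) * (I ^ 2) * h3 + (3 / 4) * Complex.I_sq

theorem conj_om : conj om = om ^ 2 := by
  have h : om ^ 2 = -1 - om := by linear_combination om_sq_add
  rw [h, om_eq]
  simp only [map_add, map_mul, map_div₀, map_neg, map_one, Complex.conj_I, Complex.conj_ofReal,
    map_ofNat]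
  ring

theorem hasDerivAt_integral_Ioi {f : ℝ → ℂ} (hf : Integrable f) (hc : Continuous f) (x : ℝ) :
    HasDerivAt (fun x => ∫ s in Ioi x, f s) (-f x) x := by
  have h : (fun x => ∫ s in Ioi x, f s) = fun x => (∫ s in Ioi 0, f s) - ∫ s in (0 : ℝ)..x, f s := by
    funext x
    rw [← intervalIntegral.integral_Ioi_sub_Ioi' hf.integrableOn hf.integrableOn]
    ring
  rw [h]
  exact (intervalIntegral.integral_hasDerivAt_right (hc.intervalIntegrable _ _)
    (hc.stronglyMeasurableAtFilter _ _) hc.continuousAt).const_sub _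

theorem tendsto_integral_Ioi_atBot {f : ℝ → ℂ} (hf : Integrable f) :
    Tendsto (fun x => ∫ s in Ioi x, f s) atBot (𝓝 (∫ s, f s)) :=
  (aecover_Ioi tendsto_id).integral_tendsto_of_countably_generated hf

/-- The integral of the potential over `(x, ∞)`. -/
noncomputable def tail (w : 𝓢(ℝ, ℝ)) (x : ℝ) : ℂ := ∫ s in Ioi x, (w s : ℂ)

theorem integrable_ofReal_schwartz (w : 𝓢(ℝ, ℝ)) : Integrable fun s => (w s : ℂ) :=
  w.integrable.ofReal

theorem continuous_ofReal_schwartz (w : 𝓢(ℝ, ℝ)) : Continuous fun s => (w s : ℂ) :=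
  Complex.continuous_ofReal.comp w.continuous

theorem hasDerivAt_tail (w : 𝓢(ℝ, ℝ)) (x : ℝ) : HasDerivAt (tail w) (-(w x : ℂ)) x :=
  hasDerivAt_integral_Ioi (integrable_ofReal_schwartz w) (continuous_ofReal_schwartz w) x

theorem continuous_tail (w : 𝓢(ℝ, ℝ)) : Continuous (tail w) :=
  continuous_iff_continuousAt.mpr fun x => (hasDerivAt_tail w x).continuousAt

theorem tendsto_tail_atTop (w : 𝓢(ℝ, ℝ)) : Tendsto (tail w) atTop (𝓝 0) :=
  tendsto_integral_Ioi_zero tendsto_id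

theorem tendsto_tail_atBot (w : 𝓢(ℝ, ℝ)) : Tendsto (tail w) atBot (𝓝 (∫ s, (w s : ℂ))) :=
  tendsto_integral_Ioi_atBot (integrable_ofReal_schwartz w)

theorem norm_tail_le (w : 𝓢(ℝ, ℝ)) (x : ℝ) : ‖tail w x‖ ≤ ∫ s, ‖(w s : ℂ)‖ :=
  (norm_integral_le_integral_norm _).trans
    (setIntegral_le_integral (integrable_ofReal_schwartz w).norm (by filter_upwards; simp))

theorem integrable_mul_of_bounded (w : 𝓢(ℝ, ℝ)) {u : ℝ → ℂ} (hu : Continuous u)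
    (hb : ∃ C : ℝ, ∀ x, ‖u x‖ ≤ C) : Integrable fun s => (w s : ℂ) * u s := by
  obtain ⟨C, hC⟩ := hb
  exact (integrable_ofReal_schwartz w).mul_bdd hu.aestronglyMeasurable
    (c := C) (by filter_upwards; exact hC)

theorem hasDerivAt_exp_tail (w : 𝓢(ℝ, ℝ)) (a d : ℂ) (x : ℝ) :
    HasDerivAt (fun x => a * Complex.exp (-d * tail w x))
      (d * (w x * (a * Complex.exp (-d * tail w x)))) x := by
  have := (((hasDerivAt_tail w x).const_mul (-d)).cexp).const_mul a
  exact this.congr_deriv (by ring)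

theorem exp_tail_bounded (w : 𝓢(ℝ, ℝ)) (a d : ℂ) :
    ∃ C : ℝ, ∀ x, ‖a * Complex.exp (-d * tail w x)‖ ≤ C := by
  refine ⟨‖a‖ * Real.exp (‖d‖ * ∫ s, ‖(w s : ℂ)‖), fun x => ?_⟩
  rw [norm_mul]
  gcongr
  refine (Complex.norm_exp_le_exp_norm _).trans ?_
  rw [norm_mul, norm_neg]
  gcongr
  exact norm_tail_le w x

theorem continuous_exp_tail (w : 𝓢(ℝ, ℝ)) (a d : ℂ) :
    Continuous fun x => a * Complex.exp (-d * tail w x) := by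
  have := continuous_tail w
  fun_prop

theorem tendsto_exp_tail_atTop (w : 𝓢(ℝ, ℝ)) (a d : ℂ) :
    Tendsto (fun x => a * Complex.exp (-d * tail w x)) atTop (𝓝 a) := by
  have := ((Complex.continuous_exp.tendsto _).comp
    ((tendsto_tail_atTop w).const_mul (-d))).const_mul a
  simpa [Function.comp_def] using this

theorem exp_tail_eq (w : 𝓢(ℝ, ℝ)) (a d : ℂ) (x : ℝ) :
    a * Complex.exp (-d * tail w x) =
      a - ∫ s in Ioi x, d * (w s * (a * Complex.exp (-d * tail w s))) := by
  rw [integral_Ioi_of_hasDerivAt_of_tendsto (continuous_exp_tail w a d).continuousWithinAt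
    (fun x _ => hasDerivAt_exp_tail w a d x) _ (tendsto_exp_tail_atTop w a d)]
  · ring
  · exact ((integrable_mul_of_bounded w (continuous_exp_tail w a d)
      (exp_tail_bounded w a d)).const_mul d).integrableOn

/-- Uniqueness for the scalar Volterra equation: a bounded solution satisfies `u' = d w u` and tends
to `a` at `+∞`, so its product with the reciprocal exponential is constant, with value `a`. -/
theorem eq_exp_tail_of_eq (w : 𝓢(ℝ, ℝ)) {a d : ℂ} {u : ℝ → ℂ} (hu : Continuous u)
    (hb : ∃ C : ℝ, ∀ x, ‖u x‖ ≤ C) (h : ∀ x, u x = a - ∫ s in Ioi x, d * (w s * u s)) (x : ℝ) :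
    u x = a * Complex.exp (-d * tail w x) := by
  have hint := (integrable_mul_of_bounded w hu hb).const_mul d
  have hcont : Continuous fun s => d * (w s * u s) := by
    have := continuous_ofReal_schwartz w
    fun_prop
  have hderiv : ∀ x, HasDerivAt u (d * (w x * u x)) x := fun x => by
    have h1 := (hasDerivAt_integral_Ioi hint hcont x).const_sub a
    rw [neg_neg] at h1
    exact h1.congr_of_eventuallyEq (Eventually.of_forall h)
  have hlim : Tendsto u atTop (𝓝 a) := by
    have h1 : Tendsto (fun x => a - ∫ s in Ioi x, d * (w s * u s)) atTop (𝓝 (a - 0)) :=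
      tendsto_const_nhds.sub (tendsto_integral_Ioi_zero tendsto_id)
    rw [sub_zero] at h1
    exact h1.congr fun x => (h x).symm
  have hd : ∀ x, HasDerivAt (fun x => u x * (1 * Complex.exp (-(-d) * tail w x))) 0 x := fun x => by
    exact ((hderiv x).mul (hasDerivAt_exp_tail w 1 (-d) x)).congr_deriv (by ring)
  have hconst : ∀ x y, u x * (1 * Complex.exp (-(-d) * tail w x)) =
      u y * (1 * Complex.exp (-(-d) * tail w y)) :=
    is_const_of_deriv_eq_zero (fun x => (hd x).differentiableAt) (fun x => (hd x).deriv)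
  have hl2 : Tendsto (fun y => u y * (1 * Complex.exp (-(-d) * tail w y))) atTop (𝓝 (a * 1)) :=
    hlim.mul (tendsto_exp_tail_atTop w 1 (-d))
  have h3 : u x * (1 * Complex.exp (-(-d) * tail w x)) = a * 1 :=
    tendsto_nhds_unique (tendsto_const_nhds.congr (hconst x)) hl2
  have h4 : Complex.exp (- -d * tail w x) * Complex.exp (-d * tail w x) = 1 := by
    rw [← Complex.exp_add]; simp
  linear_combination Complex.exp (-d * tail w x) * h3 - u x * h4

theorem integral_mul_exp_tail (w : 𝓢(ℝ, ℝ)) (a d : ℂ) :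
    ∫ s, d * (w s * (a * Complex.exp (-d * tail w s))) =
      a - a * Complex.exp (-d * ∫ s, (w s : ℂ)) := by
  refine integral_of_hasDerivAt_of_tendsto (fun x => hasDerivAt_exp_tail w a d x)
    ((integrable_mul_of_bounded w (continuous_exp_tail w a d)
      (exp_tail_bounded w a d)).const_mul d) ?_ (tendsto_exp_tail_atTop w a d)
  exact ((Complex.continuous_exp.tendsto _).comp
    ((tendsto_tail_atBot w).const_mul (-d))).const_mul a

/-- `(K diag(d w) H J)` in coordinates. -/
theorem conj_diagonal_mul_apply (K H J : Matrix (Fin 3) (Fin 3) ℂ) (d : Fin 3 → ℂ) (c : ℂ)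
    (i j : Fin 3) : (K * Matrix.diagonal (fun l => d l * c) * H * J) i j =
      ∑ l, K i l * (d l * (c * (H * J) l j)) := by
  rw [mul_assoc, mul_assoc, Matrix.mul_apply]
  refine Finset.sum_congr rfl fun l _ => ?_
  rw [Matrix.diagonal_mul]
  ring

section Conjugated

variable (w : 𝓢(ℝ, ℝ)) {K H : Matrix (Fin 3) (Fin 3) ℂ} (d : Fin 3 → ℂ) (J : ℝ → Matrix (Fin 3) (Fin 3) ℂ)

/-- The matrix `H` does not depend on `x`, so `u = H J` turns the system for one column into three
independent scalar equations. Their solutions are exponentials of `tail w`, and the full-line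
integral follows from the fundamental theorem of calculus. The statement treats a single column
because only two columns of `J` are constrained. -/
theorem integral_conj_diagonal (hKH : K * H = 1) {j : Fin 3}
    (hc : ∀ i, Continuous fun x => J x i j) (hb : ∀ i, ∃ C : ℝ, ∀ x, ‖J x i j‖ ≤ C)
    (h : ∀ i x, J x i j = (1 : Matrix (Fin 3) (Fin 3) ℂ) i j -
      ∫ s in Ioi x, (K * Matrix.diagonal (fun l => d l * (w s : ℂ)) * H * J s) i j) (i : Fin 3) :
    (1 : Matrix (Fin 3) (Fin 3) ℂ) i j -
      ∫ s, (K * Matrix.diagonal (fun l => d l * (w s : ℂ)) * H * J s) i j =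
      ∑ l, K i l * H l j * Complex.exp (-d l * ∫ s, (w s : ℂ)) := by
  have hHK : H * K = 1 := mul_eq_one_comm.mp hKH
  set u : Fin 3 → ℝ → ℂ := fun l x => (H * J x) l j with hu
  have huc : ∀ l, Continuous (u l) := fun l => by
    simp only [hu, Matrix.mul_apply]
    exact continuous_finsetSum _ fun m _ => (hc m).const_mul _
  have hub : ∀ l, ∃ C : ℝ, ∀ x, ‖u l x‖ ≤ C := fun l => by
    choose C hC using hb
    refine ⟨∑ m, ‖H l m‖ * C m, fun x => ?_⟩
    simp only [hu, Matrix.mul_apply]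
    refine (norm_sum_le _ _).trans (Finset.sum_le_sum fun m _ => ?_)
    rw [norm_mul]
    gcongr
    exact hC m x
  have hint : ∀ l, Integrable fun s => d l * ((w s : ℂ) * u l s) := fun l =>
    (integrable_mul_of_bounded w (huc l) (hub l)).const_mul _
  simp only [conj_diagonal_mul_apply] at h ⊢
  have hueq : ∀ l x, u l x = H l j - ∫ s in Ioi x, d l * ((w s : ℂ) * u l s) := fun l x => by
    have e : ∀ m, ∫ s in Ioi x, ∑ l, K m l * (d l * ((w s : ℂ) * (H * J s) l j)) =
        ∑ l, K m l * ∫ s in Ioi x, d l * ((w s : ℂ) * u l s) := fun m => by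
      rw [integral_finsetSum]
      · exact Finset.sum_congr rfl fun l _ => integral_const_mul _ _
      · exact fun l _ => ((hint l).const_mul _).integrableOn
    have e2 : ∀ m, J x m j = (1 : Matrix (Fin 3) (Fin 3) ℂ) m j -
        (K *ᵥ fun l => ∫ s in Ioi x, d l * ((w s : ℂ) * u l s)) m := fun m => by
      rw [h m x, e m]; rfl
    have e3 : u l x = (H *ᵥ fun m => J x m j) l := rfl
    rw [e3, funext e2]
    have e4 : (fun m => (1 : Matrix (Fin 3) (Fin 3) ℂ) m j -
        (K *ᵥ fun l => ∫ s in Ioi x, d l * ((w s : ℂ) * u l s)) m) =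
        (fun m => (1 : Matrix (Fin 3) (Fin 3) ℂ) m j) -
        (K *ᵥ fun l => ∫ s in Ioi x, d l * ((w s : ℂ) * u l s)) := rfl
    rw [e4, Matrix.mulVec_sub, Matrix.mulVec_mulVec, hHK, Matrix.one_mulVec, Pi.sub_apply]
    congr 1
    change (H * (1 : Matrix (Fin 3) (Fin 3) ℂ)) l j = _
    rw [mul_one]
  have hsol : ∀ l, u l = fun x => H l j * Complex.exp (-d l * tail w x) := fun l =>
    funext (eq_exp_tail_of_eq w (huc l) (hub l) (hueq l))
  rw [integral_finsetSum _ fun l _ => (hint l).const_mul _]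
  simp only [integral_const_mul]
  have e6 : ∀ l, d l * ∫ s, (w s : ℂ) * u l s =
      H l j - H l j * Complex.exp (-d l * ∫ s, (w s : ℂ)) := fun l => by
    rw [← integral_const_mul, hsol l, integral_mul_exp_tail]
  simp only [e6]
  rw [← hKH, Matrix.mul_apply, ← Finset.sum_sub_distrib]
  exact Finset.sum_congr rfl fun l _ => by ring

/-- Existence by the same decoupling read backwards: the witness is `K exp(-d tail) H`. -/
theorem exists_conj_diagonal (hKH : K * H = 1) : ∃ J : ℝ → Matrix (Fin 3) (Fin 3) ℂ, ∀ i j,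
    (Continuous fun x => J x i j) ∧ (∃ C : ℝ, ∀ x, ‖J x i j‖ ≤ C) ∧
    ∀ x, J x i j = (1 : Matrix (Fin 3) (Fin 3) ℂ) i j -
      ∫ s in Ioi x, (K * Matrix.diagonal (fun l => d l * (w s : ℂ)) * H * J s) i j := by
  have hHK : H * K = 1 := mul_eq_one_comm.mp hKH
  set u : ℝ → Matrix (Fin 3) (Fin 3) ℂ := fun x =>
    Matrix.of fun l j => H l j * Complex.exp (-d l * tail w x) with hu
  refine ⟨fun x => K * u x, fun i j => ⟨?_, ?_, fun x => ?_⟩⟩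
  · simp only [Matrix.mul_apply]
    exact continuous_finsetSum _ fun m _ => (continuous_exp_tail w (H m j) (d m)).const_mul _
  · choose C hC using fun m => exp_tail_bounded w (H m j) (d m)
    refine ⟨∑ m, ‖K i m‖ * C m, fun x => ?_⟩
    simp only [Matrix.mul_apply]
    refine (norm_sum_le _ _).trans (Finset.sum_le_sum fun m _ => ?_)
    rw [norm_mul]
    gcongr
    exact hC m x
  · simp only [conj_diagonal_mul_apply, ← mul_assoc H K, hHK, one_mul]
    rw [integral_finsetSum]
    · simp only [integral_const_mul, Matrix.mul_apply]
      rw [← hKH, Matrix.mul_apply, ← Finset.sum_sub_distrib]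
      refine Finset.sum_congr rfl fun l _ => ?_
      have := exp_tail_eq w (H l j) (d l) x
      simp only [integral_const_mul] at this
      simp only [hu, Matrix.of_apply]
      linear_combination K i l * this
    · exact fun l _ => (((integrable_mul_of_bounded w (continuous_exp_tail w (H l j) (d l))
        (exp_tail_bounded w (H l j) (d l))).const_mul _).const_mul _).integrableOn

end Conjugated

/-- The inverse of the gauge matrix. -/
noncomputable def gaugeInv : Matrix (Fin 3) (Fin 3) ℂ :=
  (1 / 3 : ℂ) • !![om ^ 2, om, 1; om, om ^ 2, 1; 1, 1, 1]

theorem gaugeInv_mul_gauge : gaugeInv * gauge = 1 := by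
  have h1 := om_cube
  have h2 := om_sq_add
  unfold gaugeInv gauge
  rw [Matrix.smul_mul, Matrix.mul_fin_three, Matrix.one_fin_three, Matrix.smul_of]
  ext i j
  fin_cases i <;> fin_cases j <;> simp
  · linear_combination (2 / 3) * h1
  · linear_combination om * h1 + h2
  · linear_combination h2
  · linear_combination om * h1 + h2
  · linear_combination (2 / 3) * h1
  · linear_combination h2
  · linear_combination h2
  · linear_combination h2
  · norm_num

theorem gauge_inv_eq : gauge⁻¹ = gaugeInv := Matrix.inv_eq_left_inv gaugeInv_mul_gauge

/-- The diagonal `(0, -1, 1)` of the potential. -/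
def potentialDiag : Fin 3 → ℂ := ![0, -1, 1]

theorem potential_eq (w : 𝓢(ℝ, ℝ)) (x : ℝ) :
    potential w x = gaugeInv * Matrix.diagonal (fun l => potentialDiag l * (w x : ℂ)) * gauge := by
  unfold potential
  rw [gauge_inv_eq]
  congr 3
  ext l
  fin_cases l <;> simp [potentialDiag]

theorem gauge_transpose : gaugeᵀ = gauge := by
  unfold gauge
  ext i j
  fin_cases i <;> fin_cases j <;> rfl

theorem gaugeInv_transpose : gaugeInvᵀ = gaugeInv := by
  unfold gaugeInv
  ext i j
  fin_cases i <;> fin_cases j <;> rfl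

/-- As `G` and `G⁻¹` are symmetric, transposition exchanges their roles. The two minus signs cancel;
they are written so that the adjoint equation, which carries the opposite sign in front of its
integral, takes the form of the direct one with `-d` in place of `d`. -/
theorem potential_transpose_eq (w : 𝓢(ℝ, ℝ)) (x : ℝ) : (potential w x)ᵀ =
    -(gauge * Matrix.diagonal (fun l => (-potentialDiag) l * (w x : ℂ)) * gaugeInv) := by
  rw [potential_eq, Matrix.transpose_mul, Matrix.transpose_mul, gauge_transpose,
    gaugeInv_transpose, Matrix.diagonal_transpose, ← mul_assoc]
  have : (Matrix.diagonal fun l => (-potentialDiag) l * (w x : ℂ)) =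
      -Matrix.diagonal fun l => potentialDiag l * (w x : ℂ) := by
    rw [Matrix.diagonal_neg]
    congr 1
    ext l
    simp
  rw [this, mul_neg, neg_mul, neg_neg]

theorem isJost_zero_iff (w : 𝓢(ℝ, ℝ)) (J : ℝ → Matrix (Fin 3) (Fin 3) ℂ) :
    IsJost w 0 J ↔ ∀ i j : Fin 3, j ≠ 2 →
      Continuous (fun x => J x i j) ∧ (∃ C : ℝ, ∀ x, ‖J x i j‖ ≤ C) ∧
      ∀ x : ℝ, J x i j = (1 : Matrix (Fin 3) (Fin 3) ℂ) i j - ∫ s in Ioi x,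
        (gaugeInv * Matrix.diagonal (fun l => potentialDiag l * (w s : ℂ)) * gauge * J s) i j := by
  simp [IsJost, potential_eq]

theorem isAdjointJost_zero_iff (w : 𝓢(ℝ, ℝ)) (J : ℝ → Matrix (Fin 3) (Fin 3) ℂ) :
    IsAdjointJost w 0 J ↔ ∀ i j : Fin 3, j ≠ 2 →
      Continuous (fun x => J x i j) ∧ (∃ C : ℝ, ∀ x, ‖J x i j‖ ≤ C) ∧
      ∀ x : ℝ, J x i j = (1 : Matrix (Fin 3) (Fin 3) ℂ) i j - ∫ s in Ioi x,
        (gauge * Matrix.diagonal (fun l => (-potentialDiag) l * (w s : ℂ)) * gaugeInv * J s) i j := by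
  simp [IsAdjointJost, potential_transpose_eq, integral_neg, sub_eq_add_neg, -Pi.neg_apply]

theorem scat_zero {w : 𝓢(ℝ, ℝ)} {J : ℝ → Matrix (Fin 3) (Fin 3) ℂ} (hJ : IsJost w 0 J)
    (i : Fin 3) {j : Fin 3} (hj : j ≠ 2) : scat w 0 J i j =
      ∑ l, gaugeInv i l * gauge l j * Complex.exp (-potentialDiag l * ∫ s, (w s : ℂ)) := by
  rw [isJost_zero_iff] at hJ
  rw [← integral_conj_diagonal w potentialDiag J gaugeInv_mul_gauge (fun i => (hJ i j hj).1)
    (fun i => (hJ i j hj).2.1) (fun i => (hJ i j hj).2.2) i]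
  simp [scat, potential_eq]

theorem adjointScat_zero {w : 𝓢(ℝ, ℝ)} {J : ℝ → Matrix (Fin 3) (Fin 3) ℂ}
    (hJ : IsAdjointJost w 0 J) (i : Fin 3) {j : Fin 3} (hj : j ≠ 2) : adjointScat w 0 J i j =
      ∑ l, gauge i l * gaugeInv l j * Complex.exp (-(-potentialDiag) l * ∫ s, (w s : ℂ)) := by
  rw [isAdjointJost_zero_iff] at hJ
  rw [← integral_conj_diagonal w (-potentialDiag) J (mul_eq_one_comm.mp gaugeInv_mul_gauge)
    (fun i => (hJ i j hj).1) (fun i => (hJ i j hj).2.1) (fun i => (hJ i j hj).2.2) i]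
  simp [adjointScat, potential_transpose_eq, integral_neg, sub_eq_add_neg, -Pi.neg_apply]

/-- Here `a = e^{∫ w}` and `b = e^{-∫ w}`. Recording only these two positive numbers with product
one reduces the rest of part (ii) to algebra with cube roots of unity. -/
theorem exists_pos_scat (w : 𝓢(ℝ, ℝ)) : ∃ a b : ℝ, 0 < a ∧ 0 < b ∧ a * b = 1 ∧
    (∀ J, IsJost w 0 J → scat w 0 J 0 0 = (1 + a + b) / 3 ∧
      scat w 0 J 0 1 = (om + om ^ 2 * a + b) / 3) ∧
    (∀ J, IsAdjointJost w 0 J → adjointScat w 0 J 0 0 = (1 + a + b) / 3 ∧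
      adjointScat w 0 J 0 1 = (om ^ 2 + om * b + a) / 3) := by
  have h1 := om_cube
  refine ⟨Real.exp (∫ s, w s), Real.exp (-∫ s, w s), Real.exp_pos _, Real.exp_pos _, ?_,
    fun J hJ => ?_, fun J hJ => ?_⟩
  · rw [← Real.exp_add]; simp
  · rw [scat_zero hJ 0 (by decide), scat_zero hJ 0 (by decide)]
    simp only [Fin.sum_univ_three, potentialDiag, gaugeInv, gauge, Matrix.smul_apply, smul_eq_mul]
    simp [integral_complex_ofReal]
    constructor
    · linear_combination (1 / 3) * (1 + Complex.exp (∫ s, w s : ℝ)) * h1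
    · linear_combination (1 / 3) * om * h1
  · rw [adjointScat_zero hJ 0 (by decide), adjointScat_zero hJ 0 (by decide)]
    simp only [Fin.sum_univ_three, potentialDiag, gaugeInv, gauge, Matrix.smul_apply, smul_eq_mul]
    simp [integral_complex_ofReal]
    constructor
    · linear_combination (1 / 3) * (1 + Complex.exp (-(∫ s, w s : ℝ))) * h1
    · linear_combination (1 / 3) * om * Complex.exp (-(∫ s, w s : ℝ)) * h1

/-- The hypotheses say that `c` is a primitive cube root of unity. The numerator then has squared
norm `1 + a² + b² - a - b - ab`, which is smaller than `(1 + a + b)²` because all cross terms have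
changed sign. -/
theorem norm_div_lt_one {c : ℂ} (hc : c + conj c = -1) (hcc : c * conj c = 1) {a b : ℝ}
    (ha : 0 < a) (hb : 0 < b) (hab : a * b = 1) :
    ‖(c + conj c * a + b) / ((1 + a + b : ℝ) : ℂ)‖ < 1 := by
  have hs : 0 < 1 + a + b := by positivity
  rw [norm_div, Complex.norm_real, Real.norm_of_nonneg hs.le, div_lt_one hs]
  have hsq : ‖c + conj c * a + b‖ ^ 2 = 1 + a ^ 2 + b ^ 2 - a - b - a * b := by
    rw [← Complex.normSq_eq_norm_sq]
    apply Complex.ofReal_injective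
    rw [← Complex.mul_conj]
    simp only [map_add, map_mul, Complex.conj_conj, Complex.conj_ofReal]
    push_cast
    have hc2 : conj c ^ 2 = -conj c - 1 := by linear_combination conj c * hc - hcc
    have hc3 : c ^ 2 = -c - 1 := by linear_combination c * hc - hcc
    linear_combination (1 + (a : ℂ) ^ 2) * hcc + (a : ℂ) * hc2 + (a : ℂ) * hc3 +
      (b - a + a * b : ℂ) * hc
  refine lt_of_pow_lt_pow_left₀ 2 hs.le ?_
  rw [hsq]
  nlinarith

theorem exists_reflection_zero (w : 𝓢(ℝ, ℝ)) :
    ∃ r₁ r₂ : ℂ, IsReflection₁ w 0 r₁ ∧ IsReflection₂ w 0 r₂ := by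
  obtain ⟨a, b, ha, hb, -, h1, h2⟩ := exists_pos_scat w
  obtain ⟨J, hJ⟩ := exists_conj_diagonal w potentialDiag gaugeInv_mul_gauge
  obtain ⟨J', hJ'⟩ := exists_conj_diagonal w (-potentialDiag) (mul_eq_one_comm.mp gaugeInv_mul_gauge)
  have hJost := (isJost_zero_iff w J).mpr fun i j _ => hJ i j
  have hJost' := (isAdjointJost_zero_iff w J').mpr fun i j _ => hJ' i j
  have hne : ((1 + a + b) / 3 : ℂ) ≠ 0 := by
    have : (0 : ℝ) < (1 + a + b) / 3 := by positivity
    exact_mod_cast this.ne'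
  exact ⟨_, _, ⟨J, hJost, by rw [(h1 J hJost).1]; exact hne, rfl⟩,
    ⟨J', hJost', by rw [(h2 J' hJost').1]; exact hne, rfl⟩⟩

theorem reflection_zero {w : 𝓢(ℝ, ℝ)} {r₁ r₂ : ℂ} (hr₁ : IsReflection₁ w 0 r₁)
    (hr₂ : IsReflection₂ w 0 r₂) :
    ‖r₁‖ < 1 ∧ ‖r₂‖ < 1 ∧ Relations r₁ r₂ ∧ r₁ = om ^ 2 * r₂ := by
  obtain ⟨a, b, ha, hb, hab, h1, h2⟩ := exists_pos_scat w
  obtain ⟨J, hJ, -, e1⟩ := hr₁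
  obtain ⟨J', hJ', -, e2⟩ := hr₂
  rw [(h1 J hJ).1, (h1 J hJ).2, div_div_div_cancel_right₀ (by norm_num)] at e1
  rw [(h2 J' hJ').1, (h2 J' hJ').2, div_div_div_cancel_right₀ (by norm_num)] at e2
  have o1 := om_cube
  have o2 := om_sq_add
  have hne : (1 + a + b : ℂ) ≠ 0 := by
    have : (0 : ℝ) < 1 + a + b := by positivity
    exact_mod_cast this.ne'
  have habc : (a * b : ℂ) = 1 := by exact_mod_cast hab
  have n1 : ‖r₁‖ < 1 := by
    have := norm_div_lt_one (c := om) (by rw [conj_om]; linear_combination o2)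
      (by rw [conj_om]; linear_combination o1) ha hb hab
    rw [conj_om] at this
    rw [e1]
    exact_mod_cast this
  have hrel : r₁ = om ^ 2 * r₂ := by
    rw [e1, e2, mul_div_assoc', div_left_inj' hne]
    linear_combination (-om - b) * o1
  have n2 : ‖r₂‖ < 1 := by
    have : ‖om‖ = 1 := by
      have h := congrArg norm o1
      rw [norm_pow, norm_one] at h
      exact (pow_eq_one_iff_of_nonneg (norm_nonneg _) (by norm_num)).mp h
    rw [hrel, norm_mul, norm_pow, this] at n1
    simpa using n1
  refine ⟨n1, n2, (relations_iff n1 n2).mpr ?_, hrel⟩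
  rw [e1, e2]
  simp only [map_add, map_mul, map_div₀, map_pow, Complex.conj_ofReal, conj_om, map_one]
  have e2' : om ^ 2 = -1 - om := by linear_combination o2
  have e4 : (om ^ 2) ^ 2 = om := by linear_combination om * o1
  rw [e4, e2', div_mul_div_comm, div_add_div _ _ hne (mul_ne_zero hne hne),
    div_add_div _ _ (mul_ne_zero hne (mul_ne_zero hne hne)) hne, div_eq_zero_iff]
  left
  -- The numerator of the relation over the common denominator `(1 + a + b)²`. It vanishes only
  -- because `ab = 1`, that is, because the exponentials of `±∫ w` are reciprocal.
  have key : (-1 - om + om * a + b) * (1 + a + b) +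
      (om + (-1 - om) * a + b) * (om + (-1 - om) * b + a) +
      (-1 - om + om * b + a) * (1 + a + b) = 0 := by
    linear_combination (3 * (1 + om)) * habc + (1 - (a + b : ℂ) + a * b) * o2
  linear_combination (1 + a + b : ℂ) ^ 2 * key

open scoped Interval

/-! ### Complex analysis -/

section ComplexAnalysis

variable {E : Type*} [NormedAddCommGroup E] [NormedSpace ℂ E] [CompleteSpace E]

/-- A continuous function that is holomorphic off a horizontal line is holomorphic. -/
theorem differentiableOn_ball_of_off_line {f : ℂ → E} {c : ℂ} {r : ℝ}
    (hc : ContinuousOn f (Metric.ball c r))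
    (hd : ∀ z ∈ Metric.ball c r, z.im ≠ c.im → DifferentiableAt ℂ f z) :
    DifferentiableOn ℂ f (Metric.ball c r) := by
  refine (Complex.IsConservativeOn.isExactOn_ball hc fun z w hzw => ?_).differentiableOn
    Metric.isOpen_ball
  rw [← add_eq_zero_iff_eq_neg, wedgeIntegral_add_wedgeIntegral_eq]
  have hrect : ([[z.re, w.re]] ×ℂ [[z.im, w.im]]) ⊆ Metric.ball c r := hzw
  -- Morera's theorem: the integral over the boundary of every rectangle must vanish. A rectangle
  -- that meets the line is cut along it. Inside each half `f` is holomorphic, and it is continuous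
  -- up to the cut, so both boundary integrals vanish; the two integrals along the cut cancel in the
  -- sum.
  by_cases hm : c.im ∈ [[z.im, w.im]]
  · have sub1 : ([[z.re, w.re]] ×ℂ [[z.im, c.im]]) ⊆ [[z.re, w.re]] ×ℂ [[z.im, w.im]] :=
      reProdIm_subset_iff.mpr (Set.prod_mono le_rfl (uIcc_subset_uIcc_left hm))
    have sub2 : ([[z.re, w.re]] ×ℂ [[c.im, w.im]]) ⊆ [[z.re, w.re]] ×ℂ [[z.im, w.im]] :=
      reProdIm_subset_iff.mpr (Set.prod_mono le_rfl (uIcc_subset_uIcc_right hm))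
    have h1 := integral_boundary_rect_eq_zero_of_continuousOn_of_differentiableOn f z ⟨w.re, c.im⟩
      (hc.mono (sub1.trans hrect)) (fun u hu => by
        have hu' : u ∈ [[z.re, w.re]] ×ℂ [[z.im, c.im]] :=
          ⟨Ioo_subset_Icc_self hu.1, Ioo_subset_Icc_self hu.2⟩
        refine (hd u (hrect (sub1 hu')) fun h => ?_).differentiableWithinAt
        have h2 := hu.2
        simp only [mem_preimage, mem_Ioo, h] at h2
        rcases le_total z.im c.im with h3 | h3 <;> simp [h3] at h2)
    have h2 := integral_boundary_rect_eq_zero_of_continuousOn_of_differentiableOn f ⟨z.re, c.im⟩ w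
      (hc.mono (sub2.trans hrect)) (fun u hu => by
        have hu' : u ∈ [[z.re, w.re]] ×ℂ [[c.im, w.im]] :=
          ⟨Ioo_subset_Icc_self hu.1, Ioo_subset_Icc_self hu.2⟩
        refine (hd u (hrect (sub2 hu')) fun h => ?_).differentiableWithinAt
        have h2 := hu.2
        simp only [mem_preimage, mem_Ioo, h] at h2
        rcases le_total w.im c.im with h3 | h3 <;> simp [h3] at h2)
    have hvert : ∀ a ∈ [[z.re, w.re]], ∀ p q : ℝ, [[p, q]] ⊆ [[z.im, w.im]] →
        IntervalIntegrable (fun y : ℝ => f (a + y * I)) volume p q := fun a ha p q hpq => by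
      refine ContinuousOn.intervalIntegrable ?_
      refine hc.comp (by fun_prop) fun y hy => hrect ⟨?_, ?_⟩
      · simpa using ha
      · simpa using hpq hy
    have e1 := intervalIntegral.integral_add_adjacent_intervals
      (hvert w.re right_mem_uIcc z.im c.im (uIcc_subset_uIcc_left hm))
      (hvert w.re right_mem_uIcc c.im w.im (uIcc_subset_uIcc_right hm))
    have e2 := intervalIntegral.integral_add_adjacent_intervals
      (hvert z.re left_mem_uIcc z.im c.im (uIcc_subset_uIcc_left hm))
      (hvert z.re left_mem_uIcc c.im w.im (uIcc_subset_uIcc_right hm))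
    rw [← e1, ← e2, smul_add, smul_add]
    have := congrArg₂ (· + ·) h1 h2
    simp only [add_zero] at this
    rw [← this]
    abel
  · refine integral_boundary_rect_eq_zero_of_differentiableOn f z w fun u hu => ?_
    refine (hd u (hrect hu) fun h => hm ?_).differentiableWithinAt
    rw [← h]
    exact hu.2

/-- An entire function of polynomial growth is a polynomial. -/
theorem exists_polynomial_of_growth (n : ℕ) {f : ℂ → E} (hf : Differentiable ℂ f) {C R : ℝ}
    (hb : ∀ z, R ≤ ‖z‖ → ‖f z‖ ≤ C * ‖z‖ ^ n) :
    ∃ a : ℕ → E, ∀ z, f z = ∑ k ∈ Finset.range (n + 1), z ^ k • a k := by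
  induction n generalizing f C R with
  | zero =>
    obtain ⟨B, hB⟩ := (isCompact_closedBall (0 : ℂ) R).exists_bound_of_continuousOn
      hf.continuous.continuousOn
    obtain ⟨c, hc⟩ := hf.exists_const_forall_eq_of_bounded <|
      isBounded_iff_forall_norm_le.mpr ⟨max B C, by
        rintro _ ⟨z, rfl⟩
        rcases le_total R ‖z‖ with h | h
        · exact le_max_of_le_right (by simpa using hb z h)
        · exact le_max_of_le_left (hB z (by simpa using h))⟩
    exact ⟨fun _ => c, fun z => by simp [hc z]⟩
  | succ n ih =>
    -- Passing to `(f(z) - f(0)) / z` lowers the order of growth by one; Liouville's theorem is the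
    -- base case.
    have hg : Differentiable ℂ (dslope f 0) := by
      rw [← differentiableOn_univ, differentiableOn_dslope univ_mem]
      exact hf.differentiableOn
    obtain ⟨a, ha⟩ := ih hg (C := C + ‖f 0‖) (R := max R 1) fun z hz => by
      have h1 : 1 ≤ ‖z‖ := (le_max_right _ _).trans hz
      have h0 : z ≠ 0 := fun h => by simp [h] at h1; linarith
      rw [dslope_of_ne _ h0, slope_def_module, sub_zero, norm_smul, norm_inv,
        inv_mul_le_iff₀ (by positivity)]
      have h2 := hb z ((le_max_left _ _).trans hz)
      have h3 : ‖f 0‖ * 1 ≤ ‖f 0‖ * ‖z‖ ^ (n + 1) := by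
        gcongr
        exact one_le_pow₀ h1
      calc ‖f z - f 0‖ ≤ ‖f z‖ + ‖f 0‖ := norm_sub_le _ _
        _ ≤ C * ‖z‖ ^ (n + 1) + ‖f 0‖ * ‖z‖ ^ (n + 1) := by linarith
        _ = _ := by ring
    refine ⟨fun k => if k = 0 then f 0 else a (k - 1), fun z => ?_⟩
    rw [Finset.sum_range_succ']
    simp only [Nat.add_eq_zero_iff, one_ne_zero, and_false, if_false, Nat.add_sub_cancel, pow_zero,
      if_true, one_smul]
    have h1 := sub_smul_dslope f 0 z
    rw [sub_zero] at h1
    have h2 : f z = z • dslope f 0 z + f 0 := by rw [h1]; simp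
    rw [h2, ha z, Finset.smul_sum]
    congr 1
    exact Finset.sum_congr rfl fun k _ => by rw [smul_smul, pow_succ']

end ComplexAnalysis

/-! ### Cauchy's formula for sectors, in the logarithmic variable -/

open scoped Interval

section SectorialCauchy

variable {E : Type*} [NormedAddCommGroup E] [NormedSpace ℂ E] [CompleteSpace E]

theorem tendsto_intervalIntegral_of_uniform {F : ℝ → ℝ → E} {c : E} {a b : ℝ} (hab : a ≤ b)
    (hF : ∀ᶠ R in atTop, ContinuousOn (F R) (Icc a b))
    (h : ∀ ε > 0, ∀ᶠ R in atTop, ∀ y ∈ Icc a b, ‖F R y - c‖ ≤ ε) :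
    Tendsto (fun R => ∫ y in a..b, F R y) atTop (𝓝 ((b - a) • c)) := by
  rw [Metric.tendsto_atTop']
  intro ε hε
  have hpos : 0 < ε / (2 * (b - a + 1)) := by
    have : 0 < b - a + 1 := by linarith
    positivity
  obtain ⟨X, hX⟩ := eventually_atTop.mp (hF.and (h _ hpos))
  refine ⟨X, fun R hR => ?_⟩
  obtain ⟨h1, h2⟩ := hX R hR.le
  have hint : IntervalIntegrable (F R) volume a b :=
    ContinuousOn.intervalIntegrable (by rwa [uIcc_of_le hab])
  rw [dist_eq_norm, ← intervalIntegral.integral_const,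
    ← intervalIntegral.integral_sub hint intervalIntegrable_const]
  refine (intervalIntegral.norm_integral_le_of_norm_le_const (C := ε / (2 * (b - a + 1)))
    fun y hy => ?_).trans_lt ?_
  · rw [uIoc_of_le hab] at hy
    exact h2 y (Ioc_subset_Icc_self hy)
  · rw [abs_of_nonneg (by linarith), div_mul_eq_mul_div, div_lt_iff₀ (by linarith)]
    nlinarith

theorem norm_exp_add_mul_I (x φ : ℝ) : ‖Complex.exp (x + φ * I)‖ = Real.exp x := by
  rw [Complex.norm_exp]; simp

theorem exp_ne_of_re_ne {u ζ : ℂ} (h : u.re ≠ ζ.re) : Complex.exp u ≠ Complex.exp ζ := by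
  intro he
  have := congrArg norm he
  rw [Complex.norm_exp, Complex.norm_exp] at this
  exact h (Real.exp_injective this)

theorem exp_ne_of_im {u ζ : ℂ} (h1 : u.im ≠ ζ.im) (h2 : |u.im - ζ.im| < 2 * Real.pi) :
    Complex.exp u ≠ Complex.exp ζ := by
  intro he
  obtain ⟨n, hn⟩ := Complex.exp_eq_exp_iff_exists_int.mp he
  have him : u.im = ζ.im + n * (2 * Real.pi) := by
    rw [hn]; simp
  rw [him, add_sub_cancel_left, abs_mul, abs_of_pos Real.two_pi_pos] at h2
  have h3 : |(n : ℝ)| < 1 := by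
    by_contra! h
    nlinarith [Real.two_pi_pos]
  have h4 : n = 0 := by
    have : |n| < 1 := by exact_mod_cast h3
    exact Int.abs_lt_one_iff.mp this
  exact h1 (by rw [him, h4]; simp)

/-- The integrand of the Cauchy integral of `g` in the logarithmic variable. -/
noncomputable def cauchyKernel (ζ u : ℂ) : ℂ :=
  Complex.exp u / (Complex.exp u - Complex.exp ζ)

theorem cauchyKernel_eq {ζ u : ℂ} (h : Complex.exp u ≠ Complex.exp ζ) :
    cauchyKernel ζ u = 1 + Complex.exp ζ / (Complex.exp u - Complex.exp ζ) := by
  have : Complex.exp u - Complex.exp ζ ≠ 0 := sub_ne_zero.mpr h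
  unfold cauchyKernel
  field_simp
  ring

theorem continuousOn_cauchyKernel (ζ : ℂ) :
    ContinuousOn (cauchyKernel ζ) {u | Complex.exp u ≠ Complex.exp ζ} := by
  unfold cauchyKernel
  exact ContinuousOn.div (by fun_prop) (by fun_prop) fun u hu => sub_ne_zero.mpr hu

omit [CompleteSpace E] in
theorem boundary_rect_cauchyKernel_of_ne {g : ℂ → E} (hg : Differentiable ℂ g) {ζ : ℂ} (c : E)
    {R a b : ℝ} (hR : ∀ u : ℂ, u.im ∈ [[a, b]] → Complex.exp u ≠ Complex.exp ζ) :
    (∫ x in (-R)..R, cauchyKernel ζ (x + a * I) • (g (Complex.exp (x + a * I)) - c)) -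
    (∫ x in (-R)..R, cauchyKernel ζ (x + b * I) • (g (Complex.exp (x + b * I)) - c)) +
    I • (∫ y in a..b, cauchyKernel ζ (R + y * I) • (g (Complex.exp (R + y * I)) - c)) -
    I • (∫ y in a..b, cauchyKernel ζ (-R + y * I) • (g (Complex.exp (-R + y * I)) - c)) = 0 := by
  have := integral_boundary_rect_eq_zero_of_differentiableOn
    (fun u => cauchyKernel ζ u • (g (Complex.exp u) - c)) ⟨-R, a⟩ ⟨R, b⟩ (fun u hu => by
      refine DifferentiableAt.differentiableWithinAt ?_
      have h1 : Complex.exp u - Complex.exp ζ ≠ 0 := sub_ne_zero.mpr (hR u hu.2)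
      unfold cauchyKernel
      have := hg (Complex.exp u)
      refine DifferentiableAt.fun_smul (DifferentiableAt.fun_div (by fun_prop) (by fun_prop) h1) ?_
      exact (this.comp u (by fun_prop)).sub_const c)
  simpa using this

/-- The strip that contains `ζ`: subtracting the value at `e^ζ` makes the pole of the kernel
removable, since the integrand becomes `e^u` times a difference quotient of `g`. The bounds on `a`
and `b` exclude the other preimages `ζ + 2πik` from the two horizontal sides. -/
theorem boundary_rect_cauchyKernel_self {g : ℂ → E} (hg : Differentiable ℂ g) {ζ : ℂ}
    {R a b : ℝ} (ha : a < ζ.im) (hb : ζ.im < b) (ha' : ζ.im < a + 2 * Real.pi)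
    (hb' : b < ζ.im + 2 * Real.pi) (hR : |ζ.re| < R) :
    (∫ x in (-R)..R, cauchyKernel ζ (x + a * I) •
        (g (Complex.exp (x + a * I)) - g (Complex.exp ζ))) -
    (∫ x in (-R)..R, cauchyKernel ζ (x + b * I) •
        (g (Complex.exp (x + b * I)) - g (Complex.exp ζ))) +
    I • (∫ y in a..b, cauchyKernel ζ (R + y * I) •
        (g (Complex.exp (R + y * I)) - g (Complex.exp ζ))) -
    I • (∫ y in a..b, cauchyKernel ζ (-R + y * I) •
        (g (Complex.exp (-R + y * I)) - g (Complex.exp ζ))) = 0 := by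
  have hd : Differentiable ℂ (dslope g (Complex.exp ζ)) := by
    rw [← differentiableOn_univ, differentiableOn_dslope univ_mem]
    exact hg.differentiableOn
  have := integral_boundary_rect_eq_zero_of_differentiableOn
    (fun u => Complex.exp u • dslope g (Complex.exp ζ) (Complex.exp u)) ⟨-R, a⟩ ⟨R, b⟩
    (Differentiable.differentiableOn (by fun_prop))
  simp only at this
  have key : ∀ u : ℂ, Complex.exp u ≠ Complex.exp ζ →
      Complex.exp u • dslope g (Complex.exp ζ) (Complex.exp u) =
        cauchyKernel ζ u • (g (Complex.exp u) - g (Complex.exp ζ)) := fun u hu => by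
    rw [dslope_of_ne _ hu, slope_def_module, smul_smul, cauchyKernel, div_eq_mul_inv]
  have hR' := abs_lt.mp hR
  have k1 : ∀ x : ℝ, Complex.exp (x + a * I) ≠ Complex.exp ζ := fun x =>
    exp_ne_of_im (by simpa using ha.ne) (by simp [abs_lt]; constructor <;> linarith)
  have k2 : ∀ x : ℝ, Complex.exp (x + b * I) ≠ Complex.exp ζ := fun x =>
    exp_ne_of_im (by simpa using hb.ne') (by simp [abs_lt]; constructor <;> linarith)
  have k3 : ∀ y : ℝ, Complex.exp (R + y * I) ≠ Complex.exp ζ := fun y =>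
    exp_ne_of_re_ne (by simpa using hR'.2.ne')
  have k4 : ∀ y : ℝ, Complex.exp (-R + y * I) ≠ Complex.exp ζ := fun y =>
    exp_ne_of_re_ne (by simpa using hR'.1.ne)
  simp only [key _ (k1 _), key _ (k2 _), key _ (k3 _)] at this
  have e4 : ∀ y : ℝ, (((-R : ℝ) : ℂ) + y * I) = -R + y * I := fun y => by push_cast; ring
  simp only [e4, key _ (k4 _)] at this
  exact this

theorem norm_cauchyKernel_sub_one_le {ζ u : ℂ} (h : ‖Complex.exp ζ‖ < ‖Complex.exp u‖) :
    ‖cauchyKernel ζ u - 1‖ ≤ ‖Complex.exp ζ‖ / (‖Complex.exp u‖ - ‖Complex.exp ζ‖) := by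
  have hne : Complex.exp u ≠ Complex.exp ζ := fun he => by rw [he] at h; exact lt_irrefl _ h
  rw [cauchyKernel_eq hne, add_sub_cancel_left, norm_div]
  have : 0 < ‖Complex.exp u‖ - ‖Complex.exp ζ‖ := sub_pos.mpr h
  gcongr
  exact norm_sub_norm_le _ _

theorem norm_cauchyKernel_le {ζ u : ℂ} (h : ‖Complex.exp u‖ < ‖Complex.exp ζ‖) :
    ‖cauchyKernel ζ u‖ ≤ ‖Complex.exp u‖ / (‖Complex.exp ζ‖ - ‖Complex.exp u‖) := by
  rw [cauchyKernel, norm_div]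
  have : 0 < ‖Complex.exp ζ‖ - ‖Complex.exp u‖ := sub_pos.mpr h
  gcongr
  rw [norm_sub_rev]
  exact norm_sub_norm_le _ _

/-- Far out the kernel tends to `1` and `g` to `0`, so the integrand tends to `-c`. These arcs are
the source of the factor `2πi` in Cauchy's formula. -/
theorem tendsto_arc_atTop {g : ℂ → E} (hg : Differentiable ℂ g) (ζ : ℂ) (c : E) {a b : ℝ}
    (hab : a ≤ b) (hinf : ∀ ε > 0, ∀ᶠ x : ℝ in atTop, ∀ φ ∈ Icc a b,
      ‖g (Complex.exp (x + φ * I))‖ ≤ ε) :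
    Tendsto (fun R : ℝ => ∫ y in a..b, cauchyKernel ζ (R + y * I) •
      (g (Complex.exp (R + y * I)) - c)) atTop (𝓝 ((b - a) • -c)) := by
  have hexp : Tendsto (fun R : ℝ => Real.exp R - ‖Complex.exp ζ‖) atTop atTop :=
    tendsto_atTop_add_const_right _ _ Real.tendsto_exp_atTop
  have hk : ∀ ε > 0, ∀ᶠ R : ℝ in atTop, ∀ y : ℝ, ‖cauchyKernel ζ (R + y * I) - 1‖ ≤ ε := by
    intro ε hε
    have h1 : Tendsto (fun R : ℝ => ‖Complex.exp ζ‖ / (Real.exp R - ‖Complex.exp ζ‖)) atTop (𝓝 0) :=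
      hexp.const_div_atTop _
    filter_upwards [h1.eventually_le_const hε, hexp.eventually_gt_atTop 0] with R h2 h3 y
    refine (norm_cauchyKernel_sub_one_le ?_).trans ?_
    · rw [norm_exp_add_mul_I]; linarith
    · rw [norm_exp_add_mul_I]; exact h2
  refine tendsto_intervalIntegral_of_uniform hab ?_ fun ε hε => ?_
  · filter_upwards [hexp.eventually_gt_atTop 0] with R hR
    have h1 : ∀ y : ℝ, Complex.exp (R + y * I) ≠ Complex.exp ζ := fun y he => by
      have := norm_exp_add_mul_I R y
      rw [he] at this
      linarith
    have := hg.continuous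
    exact ((continuousOn_cauchyKernel ζ).comp (by fun_prop) fun y _ => h1 y).smul (by fun_prop)
  · have hc : 0 < 1 + ‖c‖ := by positivity
    have hδ : 0 < min 1 (ε / (2 * (1 + ‖c‖))) := lt_min one_pos (by positivity)
    have hε4 : 0 < ε / 4 := by positivity
    filter_upwards [hk _ hδ, hinf _ hε4] with R h1 h2 y hy
    have h3 := (h1 y).trans (min_le_left _ _)
    have h4 := (h1 y).trans (min_le_right _ _)
    rw [le_div_iff₀ (by positivity)] at h4
    have h5 := h2 y hy
    set k := cauchyKernel ζ (R + y * I)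
    set v := g (Complex.exp (R + y * I))
    have e : k • (v - c) - -c = (k - 1) • v + v - (k - 1) • c := by module
    rw [e]
    calc ‖(k - 1) • v + v - (k - 1) • c‖ ≤ ‖k - 1‖ * ‖v‖ + ‖v‖ + ‖k - 1‖ * ‖c‖ := by
          refine (norm_sub_le _ _).trans ?_
          rw [norm_smul]
          gcongr
          exact (norm_add_le _ _).trans (by rw [norm_smul])
      _ ≤ ε := by nlinarith [norm_nonneg v, norm_nonneg c, norm_nonneg (k - 1)]

/-- Towards the vertex of the sectors the kernel is of size `|e^u|` while `g` stays bounded, so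
small arcs contribute nothing in the limit. -/
theorem tendsto_arc_atBot {g : ℂ → E} (hg : Differentiable ℂ g) (ζ : ℂ) (c : E) {a b : ℝ}
    (hab : a ≤ b) :
    Tendsto (fun R : ℝ => ∫ y in a..b, cauchyKernel ζ (-R + y * I) •
      (g (Complex.exp (-R + y * I)) - c)) atTop (𝓝 0) := by
  have hexp0 : Tendsto (fun R : ℝ => Real.exp (-R)) atTop (𝓝 0) := by
    exact Real.tendsto_exp_atBot.comp tendsto_neg_atTop_atBot
  have hpos : 0 < ‖Complex.exp ζ‖ := norm_pos_iff.mpr (Complex.exp_ne_zero ζ)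
  have hn : ∀ R y : ℝ, ‖Complex.exp (-R + y * I)‖ = Real.exp (-R) := fun R y => by
    have := norm_exp_add_mul_I (-R) y
    push_cast at this
    exact this
  obtain ⟨B, hB⟩ := (isCompact_closedBall (0 : ℂ) 1).exists_bound_of_continuousOn
    (f := fun s => g s - c) (hg.continuous.sub continuous_const).continuousOn
  have h0 := tendsto_intervalIntegral_of_uniform (F := fun R y => cauchyKernel ζ (-R + y * I) •
      (g (Complex.exp (-R + y * I)) - c)) (c := 0) hab ?_ fun ε hε => ?_
  · simpa using h0
  · filter_upwards [hexp0.eventually_lt_const hpos] with R hR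
    have h1 : ∀ y : ℝ, Complex.exp (-R + y * I) ≠ Complex.exp ζ := fun y he => by
      have := hn R y
      rw [he] at this
      linarith
    have := hg.continuous
    exact ((continuousOn_cauchyKernel ζ).comp (by fun_prop) fun y _ => h1 y).smul (by fun_prop)
  · have h1 : Tendsto (fun R : ℝ => Real.exp (-R) / (‖Complex.exp ζ‖ - Real.exp (-R)) * (|B| + 1))
        atTop (𝓝 (0 / (‖Complex.exp ζ‖ - 0) * (|B| + 1))) :=
      ((hexp0.div (tendsto_const_nhds.sub hexp0) (by simp))).mul_const _
    rw [zero_div, zero_mul] at h1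
    filter_upwards [h1.eventually_le_const hε, hexp0.eventually_lt_const hpos,
      eventually_ge_atTop 0] with R h2 h3 h4 y _
    rw [sub_zero, norm_smul]
    refine le_trans ?_ h2
    have hq : 0 < ‖Complex.exp ζ‖ - Real.exp (-R) := sub_pos.mpr h3
    gcongr
    · have := norm_cauchyKernel_le (ζ := ζ) (u := -R + y * I) (by rw [hn]; exact h3)
      rwa [hn] at this
    · refine (hB _ ?_).trans ((le_abs_self B).trans (by linarith))
      rw [mem_closedBall_zero_iff, hn]
      exact Real.exp_le_one_iff.mpr (by linarith)

/-- **Cauchy's formula for sectionally holomorphic functions.** The entire functions `g j`,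
considered in the sectors `β j ≤ arg ≤ β (j + 1)`, tend to zero at infinity. -/
theorem tendsto_cauchy_sectors {N : ℕ} {g : ℕ → ℂ → E} {β : ℕ → ℝ}
    (hg : ∀ j, Differentiable ℂ (g j)) (hgN : g (N + 1) = g 0) (hβ : Monotone β)
    (hβN : β (N + 1) = β 0 + 2 * Real.pi)
    (hinf : ∀ j, ∀ ε > 0, ∀ᶠ x : ℝ in atTop, ∀ φ ∈ Icc (β j) (β (j + 1)),
      ‖g j (Complex.exp (x + φ * I))‖ ≤ ε)
    {ζ : ℂ} (h0 : β 0 < ζ.im) (h1 : ζ.im < β 1) (h1' : β 1 < ζ.im + 2 * Real.pi) :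
    Tendsto (fun R : ℝ => ∑ j ∈ Finset.range (N + 1), ∫ x in (-R)..R,
      cauchyKernel ζ (x + β (j + 1) * I) •
        (g (j + 1) (Complex.exp (x + β (j + 1) * I)) - g j (Complex.exp (x + β (j + 1) * I))))
      atTop (𝓝 ((2 * Real.pi * I : ℂ) • g 0 (Complex.exp ζ))) := by
  -- The same constant is subtracted in every sector. It removes the pole in sector `0`, cancels in
  -- the differences across rays, and reappears from the large arcs with total angle `2π`.
  set c := g 0 (Complex.exp ζ) with hc
  set H : ℕ → ℕ → ℝ → E := fun i j R => ∫ x in (-R)..R,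
    cauchyKernel ζ (x + β j * I) • (g i (Complex.exp (x + β j * I)) - c) with hH
  set V : ℕ → ℝ → E := fun j R => ∫ y in (β j)..(β (j + 1)), cauchyKernel ζ (R + y * I) •
      (g j (Complex.exp (R + y * I)) - c) with hV
  set W : ℕ → ℝ → E := fun j R => ∫ y in (β j)..(β (j + 1)), cauchyKernel ζ (-R + y * I) •
      (g j (Complex.exp (-R + y * I)) - c) with hW
  have hβ1 : ∀ j, β 1 ≤ β (j + 1) := fun j => hβ (by omega)
  have hβ2 : ∀ j, j ≤ N + 1 → β j ≤ β 0 + 2 * Real.pi := fun j hj => hβN ▸ hβ hj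
  have hpi := Real.pi_pos
  have hrect : ∀ j, j < N + 1 → ∀ᶠ R in atTop,
      H j j R - H j (j + 1) R + I • V j R - I • W j R = 0 := fun j hj => by
    filter_upwards [eventually_gt_atTop |ζ.re|] with R hR
    rcases j with _ | j
    · exact boundary_rect_cauchyKernel_self (hg 0) h0 h1
        (by linarith [hβ2 1 (by omega)]) h1' hR
    · refine boundary_rect_cauchyKernel_of_ne (hg (j + 1)) c fun u hu => ?_
      rw [uIcc_of_le (hβ (by omega)), mem_Icc] at hu
      have h3 := hβ1 j
      have h4 := hβ2 (j + 1 + 1) (by omega)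
      refine exp_ne_of_im (by linarith [hu.1] : ζ.im < u.im).ne' (abs_lt.mpr ⟨?_, ?_⟩) <;>
        linarith [hu.1, hu.2]
  -- After a full turn the last ray coincides with the first one, by the period `2πi` of the
  -- exponential and the assumption `hgN`.
  have hwrap : ∀ R, H (N + 1) (N + 1) R = H 0 0 R := fun R => by
    simp only [hH, hgN, hβN]
    have e : ∀ x : ℝ, Complex.exp (x + ((β 0 + 2 * Real.pi : ℝ) : ℂ) * I) =
        Complex.exp (x + β 0 * I) := fun x => by
      have : (x + ((β 0 + 2 * Real.pi : ℝ) : ℂ) * I) = x + β 0 * I + 2 * Real.pi * I := by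
        push_cast; ring
      rw [this, Complex.exp_periodic]
    have e' : ∀ x : ℝ, cauchyKernel ζ (x + ((β 0 + 2 * Real.pi : ℝ) : ℂ) * I) =
        cauchyKernel ζ (x + β 0 * I) := fun x => by
      unfold cauchyKernel; rw [e]
    simp only [e, e']
  have hjump : ∀ j, j < N + 1 → ∀ R, H (j + 1) (j + 1) R - H j (j + 1) R = ∫ x in (-R)..R,
      cauchyKernel ζ (x + β (j + 1) * I) • (g (j + 1) (Complex.exp (x + β (j + 1) * I)) -
        g j (Complex.exp (x + β (j + 1) * I))) := fun j hj R => by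
    have hne : ∀ x : ℝ, Complex.exp (x + β (j + 1) * I) ≠ Complex.exp ζ := fun x => by
      have h3 := hβ1 j
      have h4 := hβ2 (j + 1) (by omega)
      refine exp_ne_of_im ?_ ?_
      · simpa using (by linarith : ζ.im < β (j + 1)).ne'
      · simp only [add_im, ofReal_im, mul_im, ofReal_re, I_im, mul_one, I_re, mul_zero, add_zero,
          zero_add, abs_lt]
        constructor <;> linarith
    have hcont : ∀ i, Continuous fun x : ℝ => cauchyKernel ζ (x + β (j + 1) * I) •
        (g i (Complex.exp (x + β (j + 1) * I)) - c) := fun i => by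
      have := (hg i).continuous
      exact ((continuousOn_cauchyKernel ζ).comp_continuous (by fun_prop) hne).smul (by fun_prop)
    simp only [hH]
    rw [← intervalIntegral.integral_sub ((hcont _).intervalIntegrable _ _)
      ((hcont _).intervalIntegrable _ _)]
    congr 1
    funext x
    module
  have hlim : Tendsto (fun R => ∑ j ∈ Finset.range (N + 1), (I • W j R - I • V j R)) atTop
      (𝓝 (∑ j ∈ Finset.range (N + 1), (I • (0 : E) - I • ((β (j + 1) - β j) • -c)))) :=
    tendsto_finsetSum _ fun j _ =>
      ((tendsto_arc_atBot (hg j) ζ c (hβ (by omega))).const_smul I).sub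
        ((tendsto_arc_atTop (hg j) ζ c (hβ (by omega)) (hinf j)).const_smul I)
  have hval : (∑ j ∈ Finset.range (N + 1), (I • (0 : E) - I • ((β (j + 1) - β j) • -c))) =
      (2 * Real.pi * I : ℂ) • c := by
    have e : ∀ j, (I • (0 : E) - I • ((β (j + 1) - β j) • -c)) =
        (β (j + 1) - β j) • (I • c) := fun j => by
      rw [smul_zero, zero_sub, smul_neg, smul_neg, neg_neg, smul_comm]
    simp only [e]
    rw [← Finset.sum_smul, Finset.sum_range_sub, hβN, add_sub_cancel_left, ← Complex.coe_smul,
      smul_smul]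
    push_cast
    rfl
  rw [← hval]
  refine hlim.congr' ?_
  have hall : ∀ᶠ R in atTop, ∀ j ∈ Finset.range (N + 1),
      H j j R - H j (j + 1) R + I • V j R - I • W j R = 0 :=
    (Finset.eventually_all _).mpr fun j hj => hrect j (Finset.mem_range.mp hj)
  filter_upwards [hall] with R hR
  have e1 : ∑ j ∈ Finset.range (N + 1), (I • W j R - I • V j R) =
      ∑ j ∈ Finset.range (N + 1), (H j j R - H j (j + 1) R) :=
    Finset.sum_congr rfl fun j hj => by
      have := hR j hj
      rw [add_sub_assoc, add_eq_zero_iff_eq_neg] at this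
      rw [this]; abel
  -- Cyclic rearrangement: the lower sides of the sectors are re-indexed by one, so that both terms
  -- of each summand belong to the same ray.
  have e2 : ∑ j ∈ Finset.range (N + 1), (H j j R - H j (j + 1) R) =
      ∑ j ∈ Finset.range (N + 1), (H (j + 1) (j + 1) R - H j (j + 1) R) := by
    rw [Finset.sum_sub_distrib, Finset.sum_sub_distrib]
    congr 1
    have := Finset.sum_range_succ' (fun j => H j j R) (N + 1)
    rw [Finset.sum_range_succ, hwrap R] at this
    exact add_right_cancel this
  rw [e1, e2]
  exact Finset.sum_congr rfl fun j hj => hjump j (Finset.mem_range.mp hj) R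

end SectorialCauchy

/-! ### Sectors and Cauchy estimates -/

/-- The angle of ray `n + 1`, for all integers `n`. -/
noncomputable def rayAngle (n : ℤ) : ℝ := (2 * n + 1) * Real.pi / 12

/-- Half the opening of the sectors in which the jumps decay. -/
noncomputable def tilt : ℝ := Real.pi / 60

theorem tilt_pos : 0 < tilt := by unfold tilt; positivity

theorem rayAngle_succ (n : ℤ) : rayAngle (n + 1) = rayAngle n + 10 * tilt := by
  unfold rayAngle tilt; push_cast; ring

theorem rayAngle_add_twelve (n : ℤ) : rayAngle (n + 12) = rayAngle n + 2 * Real.pi := by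
  unfold rayAngle; push_cast; ring

theorem two_pi_eq_tilt : 2 * Real.pi = 120 * tilt := by unfold tilt; ring

theorem rayAngle_add_nat (n : ℤ) (j : ℕ) : rayAngle (n + j) = rayAngle n + j * (10 * tilt) := by
  unfold rayAngle tilt; push_cast; ring

/-- The constant of the separation estimate. -/
noncomputable def sepConst : ℝ := Real.sqrt (1 - Real.cos tilt)

theorem cos_tilt_lt_one : Real.cos tilt < 1 := by
  have h := Real.cos_lt_cos_of_nonneg_of_le_pi le_rfl
    (by unfold tilt; linarith [Real.pi_pos] : tilt ≤ Real.pi) tilt_pos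
  rwa [Real.cos_zero] at h

theorem cos_tilt_nonneg : 0 ≤ Real.cos tilt :=
  Real.cos_nonneg_of_neg_pi_div_two_le_of_le (by linarith [tilt_pos, Real.pi_pos])
    (by unfold tilt; linarith [Real.pi_pos])

theorem sepConst_pos : 0 < sepConst := Real.sqrt_pos.mpr (sub_pos.mpr cos_tilt_lt_one)

theorem cos_le_cos_tilt {ψ : ℝ} (h1 : tilt ≤ ψ) (h2 : ψ ≤ 2 * Real.pi - tilt) :
    Real.cos ψ ≤ Real.cos tilt := by
  rcases le_total ψ Real.pi with h | h
  · exact Real.cos_le_cos_of_nonneg_of_le_pi tilt_pos.le h h1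
  · rw [← Real.cos_two_pi_sub ψ]
    exact Real.cos_le_cos_of_nonneg_of_le_pi tilt_pos.le (by linarith) (by linarith)

/-- The law of cosines: if the angle between `s` and `z` is at least `tilt`, then `|s - z|² ≥ (1 -
cos tilt)(|s|² + |z|²)`, whatever the two radii are. -/
theorem sepConst_mul_le {x x' φ β : ℝ} (h1 : tilt ≤ β - φ) (h2 : β - φ ≤ 2 * Real.pi - tilt) :
    sepConst * Real.exp x' ≤ ‖Complex.exp (x' + β * I) - Complex.exp (x + φ * I)‖ ∧
    sepConst * Real.exp x ≤ ‖Complex.exp (x' + β * I) - Complex.exp (x + φ * I)‖ := by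
  have hcos := cos_le_cos_tilt h1 h2
  have hsq : ‖Complex.exp (x' + β * I) - Complex.exp (x + φ * I)‖ ^ 2 =
      Real.exp x' ^ 2 + Real.exp x ^ 2 - 2 * Real.exp x * Real.exp x' * Real.cos (β - φ) := by
    rw [← Complex.normSq_eq_norm_sq, Complex.normSq_apply, Complex.exp_add, Complex.exp_add,
      Complex.exp_mul_I, Complex.exp_mul_I, ← Complex.ofReal_exp, ← Complex.ofReal_exp,
      ← Complex.ofReal_cos, ← Complex.ofReal_sin, ← Complex.ofReal_cos, ← Complex.ofReal_sin,
      Real.cos_sub]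
    simp only [sub_re, mul_re, add_re, ofReal_re, ofReal_im, I_re, I_im, sub_im, mul_im, add_im]
    linear_combination (Real.exp x' ^ 2) * Real.sin_sq_add_cos_sq β +
      (Real.exp x ^ 2) * Real.sin_sq_add_cos_sq φ
  have e1 := Real.exp_pos x
  have e2 := Real.exp_pos x'
  have c0 := cos_tilt_nonneg
  have c1 := cos_tilt_lt_one
  have hlow : (1 - Real.cos tilt) * (Real.exp x' ^ 2 + Real.exp x ^ 2) ≤
      ‖Complex.exp (x' + β * I) - Complex.exp (x + φ * I)‖ ^ 2 := by
    rw [hsq]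
    nlinarith [mul_le_mul_of_nonneg_left hcos (by positivity : 0 ≤ 2 * Real.exp x * Real.exp x'),
      mul_nonneg c0 (sq_nonneg (Real.exp x - Real.exp x'))]
  have hs : sepConst ^ 2 = 1 - Real.cos tilt := Real.sq_sqrt (sub_pos.mpr c1).le
  constructor <;> refine le_of_sq_le_sq ?_ (norm_nonneg _) <;> rw [mul_pow, hs] <;> nlinarith

/-- The second bound rests on `s/(s - z) + s/z = s²/(z(s - z))`: removing the leading term `-s/z` of
the kernel as `z → ∞` leaves a remainder of size `|s|²/|z|²`. It gives the expansion at infinity,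
the first one gives boundedness. -/
theorem norm_cauchyKernel_le_inv {x x' φ β : ℝ} (h1 : tilt ≤ β - φ)
    (h2 : β - φ ≤ 2 * Real.pi - tilt) :
    ‖cauchyKernel (x + φ * I) (x' + β * I)‖ ≤ sepConst⁻¹ ∧
    ‖cauchyKernel (x + φ * I) (x' + β * I) + Complex.exp (x' + β * I) / Complex.exp (x + φ * I)‖ ≤
      sepConst⁻¹ * Real.exp (2 * x') * Real.exp (-2 * x) := by
  obtain ⟨h3, h4⟩ := sepConst_mul_le (x := x) (x' := x') h1 h2
  have hc := sepConst_pos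
  have e1 := Real.exp_pos x
  have e2 := Real.exp_pos x'
  have hpos : 0 < ‖Complex.exp (x' + β * I) - Complex.exp (x + φ * I)‖ :=
    lt_of_lt_of_le (by positivity) h3
  constructor
  · rw [cauchyKernel, norm_div, norm_exp_add_mul_I, div_le_iff₀ hpos, inv_mul_eq_div,
      le_div_iff₀ hc, mul_comm]
    exact h3
  · have hne : Complex.exp (x' + β * I) - Complex.exp (x + φ * I) ≠ 0 := norm_pos_iff.mp hpos
    have e : cauchyKernel (x + φ * I) (x' + β * I) + Complex.exp (x' + β * I) /
        Complex.exp (x + φ * I) = Complex.exp (x' + β * I) ^ 2 / (Complex.exp (x + φ * I) *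
          (Complex.exp (x' + β * I) - Complex.exp (x + φ * I))) := by
      have hz := Complex.exp_ne_zero (x + φ * I)
      unfold cauchyKernel
      generalize Complex.exp (x + φ * I) = z at hz hne
      generalize Complex.exp (x' + β * I) = s at hne
      rw [div_add_div _ _ hne hz, div_eq_div_iff (mul_ne_zero hne hz) (mul_ne_zero hz hne)]
      ring
    rw [e, norm_div, norm_pow, norm_mul, norm_exp_add_mul_I, norm_exp_add_mul_I,
      div_le_iff₀ (by positivity)]
    have e3 : Real.exp (2 * x') = Real.exp x' ^ 2 := by rw [← Real.exp_nat_mul]; norm_num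
    have e4 : Real.exp (-2 * x) * (Real.exp x * Real.exp x) = 1 := by
      rw [← Real.exp_add, ← Real.exp_add]; ring_nf; simp
    rw [e3]
    calc Real.exp x' ^ 2 = sepConst⁻¹ * Real.exp x' ^ 2 * (sepConst * (Real.exp (-2 * x) *
          (Real.exp x * Real.exp x))) := by rw [e4]; field_simp
      _ = sepConst⁻¹ * Real.exp x' ^ 2 * Real.exp (-2 * x) * (Real.exp x *
          (sepConst * Real.exp x)) := by ring
      _ ≤ _ := by gcongr

/-- The weight `|s| ^ p e ^ {-|s|}` in the logarithmic variable. -/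
noncomputable def expWeight (p : ℕ) (x : ℝ) : ℝ := Real.exp x ^ p * Real.exp (-Real.exp x)

theorem expWeight_nonneg (p : ℕ) (x : ℝ) : 0 ≤ expWeight p x := by unfold expWeight; positivity

theorem continuous_expWeight (p : ℕ) : Continuous (expWeight p) := by
  unfold expWeight; fun_prop

/-- An integrable majorant for the weights. At `x → -∞`, the vertex of the sectors, the decay comes
from a positive power of `e^x`; at `x → +∞` it comes from the double exponential. -/
theorem expWeight_le {p : ℕ} (h1 : 1 ≤ p) (h2 : p ≤ 2) (x : ℝ) :
    expWeight p x ≤ 12 * (1 + x ^ 2)⁻¹ := by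
  unfold expWeight
  rw [← div_eq_mul_inv, le_div_iff₀ (by positivity)]
  have e0 := Real.exp_pos x
  rcases le_total 0 x with h | h
  · have h3 : 1 + x ^ 2 ≤ 2 * Real.exp x := by
      nlinarith [Real.quadratic_le_exp_of_nonneg h]
    have h4 : 1 ≤ Real.exp x := Real.one_le_exp h
    have h5 : Real.exp x ^ p ≤ Real.exp x ^ 2 := pow_le_pow_right₀ h4 h2
    have h6 : Real.exp x ^ 3 / 6 ≤ Real.exp (Real.exp x) := by
      have := Real.pow_div_factorial_le_exp (Real.exp x) e0.le 3
      norm_num [Nat.factorial] at this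
      exact this
    have h7 : Real.exp (-Real.exp x) * Real.exp (Real.exp x) = 1 := by
      rw [← Real.exp_add]; simp
    have e1 := Real.exp_pos (-Real.exp x)
    calc Real.exp x ^ p * Real.exp (-Real.exp x) * (1 + x ^ 2)
        ≤ Real.exp x ^ 2 * Real.exp (-Real.exp x) * (2 * Real.exp x) := by gcongr
      _ = 12 * (Real.exp (-Real.exp x) * (Real.exp x ^ 3 / 6)) := by ring
      _ ≤ 12 * (Real.exp (-Real.exp x) * Real.exp (Real.exp x)) := by gcongr
      _ = 12 := by rw [h7, mul_one]
  · have h3 : 1 + x ^ 2 ≤ 2 * Real.exp (-x) := by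
      nlinarith [Real.quadratic_le_exp_of_nonneg (neg_nonneg.mpr h)]
    have h4 : Real.exp x ≤ 1 := Real.exp_le_one_iff.mpr h
    have h5 : Real.exp x ^ p ≤ Real.exp x := by
      simpa using pow_le_pow_of_le_one e0.le h4 h1
    have h6 : Real.exp (-Real.exp x) ≤ 1 := Real.exp_le_one_iff.mpr (by linarith)
    have h7 : Real.exp x * Real.exp (-x) = 1 := by rw [← Real.exp_add]; simp
    calc Real.exp x ^ p * Real.exp (-Real.exp x) * (1 + x ^ 2)
        ≤ Real.exp x * 1 * (2 * Real.exp (-x)) := by gcongr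
      _ = 2 * (Real.exp x * Real.exp (-x)) := by ring
      _ ≤ 12 := by rw [h7]; norm_num

theorem integrable_expWeight {p : ℕ} (h1 : 1 ≤ p) (h2 : p ≤ 2) : Integrable (expWeight p) :=
  (integrable_inv_one_add_sq.const_mul 12).mono' (continuous_expWeight p).aestronglyMeasurable
    (Eventually.of_forall fun x => by
      rw [Real.norm_of_nonneg (expWeight_nonneg p x)]
      exact expWeight_le h1 h2 x)

theorem exp_mul_expWeight (p : ℕ) (x : ℝ) : Real.exp x * expWeight p x = expWeight (p + 1) x := by
  unfold expWeight; ring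

theorem tendsto_expWeight (p : ℕ) : Tendsto (expWeight p) atTop (𝓝 0) :=
  (Real.tendsto_pow_mul_exp_neg_atTop_nhds_zero p).comp Real.tendsto_exp_atTop

section Estimates

variable {E : Type*} [NormedAddCommGroup E] [NormedSpace ℂ E]

/-- Sectionally holomorphic functions that tend to zero at infinity and whose jumps on tilted rays
are bounded by `k`. -/
structure IsSectorial (g : ℤ → ℂ → E) (k : ℝ → ℝ) : Prop where
  differentiable : ∀ n, Differentiable ℂ (g n)
  periodic : ∀ n, g (n + 12) = g n
  tendsto_zero : ∀ ε > 0, ∀ᶠ x : ℝ in atTop, ∀ n, ∀ φ ∈ Icc (rayAngle n) (rayAngle (n + 1)),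
    ‖g n (Complex.exp (x + φ * I))‖ ≤ ε
  jump_le : ∀ n, ∀ x φ : ℝ, |φ - rayAngle n| ≤ tilt →
    ‖g n (Complex.exp (x + φ * I)) - g (n - 1) (Complex.exp (x + φ * I))‖ ≤ k x

variable {g : ℤ → ℂ → E} {k : ℝ → ℝ}

/-- A point slightly outside a sector lies in the neighbouring one, where that neighbour's function
is small; the two differ by a jump, which is small as well. -/
theorem IsSectorial.tendsto_zero_tilted (hg : IsSectorial g k) (hk : Tendsto k atTop (𝓝 0)) :
    ∀ ε > 0, ∀ᶠ x : ℝ in atTop, ∀ n, ∀ φ ∈ Icc (rayAngle n - tilt) (rayAngle (n + 1) + tilt),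
      ‖g n (Complex.exp (x + φ * I))‖ ≤ ε := by
  intro ε hε
  have ht := tilt_pos
  filter_upwards [hg.tendsto_zero (ε / 2) (by positivity),
    hk.eventually_le_const (by positivity : 0 < ε / 2)] with x h1 h2 n φ hφ
  rw [mem_Icc, rayAngle_succ] at hφ
  have key : ∀ m, φ ∈ Icc (rayAngle m) (rayAngle (m + 1)) →
      ∀ v : E, ‖v - g m (Complex.exp (x + φ * I))‖ ≤ k x → ‖v‖ ≤ ε := fun m hm v hv => by
    have h3 := h1 m φ hm
    calc ‖v‖ ≤ ‖v - g m (Complex.exp (x + φ * I))‖ + ‖g m (Complex.exp (x + φ * I))‖ :=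
          norm_le_norm_sub_add _ _
      _ ≤ ε := by linarith
  rcases lt_or_ge φ (rayAngle n) with h | h
  · refine key (n - 1) ?_ _ (hg.jump_le n x φ (abs_le.mpr ⟨by linarith, by linarith⟩))
    have := rayAngle_succ (n - 1)
    rw [sub_add_cancel] at this
    rw [sub_add_cancel]
    exact ⟨by linarith, h.le⟩
  · rcases le_or_gt φ (rayAngle (n + 1)) with h' | h'
    · exact (h1 n φ ⟨h, h'⟩).trans (by linarith)
    · rw [rayAngle_succ] at h'
      refine key (n + 1) ?_ _ ?_
      · rw [mem_Icc, rayAngle_succ (n + 1), rayAngle_succ n]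
        exact ⟨by linarith, by linarith⟩
      · rw [norm_sub_rev]
        have := hg.jump_le (n + 1) x φ (by
          rw [rayAngle_succ, abs_le]; exact ⟨by linarith, by linarith⟩)
        rwa [add_sub_cancel_right] at this

/-- The contour is turned by the angle `σ`. -/
theorem IsSectorial.tendsto_cauchy [CompleteSpace E] (hg : IsSectorial g k) (hk : Tendsto k atTop (𝓝 0)) {σ : ℝ}
    (hσ : |σ| ≤ tilt) {m : ℤ} {x φ : ℝ} (h1 : rayAngle m + σ + tilt ≤ φ)
    (h2 : φ ≤ rayAngle (m + 1) + σ - tilt) :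
    Tendsto (fun R : ℝ => ∑ j ∈ Finset.range 12, ∫ t in (-R)..R,
      cauchyKernel (x + φ * I) (t + (rayAngle (m + (j + 1 : ℕ)) + σ : ℝ) * I) •
        (g (m + (j + 1 : ℕ)) (Complex.exp (t + (rayAngle (m + (j + 1 : ℕ)) + σ : ℝ) * I)) -
          g (m + (j : ℕ)) (Complex.exp (t + (rayAngle (m + (j + 1 : ℕ)) + σ : ℝ) * I))))
      atTop (𝓝 ((2 * Real.pi * I : ℂ) • g m (Complex.exp (x + φ * I)))) := by
  have ht := tilt_pos
  have hσ' := abs_le.mp hσ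
  have := tendsto_cauchy_sectors (N := 11) (g := fun j => g (m + j))
    (β := fun j => rayAngle (m + j) + σ) (ζ := x + φ * I) (fun j => hg.differentiable _)
    (by simpa using hg.periodic m)
    (fun i j hij => by
      simp only [rayAngle_add_nat]
      gcongr)
    (by
      have := rayAngle_add_twelve m
      simp only [Nat.reduceAdd, Nat.cast_ofNat, this, CharP.cast_eq_zero, add_zero]
      ring)
    (fun j ε hε => by
      filter_upwards [hg.tendsto_zero_tilted hk ε hε] with x hx φ hφ
      refine hx _ φ ⟨by linarith [hφ.1], ?_⟩
      have h3 := hφ.2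
      push_cast at h3
      rw [add_assoc]
      linarith)
    (by simp; linarith) (by simp at h2 ⊢; linarith)
    (by
      simp only [Nat.cast_one, rayAngle_succ, two_pi_eq_tilt, add_im, ofReal_im, mul_im,
        ofReal_re, I_im, mul_one, I_re, mul_zero, add_zero, zero_add]
      linarith)
  simpa using this

/-- The angles between a point of a sector and the other rays of a turned contour. -/
theorem tilt_le_rayAngle_sub {m : ℤ} {φ σ : ℝ} (h1 : rayAngle m + σ + tilt ≤ φ)
    (h2 : φ ≤ rayAngle (m + 1) + σ - tilt) {j : ℕ} (hj : j ∈ Finset.range 12) :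
    tilt ≤ rayAngle (m + (j + 1 : ℕ)) + σ - φ ∧
      rayAngle (m + (j + 1 : ℕ)) + σ - φ ≤ 2 * Real.pi - tilt := by
  have ht := tilt_pos
  rw [rayAngle_add_nat, two_pi_eq_tilt]
  rw [rayAngle_succ] at h2
  have h3 : (j : ℝ) ≤ 11 := by exact_mod_cast Nat.le_of_lt_succ (Finset.mem_range.mp hj)
  have h4 : (0 : ℝ) ≤ j := Nat.cast_nonneg j
  push_cast
  constructor <;> nlinarith

theorem IsSectorial.norm_jump_le (hg : IsSectorial g k) {σ : ℝ} (hσ : |σ| ≤ tilt) (m : ℤ) (j : ℕ)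
    (t : ℝ) : ‖g (m + (j + 1 : ℕ)) (Complex.exp (t + (rayAngle (m + (j + 1 : ℕ)) + σ : ℝ) * I)) -
      g (m + (j : ℕ)) (Complex.exp (t + (rayAngle (m + (j + 1 : ℕ)) + σ : ℝ) * I))‖ ≤ k t := by
  have := hg.jump_le (m + (j + 1 : ℕ)) t (rayAngle (m + (j + 1 : ℕ)) + σ) (by simpa using hσ)
  have e : (m + (j + 1 : ℕ) - 1 : ℤ) = m + (j : ℕ) := by push_cast; ring
  rwa [e] at this

/-- For a point on a ray the Cauchy integral over that ray is singular. Turning the whole contour by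
`-tilt` or `+tilt`, according to the half of the sector the point lies in, keeps every ray at
angular distance at least `tilt`. -/
theorem exists_tilt {m : ℤ} {φ : ℝ} (hφ : φ ∈ Icc (rayAngle m) (rayAngle (m + 1))) :
    ∃ σ : ℝ, |σ| ≤ tilt ∧ rayAngle m + σ + tilt ≤ φ ∧ φ ≤ rayAngle (m + 1) + σ - tilt := by
  have ht := tilt_pos
  have h := rayAngle_succ m
  rcases le_total φ (rayAngle m + 5 * tilt) with h1 | h1
  · exact ⟨-tilt, by rw [abs_neg, abs_of_pos ht], by linarith [hφ.1], by linarith⟩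
  · exact ⟨tilt, by rw [abs_of_pos ht], by linarith, by linarith [hφ.2]⟩

/-- Cauchy's formula on the turned contour, with the kernel bounded by `sepConst⁻¹`. What matters is
that the bound is linear in `A` with a universal factor: zero jumps force the function to vanish,
and small jumps keep it small. The weight has exponent one because in the logarithmic variable the
measure `ds/s` would not be integrable at the vertex without a factor `|s|`. -/
theorem IsSectorial.norm_le [CompleteSpace E] {A : ℝ} (hg : IsSectorial g fun x => A * expWeight 1 x) {m : ℤ}
    {x φ : ℝ} (hφ : φ ∈ Icc (rayAngle m) (rayAngle (m + 1))) :
    ‖g m (Complex.exp (x + φ * I))‖ ≤ A * (12 * (sepConst⁻¹ * ∫ t, expWeight 1 t)) := by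
  obtain ⟨σ, hσ, h1, h2⟩ := exists_tilt hφ
  have hk : Tendsto (fun x => A * expWeight 1 x) atTop (𝓝 0) := by
    simpa using (tendsto_expWeight 1).const_mul A
  have hA : ∀ t, 0 ≤ A * expWeight 1 t := fun t =>
    (norm_nonneg _).trans (hg.norm_jump_le hσ m 0 t)
  have hint := (integrable_expWeight le_rfl one_le_two).const_mul A
  have hc := sepConst_pos
  have hle : ‖(2 * Real.pi * I : ℂ) • g m (Complex.exp (x + φ * I))‖ ≤
      A * (12 * (sepConst⁻¹ * ∫ t, expWeight 1 t)) := by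
    refine le_of_tendsto (hg.tendsto_cauchy hk hσ h1 h2 (x := x)).norm ?_
    filter_upwards [eventually_ge_atTop 0] with R hR
    have e : A * (12 * (sepConst⁻¹ * ∫ t, expWeight 1 t)) =
        ∑ _j ∈ Finset.range 12, sepConst⁻¹ * ∫ t, A * expWeight 1 t := by
      rw [Finset.sum_const, Finset.card_range, integral_const_mul, nsmul_eq_mul]
      push_cast
      ring
    rw [e]
    refine norm_sum_le_of_le _ fun j hj => ?_
    refine (intervalIntegral.norm_integral_le_of_norm_le (by linarith)
      (g := fun t => sepConst⁻¹ * (A * expWeight 1 t)) (Eventually.of_forall fun t _ => ?_)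
      (hint.const_mul _).intervalIntegrable).trans ?_
    · obtain ⟨h3, h4⟩ := tilt_le_rayAngle_sub h1 h2 hj
      rw [norm_smul]
      gcongr
      · exact (norm_cauchyKernel_le_inv h3 h4).1
      · exact hg.norm_jump_le hσ m j t
    · rw [intervalIntegral.integral_const_mul, intervalIntegral.integral_of_le (by linarith)]
      gcongr
      · exact Eventually.of_forall hA
      · exact Measure.restrict_le_self
  refine le_trans ?_ hle
  rw [norm_smul]
  have : (1 : ℝ) ≤ ‖(2 * Real.pi * I : ℂ)‖ := by
    simp [abs_of_pos Real.pi_pos]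
    linarith [Real.pi_gt_three]
  exact le_mul_of_one_le_left (norm_nonneg _) this

/-- Inserting `s/(s - z) = -s/z + O(|s|²/|z|²)` into Cauchy's formula: the first term gives the
coefficient of `1/z`, up to the factor `-1/(2πi)` the sum of the integrals of `s` times the jump,
and the second gives the error. The factors `s` and `s²` supply the integrability at the vertex, so
jumps of weight zero suffice. -/
theorem IsSectorial.exists_moment_tilted [CompleteSpace E] {A : ℝ}
    (hg : IsSectorial g fun x => A * expWeight 0 x) {σ : ℝ} (hσ : |σ| ≤ tilt) (m : ℤ) :
    ∃ μ : E, ∀ x φ : ℝ, rayAngle m + σ + tilt ≤ φ → φ ≤ rayAngle (m + 1) + σ - tilt →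
      ‖g m (Complex.exp (x + φ * I)) - (Complex.exp (x + φ * I))⁻¹ • μ‖ ≤
        A * (12 * (sepConst⁻¹ * ∫ t, expWeight 2 t)) * Real.exp (-2 * x) := by
  have hk : Tendsto (fun x => A * expWeight 0 x) atTop (𝓝 0) := by
    simpa using (tendsto_expWeight 0).const_mul A
  have hjump := hg.norm_jump_le hσ m
  set b : ℕ → ℝ := fun j => rayAngle (m + (j + 1 : ℕ)) + σ with hb
  set J : ℕ → ℝ → E := fun j t => g (m + (j + 1 : ℕ)) (Complex.exp (t + b j * I)) -
    g (m + (j : ℕ)) (Complex.exp (t + b j * I)) with hJ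
  have hA : ∀ t, 0 ≤ A * expWeight 0 t := fun t => (norm_nonneg _).trans (hjump 0 t)
  have hJc : ∀ j, Continuous (J j) := fun j => by
    have h1 := (hg.differentiable (m + (j + 1 : ℕ))).continuous
    have h2 := (hg.differentiable (m + (j : ℕ))).continuous
    simp only [hJ]
    fun_prop
  have hsc : ∀ j, Continuous fun t : ℝ => Complex.exp (t + b j * I) • J j t := fun j =>
    (by fun_prop : Continuous fun t : ℝ => Complex.exp (t + b j * I)).smul (hJc j)
  have hsi : ∀ j, Integrable fun t : ℝ => Complex.exp (t + b j * I) • J j t := fun j => by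
    refine ((integrable_expWeight le_rfl one_le_two).const_mul A).mono'
      (hsc j).aestronglyMeasurable (Eventually.of_forall fun t => ?_)
    rw [norm_smul, norm_exp_add_mul_I, ← zero_add 1, ← exp_mul_expWeight]
    have := hjump j t
    calc Real.exp t * ‖J j t‖ ≤ Real.exp t * (A * expWeight 0 t) := by gcongr
      _ = _ := by ring
  have hint := (integrable_expWeight one_le_two le_rfl).const_mul A
  have hc := sepConst_pos
  set S := ∑ j ∈ Finset.range 12, ∫ t : ℝ, Complex.exp (t + b j * I) • J j t with hS
  refine ⟨(2 * Real.pi * I : ℂ)⁻¹ • -S, fun x φ h1 h2 => ?_⟩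
  set z := Complex.exp (x + φ * I) with hz
  have hne : ∀ j ∈ Finset.range 12, ∀ t : ℝ, Complex.exp (t + b j * I) ≠ z := fun j hj t he => by
    obtain ⟨h3, h4⟩ := tilt_le_rayAngle_sub h1 h2 hj
    have := (sepConst_mul_le (x := x) (x' := t) h3 h4).1
    rw [← hz] at this
    change _ ≤ ‖Complex.exp (t + b j * I) - z‖ at this
    rw [he, sub_self, norm_zero] at this
    have h5 := mul_pos hc (Real.exp_pos t)
    linarith
  have hlim : Tendsto (fun R : ℝ => ∑ j ∈ Finset.range 12, ∫ t in (-R)..R,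
      (cauchyKernel (x + φ * I) (t + b j * I) + Complex.exp (t + b j * I) / z) • J j t) atTop
      (𝓝 ((2 * Real.pi * I : ℂ) • g m z + z⁻¹ • S)) := by
    have h3 : Tendsto (fun R : ℝ => z⁻¹ • ∑ j ∈ Finset.range 12, ∫ t in (-R)..R,
        Complex.exp (t + b j * I) • J j t) atTop (𝓝 (z⁻¹ • S)) :=
      (tendsto_finsetSum _ fun j _ => intervalIntegral_tendsto_integral (hsi j)
        tendsto_neg_atTop_atBot tendsto_id).const_smul _
    refine ((hg.tendsto_cauchy hk hσ h1 h2).add h3).congr fun R => ?_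
    rw [Finset.smul_sum, ← Finset.sum_add_distrib]
    refine Finset.sum_congr rfl fun j hj => ?_
    rw [← intervalIntegral.integral_smul, ← intervalIntegral.integral_add]
    · refine intervalIntegral.integral_congr fun t _ => ?_
      simp only [hJ, hb]
      rw [add_smul, smul_smul, div_eq_inv_mul]
    · exact (((continuousOn_cauchyKernel _).comp_continuous (by fun_prop) (hne j hj)).smul
        (hJc j)).intervalIntegrable _ _
    · exact ((hsc j).const_smul _).intervalIntegrable _ _
  have hle : ‖(2 * Real.pi * I : ℂ) • g m z + z⁻¹ • S‖ ≤
      A * (12 * (sepConst⁻¹ * ∫ t, expWeight 2 t)) * Real.exp (-2 * x) := by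
    refine le_of_tendsto hlim.norm ?_
    filter_upwards [eventually_ge_atTop 0] with R hR
    have e : A * (12 * (sepConst⁻¹ * ∫ t, expWeight 2 t)) * Real.exp (-2 * x) =
        ∑ _j ∈ Finset.range 12, (sepConst⁻¹ * Real.exp (-2 * x)) * ∫ t, A * expWeight 2 t := by
      rw [Finset.sum_const, Finset.card_range, integral_const_mul, nsmul_eq_mul]
      push_cast
      ring
    rw [e]
    refine norm_sum_le_of_le _ fun j hj => ?_
    refine (intervalIntegral.norm_integral_le_of_norm_le (by linarith)
      (g := fun t => (sepConst⁻¹ * Real.exp (-2 * x)) * (A * expWeight 2 t))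
      (Eventually.of_forall fun t _ => ?_) (hint.const_mul _).intervalIntegrable).trans ?_
    · obtain ⟨h3, h4⟩ := tilt_le_rayAngle_sub h1 h2 hj
      rw [norm_smul]
      calc _ ≤ (sepConst⁻¹ * Real.exp (2 * t) * Real.exp (-2 * x)) * (A * expWeight 0 t) := by
            gcongr
            · exact (norm_cauchyKernel_le_inv (x := x) h3 h4).2
            · exact hjump j t
        _ = _ := by
            have : Real.exp (2 * t) = Real.exp t ^ 2 := by rw [← Real.exp_nat_mul]; norm_num
            rw [this]
            unfold expWeight
            ring
    · rw [intervalIntegral.integral_const_mul, intervalIntegral.integral_of_le (by linarith)]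
      gcongr
      · refine Eventually.of_forall fun t => ?_
        have := mul_nonneg (hA t) (sq_nonneg (Real.exp t))
        unfold expWeight at this ⊢
        change 0 ≤ _
        linarith
      · exact Measure.restrict_le_self
  have hpi : (2 * Real.pi * I : ℂ) ≠ 0 := by simp [Real.pi_ne_zero]
  have e : g m z - z⁻¹ • (2 * Real.pi * I : ℂ)⁻¹ • -S =
      (2 * Real.pi * I : ℂ)⁻¹ • ((2 * Real.pi * I : ℂ) • g m z + z⁻¹ • S) := by
    rw [smul_add, inv_smul_smul₀ hpi, smul_neg, smul_neg, sub_neg_eq_add, smul_comm]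
  rw [e, norm_smul]
  have : (1 : ℝ) ≤ ‖(2 * Real.pi * I : ℂ)‖ := by
    simp [abs_of_pos Real.pi_pos]
    linarith [Real.pi_gt_three]
  refine le_trans (mul_le_of_le_one_left (norm_nonneg _) ?_) hle
  rw [norm_inv]
  exact inv_le_one_of_one_le₀ this

/-- Multiply by `z` and go to infinity along one direction; all three errors are `O(1/|z|)` after
that. -/
theorem eq_of_norm_sub_inv_smul_le {C : ℝ} {u v : ℂ → E} {μ ν : E} {φ : ℝ}
    (hu : ∀ x : ℝ, ‖u (Complex.exp (x + φ * I)) - (Complex.exp (x + φ * I))⁻¹ • μ‖ ≤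
      C * Real.exp (-2 * x))
    (hv : ∀ x : ℝ, ‖v (Complex.exp (x + φ * I)) - (Complex.exp (x + φ * I))⁻¹ • ν‖ ≤
      C * Real.exp (-2 * x))
    (huv : ∀ x : ℝ, ‖u (Complex.exp (x + φ * I)) - v (Complex.exp (x + φ * I))‖ ≤
      C * Real.exp (-2 * x)) : μ = ν := by
  have hle : ∀ x : ℝ, ‖μ - ν‖ ≤ 3 * C * Real.exp (-x) := fun x => by
    set z := Complex.exp (x + φ * I) with hz
    have hz0 : z ≠ 0 := Complex.exp_ne_zero _
    have hn : ‖z‖ = Real.exp x := norm_exp_add_mul_I x φ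
    have e : μ - ν = z • ((u z - v z) - (u z - z⁻¹ • μ) + (v z - z⁻¹ • ν)) := by
      have : (u z - v z) - (u z - z⁻¹ • μ) + (v z - z⁻¹ • ν) = z⁻¹ • (μ - ν) := by
        rw [smul_sub]; abel
      rw [this, smul_smul, mul_inv_cancel₀ hz0, one_smul]
    have e2 : Real.exp x * Real.exp (-2 * x) = Real.exp (-x) := by
      rw [← Real.exp_add]; ring_nf
    rw [e, norm_smul, hn]
    calc Real.exp x * ‖(u z - v z) - (u z - z⁻¹ • μ) + (v z - z⁻¹ • ν)‖
        ≤ Real.exp x * (C * Real.exp (-2 * x) + C * Real.exp (-2 * x) + C * Real.exp (-2 * x)) := by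
          gcongr
          refine (norm_add_le _ _).trans (add_le_add ((norm_sub_le _ _).trans ?_) (hv x))
          exact add_le_add (huv x) (hu x)
      _ = 3 * C * (Real.exp x * Real.exp (-2 * x)) := by ring
      _ = _ := by rw [e2]
  have hlim : Tendsto (fun x : ℝ => 3 * C * Real.exp (-x)) atTop (𝓝 0) := by
    simpa using Real.tendsto_exp_neg_atTop_nhds_zero.const_mul (3 * C)
  have := ge_of_tendsto hlim (Eventually.of_forall hle)
  exact sub_eq_zero.mp (norm_le_zero_iff.mp this)

/-- The constant of the expansion at infinity. -/
noncomputable def momentConst : ℝ := 12 * (sepConst⁻¹ * ∫ t, expWeight 2 t) + 2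

theorem momentConst_pos : 0 < momentConst := by
  unfold momentConst
  have := sepConst_pos
  have : 0 ≤ ∫ t, expWeight 2 t := integral_nonneg fun t => expWeight_nonneg 2 t
  positivity

/-- The jump itself is of the order of the error term in the expansion. The summand `2` in
`momentConst` is there to absorb it. -/
theorem expWeight_zero_le (x : ℝ) : expWeight 0 x ≤ 2 * Real.exp (-2 * x) := by
  unfold expWeight
  have h : Real.exp x ^ 2 / 2 ≤ Real.exp (Real.exp x) := by
    have := Real.pow_div_factorial_le_exp (Real.exp x) (Real.exp_pos x).le 2
    norm_num [Nat.factorial] at this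
    exact this
  have h1 : Real.exp (-2 * x) * Real.exp x ^ 2 = 1 := by
    rw [← Real.exp_nat_mul, ← Real.exp_add]; simp
  have h2 : Real.exp (-Real.exp x) * Real.exp (Real.exp x) = 1 := by
    rw [← Real.exp_add]; simp
  rw [pow_zero, one_mul]
  calc Real.exp (-Real.exp x) = 2 * Real.exp (-2 * x) *
        (Real.exp (-Real.exp x) * (Real.exp x ^ 2 / 2)) := by
          linear_combination -Real.exp (-Real.exp x) * h1
    _ ≤ 2 * Real.exp (-2 * x) * (Real.exp (-Real.exp x) * Real.exp (Real.exp x)) := by gcongr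
    _ = _ := by rw [h2, mul_one]

/-- A priori each sector has two coefficients, one for each direction of turning. They agree because
their ranges of validity overlap, and they agree with those of the next sector because the jump on
the common ray is `O(|z|⁻²)`. -/
theorem IsSectorial.exists_moment [CompleteSpace E] {A : ℝ}
    (hg : IsSectorial g fun x => A * expWeight 0 x) :
    ∃ μ : E, ∀ m, ∀ x : ℝ, ∀ φ ∈ Icc (rayAngle m) (rayAngle (m + 1)),
      ‖g m (Complex.exp (x + φ * I)) - (Complex.exp (x + φ * I))⁻¹ • μ‖ ≤
        A * momentConst * Real.exp (-2 * x) := by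
  have ht := tilt_pos
  have hA : 0 ≤ A := by
    have h1 := (norm_nonneg _).trans (hg.jump_le 0 0 (rayAngle 0) (by simpa using ht.le))
    have h2 : 0 < expWeight 0 0 := by unfold expWeight; positivity
    exact nonneg_of_mul_nonneg_left h1 h2
  choose μ₁ h₁ using fun m => hg.exists_moment_tilted (σ := -tilt) (by rw [abs_neg, abs_of_pos ht]) m
  choose μ₂ h₂ using fun m => hg.exists_moment_tilted (σ := tilt) (by rw [abs_of_pos ht]) m
  have hle : ∀ x, A * (12 * (sepConst⁻¹ * ∫ t, expWeight 2 t)) * Real.exp (-2 * x) ≤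
      A * momentConst * Real.exp (-2 * x) := fun x => by
    unfold momentConst
    gcongr
    linarith
  replace h₁ : ∀ (m : ℤ) (x φ : ℝ), rayAngle m ≤ φ → φ ≤ rayAngle m + 8 * tilt →
      ‖g m (Complex.exp (x + φ * I)) - (Complex.exp (x + φ * I))⁻¹ • μ₁ m‖ ≤
        A * momentConst * Real.exp (-2 * x) := fun m x φ h3 h4 =>
    (h₁ m x φ (by linarith) (by rw [rayAngle_succ]; linarith)).trans (hle x)
  replace h₂ : ∀ (m : ℤ) (x φ : ℝ), rayAngle m + 2 * tilt ≤ φ → φ ≤ rayAngle m + 10 * tilt →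
      ‖g m (Complex.exp (x + φ * I)) - (Complex.exp (x + φ * I))⁻¹ • μ₂ m‖ ≤
        A * momentConst * Real.exp (-2 * x) := fun m x φ h3 h4 =>
    (h₂ m x φ (by linarith) (by rw [rayAngle_succ]; linarith)).trans (hle x)
  have e₁ : ∀ m, μ₁ m = μ₂ m := fun m => by
    refine eq_of_norm_sub_inv_smul_le (φ := rayAngle m + 5 * tilt)
      (fun x => h₁ m x _ (by linarith) (by linarith))
      (fun x => h₂ m x _ (by linarith) (by linarith)) fun x => ?_
    rw [sub_self, norm_zero]
    have := momentConst_pos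
    positivity
  have e₂ : ∀ m, μ₂ m = μ₁ (m + 1) := fun m => by
    have hs := rayAngle_succ m
    refine eq_of_norm_sub_inv_smul_le (φ := rayAngle (m + 1))
      (fun x => h₂ m x _ (by linarith) (by linarith))
      (fun x => h₁ (m + 1) x _ le_rfl (by linarith)) fun x => ?_
    rw [norm_sub_rev]
    have h3 := hg.jump_le (m + 1) x (rayAngle (m + 1)) (by simpa using ht.le)
    rw [add_sub_cancel_right] at h3
    refine h3.trans ?_
    rw [mul_assoc]
    gcongr
    refine (expWeight_zero_le x).trans ?_
    gcongr
    unfold momentConst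
    have := sepConst_pos
    have : 0 ≤ ∫ t, expWeight 2 t := integral_nonneg fun t => expWeight_nonneg 2 t
    have : 0 ≤ 12 * (sepConst⁻¹ * ∫ t, expWeight 2 t) := by positivity
    linarith
  have e₃ : ∀ m, μ₁ m = μ₁ 0 := fun m => by
    induction m with
    | zero => rfl
    | succ i ih => rw [← e₂, ← e₁, ih]
    | pred i ih => rw [e₁, e₂, sub_add_cancel, ih]
  refine ⟨μ₁ 0, fun m x φ hφ => ?_⟩
  rw [mem_Icc, rayAngle_succ] at hφ
  rcases le_total φ (rayAngle m + 8 * tilt) with h | h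
  · rw [← e₃ m]
    exact h₁ m x φ hφ.1 h
  · rw [← e₃ m, e₁ m]
    exact h₂ m x φ (by linarith) hφ.2

end Estimates

/-! ### Polar coordinates and the contour -/

/-- The ray with the integer index `n`. -/
def rayIdx (n : ℤ) : Fin 12 := ((n : ZMod 12) : ZMod 12)

theorem rayIdx_add_twelve (n : ℤ) : rayIdx (n + 12) = rayIdx n := by
  have h : ((n + 12 : ℤ) : ZMod 12) = (n : ZMod 12) := by
    push_cast
    have : (12 : ZMod 12) = 0 := rfl
    rw [this, add_zero]
  exact h

theorem rayIdx_add_mul (n k : ℤ) : rayIdx (n + 12 * k) = rayIdx n := by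
  have h : ((n + 12 * k : ℤ) : ZMod 12) = (n : ZMod 12) := by
    push_cast
    have : (12 : ZMod 12) = 0 := rfl
    rw [this, zero_mul, add_zero]
  exact h

theorem rayAngle_add_mul (n k : ℤ) : rayAngle (n + 12 * k) = rayAngle n + k * (2 * Real.pi) := by
  unfold rayAngle; push_cast; ring

theorem rayAngle_strictMono : StrictMono rayAngle := fun a b h => by
  have : (a : ℝ) < b := by exact_mod_cast h
  unfold rayAngle
  have := Real.pi_pos
  gcongr

theorem rayIdx_natCast (n : Fin 12) : rayIdx ((n : ℕ) : ℤ) = n := by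
  have h : (((n : ℕ) : ℤ) : ZMod 12) = (n : ZMod 12) := by
    rw [Int.cast_natCast]
    exact ZMod.natCast_zmod_val (n := 12) n
  exact h

theorem rayDir_rayIdx (n : ℤ) : rayDir (rayIdx n) = Complex.exp (rayAngle n * I) := by
  have h := Int.emod_add_mul_ediv n 12
  set q := n / 12 with hq
  obtain ⟨m, hm⟩ : ∃ m : Fin 12, ((m : ℕ) : ℤ) = n % 12 :=
    ⟨⟨(n % 12).toNat, by omega⟩, by simp; omega⟩
  rw [← h, rayIdx_add_mul, ← hm, rayIdx_natCast, rayAngle_add_mul]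
  unfold rayDir rayAngle
  rw [Complex.exp_eq_exp_iff_exists_int]
  exact ⟨-q, by push_cast; ring⟩

theorem exp_eq_exp_polar_iff {x x' φ φ' : ℝ} :
    Complex.exp (x + φ * I) = Complex.exp (x' + φ' * I) ↔
      x = x' ∧ ∃ k : ℤ, φ = φ' + k * (2 * Real.pi) := by
  rw [Complex.exp_eq_exp_iff_exists_int]
  constructor
  · rintro ⟨k, hk⟩
    have h1 := congrArg Complex.re hk
    have h2 := congrArg Complex.im hk
    simp at h1 h2
    exact ⟨h1, k, h2⟩
  · rintro ⟨rfl, k, rfl⟩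
    exact ⟨k, by push_cast; ring⟩

theorem exp_log_norm_add_arg {z : ℂ} (hz : z ≠ 0) :
    Complex.exp ((Real.log ‖z‖ : ℝ) + (arg z : ℝ) * I) = z := by
  have := Complex.exp_log hz
  rwa [Complex.log] at this

/-- The index of the sector of a point. -/
noncomputable def sectorIdx (φ : ℝ) : ℤ := ⌊(φ * 12 / Real.pi - 1) / 2⌋

theorem sectorIdx_eq {n : ℤ} {φ : ℝ} (h : φ ∈ Ico (rayAngle n) (rayAngle (n + 1))) :
    sectorIdx φ = n := by
  have hpi := Real.pi_pos
  unfold rayAngle at h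
  push_cast at h
  obtain ⟨h1, h2⟩ := h
  rw [sectorIdx, Int.floor_eq_iff]
  constructor
  · rw [le_div_iff₀ two_pos, le_sub_iff_add_le, le_div_iff₀ hpi]; linarith
  · rw [div_lt_iff₀ two_pos, sub_lt_iff_lt_add, div_lt_iff₀ hpi]; linarith

theorem mem_Ico_sectorIdx (φ : ℝ) :
    φ ∈ Ico (rayAngle (sectorIdx φ)) (rayAngle (sectorIdx φ + 1)) := by
  have hpi := Real.pi_pos
  have h1 := Int.floor_le ((φ * 12 / Real.pi - 1) / 2)
  have h2 := Int.lt_floor_add_one ((φ * 12 / Real.pi - 1) / 2)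
  rw [le_div_iff₀ two_pos, le_sub_iff_add_le, le_div_iff₀ hpi] at h1
  rw [div_lt_iff₀ two_pos, sub_lt_iff_lt_add, div_lt_iff₀ hpi] at h2
  unfold rayAngle sectorIdx
  push_cast
  constructor <;> linarith

theorem exists_polar {z : ℂ} (hz : z ≠ 0) : ∃ (n : ℤ) (x φ : ℝ),
    φ ∈ Ico (rayAngle n) (rayAngle (n + 1)) ∧ z = Complex.exp (x + φ * I) :=
  ⟨_, _, _, mem_Ico_sectorIdx (arg z), (exp_log_norm_add_arg hz).symm⟩

theorem ray_mem_contour (n : ℤ) (x : ℝ) : Complex.exp (x + rayAngle n * I) ∈ contour :=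
  ⟨rayIdx n, Real.exp x, (Real.exp_pos x).le, by
    rw [rayDir_rayIdx, Complex.exp_add, Complex.ofReal_exp]⟩

theorem zero_mem_contour : (0 : ℂ) ∈ contour := ⟨0, 0, le_rfl, by simp⟩

theorem mem_contour_iff {z : ℂ} (hz : z ≠ 0) :
    z ∈ contour ↔ ∃ (n : ℤ) (x : ℝ), z = Complex.exp (x + rayAngle n * I) := by
  constructor
  · rintro ⟨n, t, ht, rfl⟩
    have ht' : 0 < t := lt_of_le_of_ne ht fun h => hz (by simp [← h])
    refine ⟨((n : ℕ) : ℤ), Real.log t, ?_⟩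
    rw [Complex.exp_add, ← rayDir_rayIdx, rayIdx_natCast, ← Complex.ofReal_exp,
      Real.exp_log ht']
  · rintro ⟨n, x, rfl⟩
    exact ray_mem_contour n x

theorem not_mem_contour {n : ℤ} {x φ : ℝ} (h : φ ∈ Ioo (rayAngle n) (rayAngle (n + 1))) :
    Complex.exp (x + φ * I) ∉ contour := by
  rw [mem_contour_iff (Complex.exp_ne_zero _)]
  rintro ⟨m, x', he⟩
  obtain ⟨-, k, hk⟩ := exp_eq_exp_polar_iff.mp he
  rw [← rayAngle_add_mul] at hk
  rw [hk, mem_Ioo, rayAngle_strictMono.lt_iff_lt, rayAngle_strictMono.lt_iff_lt] at h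
  omega

theorem exists_polar_of_not_mem_contour {z : ℂ} (hz : z ∉ contour) : ∃ (n : ℤ) (x φ : ℝ),
    φ ∈ Ioo (rayAngle n) (rayAngle (n + 1)) ∧ z = Complex.exp (x + φ * I) := by
  have hz0 : z ≠ 0 := fun h => hz (h ▸ zero_mem_contour)
  obtain ⟨n, x, φ, hφ, rfl⟩ := exists_polar hz0
  refine ⟨n, x, φ, ⟨lt_of_le_of_ne hφ.1 fun h => hz ?_, hφ.2⟩, rfl⟩
  rw [← h]
  exact ray_mem_contour n x

/-- Polar coordinates near a point. -/
theorem eventually_polar (x₀ φ₀ : ℝ) {η : ℝ} (hη : 0 < η) :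
    ∀ᶠ z in 𝓝 (Complex.exp (x₀ + φ₀ * I)), ∃ x φ : ℝ, |φ - φ₀| < η ∧
      z = Complex.exp (x + φ * I) ∧
      (0 < (z / Complex.exp (x₀ + φ₀ * I)).im → φ₀ < φ) ∧
      ((z / Complex.exp (x₀ + φ₀ * I)).im < 0 → φ < φ₀) ∧
      ((z / Complex.exp (x₀ + φ₀ * I)).im = 0 → φ = φ₀) := by
  set z₀ := Complex.exp (x₀ + φ₀ * I) with hz₀
  have h0 : z₀ ≠ 0 := Complex.exp_ne_zero _
  have hw : Tendsto (fun z : ℂ => z / z₀) (𝓝 z₀) (𝓝 1) := by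
    have : ContinuousAt (fun z : ℂ => z / z₀) z₀ := continuousAt_id.div_const _
    have h1 := this.tendsto
    rwa [div_self h0] at h1
  have harg : Tendsto (fun z : ℂ => arg (z / z₀)) (𝓝 z₀) (𝓝 0) := by
    have h1 := (continuousAt_arg one_mem_slitPlane).tendsto.comp hw
    rwa [arg_one] at h1
  have hmin : 0 < min η Real.pi := lt_min hη Real.pi_pos
  filter_upwards [harg.eventually (Metric.ball_mem_nhds 0 hmin),
    isOpen_ne.mem_nhds h0] with z hz hzne
  rw [Real.dist_eq, sub_zero, lt_min_iff] at hz
  have hwne : z / z₀ ≠ 0 := div_ne_zero hzne h0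
  refine ⟨Real.log ‖z / z₀‖ + x₀, arg (z / z₀) + φ₀, by simpa using hz.1, ?_, fun h => ?_,
    fun h => ?_, fun h => ?_⟩
  · have e : ((Real.log ‖z / z₀‖ + x₀ : ℝ) : ℂ) + ((arg (z / z₀) + φ₀ : ℝ) : ℂ) * I =
        ((Real.log ‖z / z₀‖ : ℝ) + (arg (z / z₀) : ℝ) * I) + (x₀ + φ₀ * I) := by push_cast; ring
    rw [e, Complex.exp_add, exp_log_norm_add_arg hwne, ← hz₀, div_mul_cancel₀ _ h0]
  · have h1 : 0 ≤ arg (z / z₀) := arg_nonneg_iff.mpr h.le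
    have h2 : arg (z / z₀) ≠ 0 := fun h3 => h.ne' (arg_eq_zero_iff.mp h3).2
    linarith [lt_of_le_of_ne h1 h2.symm]
  · linarith [arg_neg_iff.mpr h]
  · have h1 : 0 ≤ arg (z / z₀) := arg_nonneg_iff.mpr h.ge
    have h2 : ¬ arg (z / z₀) < 0 := not_lt.mpr h1
    have h3 : arg (z / z₀) = 0 := by
      by_contra h4
      have h5 : arg (z / z₀) = Real.pi := by
        rw [arg_eq_pi_iff]
        refine ⟨?_, h⟩
        by_contra! h6
        exact h4 (arg_eq_zero_iff.mpr ⟨h6, h⟩)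
      rw [h5, abs_of_pos Real.pi_pos] at hz
      exact lt_irrefl _ hz.2
    rw [h3, zero_add]

theorem eventually_sector {n : ℤ} {x₀ φ₀ : ℝ} (h : φ₀ ∈ Ioo (rayAngle n) (rayAngle (n + 1))) :
    ∀ᶠ z in 𝓝 (Complex.exp (x₀ + φ₀ * I)), ∃ x φ : ℝ,
      φ ∈ Ioo (rayAngle n) (rayAngle (n + 1)) ∧ z = Complex.exp (x + φ * I) := by
  have hη : 0 < min (φ₀ - rayAngle n) (rayAngle (n + 1) - φ₀) :=
    lt_min (sub_pos.mpr h.1) (sub_pos.mpr h.2)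
  filter_upwards [eventually_polar x₀ φ₀ hη] with z ⟨x, φ, h1, h2, _⟩
  rw [lt_min_iff, abs_lt, abs_lt] at h1
  exact ⟨x, φ, ⟨by linarith [h1.1.1], by linarith [h1.2.2]⟩, h2⟩

theorem isOpen_compl_contour : IsOpen contourᶜ := by
  rw [isOpen_iff_mem_nhds]
  intro z hz
  obtain ⟨n, x, φ, hφ, rfl⟩ := exists_polar_of_not_mem_contour hz
  filter_upwards [eventually_sector hφ] with w ⟨x, φ, h1, h2⟩
  rw [h2]
  exact not_mem_contour h1

/-- Near a ray: the upper side belongs to sector `n`, the lower side to sector `n - 1`. -/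
theorem eventually_ray (n : ℤ) (x₀ : ℝ) :
    ∀ᶠ z in 𝓝 (Complex.exp (x₀ + rayAngle n * I)),
      (0 < (z / Complex.exp (x₀ + rayAngle n * I)).im → ∃ x φ : ℝ,
        φ ∈ Ioo (rayAngle n) (rayAngle (n + 1)) ∧ z = Complex.exp (x + φ * I)) ∧
      ((z / Complex.exp (x₀ + rayAngle n * I)).im < 0 → ∃ x φ : ℝ,
        φ ∈ Ioo (rayAngle (n - 1)) (rayAngle (n - 1 + 1)) ∧ z = Complex.exp (x + φ * I)) ∧
      ((z / Complex.exp (x₀ + rayAngle n * I)).im = 0 → z ∈ contour) := by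
  have hη : 0 < 10 * tilt := by linarith [tilt_pos]
  have hs := rayAngle_succ n
  have hs' := rayAngle_succ (n - 1)
  rw [sub_add_cancel] at hs'
  filter_upwards [eventually_polar x₀ (rayAngle n) hη] with z ⟨x, φ, h1, h2, h3, h4, h5⟩
  rw [abs_lt] at h1
  refine ⟨fun h => ⟨x, φ, ⟨h3 h, by linarith⟩, h2⟩, fun h => ⟨x, φ, ⟨by linarith, ?_⟩, h2⟩,
    fun h => ?_⟩
  · rw [sub_add_cancel]; exact h4 h
  · rw [h2, h5 h]
    exact ray_mem_contour n x

/-- Points of the rays are limits of slightly rotated points. Extending `unjumped` by its limits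
requires this. -/
theorem compl_zero_subset_closure : ({0}ᶜ : Set ℂ) ⊆ closure contourᶜ := by
  intro z hz
  by_cases hc : z ∈ contour
  · obtain ⟨n, x, rfl⟩ := (mem_contour_iff hz).mp hc
    have hlim : Tendsto (fun φ : ℝ => Complex.exp (x + φ * I)) (𝓝[>] (rayAngle n))
        (𝓝 (Complex.exp (x + rayAngle n * I))) := by
      have : Continuous fun φ : ℝ => Complex.exp (x + φ * I) := by fun_prop
      exact (this.tendsto _).mono_left nhdsWithin_le_nhds
    refine mem_closure_of_tendsto hlim ?_
    filter_upwards [Ioo_mem_nhdsGT (rayAngle_strictMono (lt_add_one n))] with φ hφ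
    exact not_mem_contour hφ
  · exact subset_closure hc

open scoped Matrix.Norms.Operator

/-! ### Entire continuations of the solution from the sectors -/

/-- Square matrices of size three. -/
abbrev Mat := Matrix (Fin 3) (Fin 3) ℂ

theorem norm_apply_le (A : Mat) (i j : Fin 3) : ‖A i j‖ ≤ ‖A‖ := by
  rw [Matrix.linfty_opNorm_def]
  have h1 := Finset.le_sup (f := fun i => ∑ j, ‖A i j‖₊) (Finset.mem_univ i)
  have h2 := Finset.single_le_sum (f := fun j => ‖A i j‖₊) (fun _ _ => zero_le) (Finset.mem_univ j)
  exact_mod_cast h2.trans h1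

theorem norm_le_of_apply_le {A : Mat} {C : ℝ} (h : ∀ i j, ‖A i j‖ ≤ C) : ‖A‖ ≤ 3 * C := by
  have hC : 0 ≤ C := (norm_nonneg _).trans (h 0 0)
  lift C to NNReal using hC
  rw [Matrix.linfty_opNorm_def]
  have : (Finset.univ.sup fun i => ∑ j, ‖A i j‖₊) ≤ 3 * C :=
    Finset.sup_le fun i _ => (Finset.sum_le_sum fun j _ =>
      (show ‖A i j‖₊ ≤ C by exact_mod_cast h i j)).trans (by simp)
  exact_mod_cast this

theorem differentiable_of_apply {f : ℂ → Mat} (h : ∀ i j, Differentiable ℂ fun z => f z i j) :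
    Differentiable ℂ f :=
  differentiable_pi.mpr fun i => differentiable_pi.mpr fun j => h i j

theorem differentiable_apply {f : ℂ → Mat} (h : Differentiable ℂ f) (i j : Fin 3) :
    Differentiable ℂ fun z => f z i j :=
  differentiable_pi.mp (differentiable_pi.mp h i) j

/-- The diagonal matrix with the entries `e ^ f i`. -/
noncomputable def expDiag (f : Fin 3 → ℂ) : Mat := Matrix.diagonal fun i => Complex.exp (f i)

theorem expDiag_mul (f g : Fin 3 → ℂ) : expDiag f * expDiag g = expDiag (f + g) := by
  simp [expDiag, Matrix.diagonal_mul_diagonal, ← Complex.exp_add]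

theorem expDiag_zero : expDiag 0 = 1 := by simp [expDiag]

theorem expDiag_mul_neg (f : Fin 3 → ℂ) : expDiag f * expDiag (-f) = 1 := by
  rw [expDiag_mul, add_neg_cancel, expDiag_zero]

theorem expDiag_neg_mul (f : Fin 3 → ℂ) : expDiag (-f) * expDiag f = 1 := by
  rw [expDiag_mul, neg_add_cancel, expDiag_zero]

theorem jump_eq (r₁ r₂ : ℂ) (n : Fin 12) (y : ℝ) (z : ℂ) :
    jump r₁ r₂ n y z = expDiag (phase y z) * jumpConst r₁ r₂ n * expDiag (-phase y z) := rfl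

theorem differentiable_expDiag {f : ℂ → Fin 3 → ℂ} (h : ∀ i, Differentiable ℂ fun z => f z i) :
    Differentiable ℂ fun z => expDiag (f z) := by
  refine differentiable_of_apply fun i j => ?_
  unfold expDiag
  rcases eq_or_ne i j with rfl | hij
  · simp only [Matrix.diagonal_apply_eq]
    have := h i
    fun_prop
  · simp only [Matrix.diagonal_apply_ne _ hij]
    fun_prop

theorem differentiable_phase (y : ℝ) (i : Fin 3) : Differentiable ℂ fun z => phase y z i := by
  unfold phase; fun_prop

theorem differentiable_expDiag_phase (y : ℝ) : Differentiable ℂ fun z => expDiag (phase y z) :=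
  differentiable_expDiag (differentiable_phase y)

theorem differentiable_expDiag_neg_phase (y : ℝ) :
    Differentiable ℂ fun z => expDiag (-phase y z) :=
  differentiable_expDiag fun i => (differentiable_phase y i).neg

theorem det_jumpConst (r₁ r₂ : ℂ) (n : Fin 12) : (jumpConst r₁ r₂ n).det = 1 := by
  fin_cases n <;> simp [jumpConst, Matrix.det_fin_three]

/-- The solution of the Riemann-Hilbert problem in the sectors, continued to entire functions. -/
structure IsEntireSolution (r₁ r₂ : ℂ) (y : ℝ) (M : ℤ → ℂ → Mat) : Prop where
  differentiable : ∀ n, Differentiable ℂ (M n)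
  periodic : ∀ n, M (n + 12) = M n
  jump : ∀ n z, M n z = M (n - 1) z * PainleveModel.jump r₁ r₂ (rayIdx n) y z
  tendsto_one : ∀ ε > 0, ∀ᶠ x : ℝ in atTop, ∀ n, ∀ φ ∈ Icc (rayAngle n) (rayAngle (n + 1)),
    ‖M n (Complex.exp (x + φ * I)) - 1‖ ≤ ε

/-- The product `J₀ ⋯ Jₙ` of the constant jumps. -/
noncomputable def jumpProd (r₁ r₂ : ℂ) (n : Fin 12) : Mat :=
  ((List.ofFn (jumpConst r₁ r₂)).take (n + 1)).prod

theorem jumpProd_succ (r₁ r₂ : ℂ) (n : ℕ) (h : n + 1 < 12) :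
    jumpProd r₁ r₂ ⟨n + 1, h⟩ = jumpProd r₁ r₂ ⟨n, by omega⟩ * jumpConst r₁ r₂ ⟨n + 1, h⟩ := by
  unfold jumpProd
  rw [List.prod_take_succ _ (n + 1) (by rw [List.length_ofFn]; exact h), List.getElem_ofFn]

/-- The recursion for partial products is cyclic only because the complete product is `I`: at index
zero the predecessor is the full product. The consistency condition enters the Riemann-Hilbert
analysis here. -/
theorem jumpProd_eq {r₁ r₂ : ℂ} (h : (List.ofFn (jumpConst r₁ r₂)).prod = 1) (n : ℤ) :
    jumpProd r₁ r₂ (rayIdx n) =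
      jumpProd r₁ r₂ (rayIdx (n - 1)) * jumpConst r₁ r₂ (rayIdx n) := by
  have key : ∀ m : Fin 12, jumpProd r₁ r₂ m = jumpProd r₁ r₂ (m - 1) * jumpConst r₁ r₂ m := by
    rintro ⟨m, hm⟩
    rcases m with _ | m
    · have e : (⟨0, hm⟩ - 1 : Fin 12) = ⟨11, by omega⟩ := rfl
      rw [e]
      have h11 : jumpProd r₁ r₂ ⟨11, by omega⟩ = 1 := by
        unfold jumpProd
        rw [List.take_of_length_le (by simp), h]
      rw [h11, one_mul]
      simp [jumpProd, List.ofFn_succ]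
    · have e : (⟨m + 1, hm⟩ - 1 : Fin 12) = ⟨m, by omega⟩ := by
        rw [sub_eq_iff_eq_add]
        apply Fin.ext
        rw [Fin.val_add]
        simp
        omega
      rw [e, jumpProd_succ]
  have e : rayIdx (n - 1) = rayIdx n - 1 := by
    have h1 : ((n - 1 : ℤ) : ZMod 12) = (n : ZMod 12) - 1 := by push_cast; ring
    exact h1
  rw [e]
  exact key _

theorem det_jumpProd (r₁ r₂ : ℂ) (n : Fin 12) : (jumpProd r₁ r₂ n).det = 1 := by
  obtain ⟨n, hn⟩ := n
  induction n with
  | zero =>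
    have : jumpProd r₁ r₂ ⟨0, hn⟩ = jumpConst r₁ r₂ 0 := by simp [jumpProd, List.ofFn_succ]
    rw [this, det_jumpConst]
  | succ n ih => rw [jumpProd_succ, Matrix.det_mul, ih, det_jumpConst, one_mul]

theorem jumpProd_mul_inv (r₁ r₂ : ℂ) (n : Fin 12) :
    jumpProd r₁ r₂ n * (jumpProd r₁ r₂ n)⁻¹ = 1 :=
  Matrix.mul_nonsing_inv _ (by rw [det_jumpProd]; exact isUnit_one)

theorem jumpProd_inv_mul (r₁ r₂ : ℂ) (n : Fin 12) :
    (jumpProd r₁ r₂ n)⁻¹ * jumpProd r₁ r₂ n = 1 :=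
  Matrix.nonsing_inv_mul _ (by rw [det_jumpProd]; exact isUnit_one)

section Continuation

variable {r₁ r₂ : ℂ} {y : ℝ} {M : ℂ → Mat}

/-- The solution with the jumps removed. -/
noncomputable def unjumped (r₁ r₂ : ℂ) (y : ℝ) (M : ℂ → Mat) (z : ℂ) : Mat :=
  M z * expDiag (phase y z) * (jumpProd r₁ r₂ (rayIdx (sectorIdx (arg z))))⁻¹

/-- The argument of the point may differ from `φ` by a multiple of `2π`; this changes the sector
index by a multiple of twelve, which `rayIdx` ignores. -/
theorem rayIdx_sectorIdx {n : ℤ} {x φ : ℝ} (h : φ ∈ Ioo (rayAngle n) (rayAngle (n + 1))) :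
    rayIdx (sectorIdx (arg (Complex.exp (x + φ * I)))) = rayIdx n := by
  have h1 := exp_log_norm_add_arg (Complex.exp_ne_zero (x + φ * I))
  obtain ⟨-, k, hk⟩ := exp_eq_exp_polar_iff.mp h1
  rw [hk, sectorIdx_eq (n := n + 12 * k), rayIdx_add_mul]
  have h2 := rayAngle_add_mul n k
  have h3 := rayAngle_add_mul (n + 1) k
  rw [add_right_comm] at h3
  exact ⟨by rw [h2]; linarith [h.1], by rw [h3]; linarith [h.2]⟩

theorem unjumped_eq {n : ℤ} {z : ℂ} (h : ∃ x φ : ℝ,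
    φ ∈ Ioo (rayAngle n) (rayAngle (n + 1)) ∧ z = Complex.exp (x + φ * I)) :
    unjumped r₁ r₂ y M z = M z * expDiag (phase y z) * (jumpProd r₁ r₂ (rayIdx n))⁻¹ := by
  obtain ⟨x, φ, h, rfl⟩ := h
  rw [unjumped, rayIdx_sectorIdx h]

theorem IsSolution.differentiableAt (hM : IsSolution r₁ r₂ y M) {z : ℂ} (hz : z ∉ contour) :
    DifferentiableAt ℂ M z :=
  differentiableAt_pi.mpr fun i => differentiableAt_pi.mpr fun j =>
    (hM.analytic i j).differentiableAt (isOpen_compl_contour.mem_nhds hz)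

theorem IsSolution.differentiableAt_unjumped (hM : IsSolution r₁ r₂ y M) {z : ℂ}
    (hz : z ∉ contour) : DifferentiableAt ℂ (unjumped r₁ r₂ y M) z := by
  obtain ⟨n, x, φ, hφ, rfl⟩ := exists_polar_of_not_mem_contour hz
  have hev : unjumped r₁ r₂ y M =ᶠ[𝓝 (Complex.exp (x + φ * I))]
      fun z => M z * expDiag (phase y z) * (jumpProd r₁ r₂ (rayIdx n))⁻¹ := by
    filter_upwards [eventually_sector hφ] with z hz
    exact unjumped_eq hz
  refine DifferentiableAt.congr_of_eventuallyEq ?_ hev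
  exact ((hM.differentiableAt hz).mul (differentiable_expDiag_phase y _)).mul_const _

/-- With `Pₙ` the partial products and `Jₙ` the constant jumps, `M₊ e^θ Pₙ⁻¹ = M₋ e^θ Jₙ Pₙ⁻¹ = M₋
e^θ Pₙ₋₁⁻¹`: the limits from the two sides of the ray coincide. -/
theorem IsSolution.tendsto_unjumped_ray (hM : IsSolution r₁ r₂ y M)
    (hr : (List.ofFn (jumpConst r₁ r₂)).prod = 1) (n : ℤ) (x : ℝ) :
    ∃ L, Tendsto (unjumped r₁ r₂ y M) (𝓝[contourᶜ] (Complex.exp (x + rayAngle n * I))) (𝓝 L) := by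
  obtain ⟨Mp, Mm, hp, hm, hpm⟩ := hM.jump (rayIdx n) (Real.exp x) (Real.exp_pos x)
  have hz₀ : ((Real.exp x : ℝ) : ℂ) * rayDir (rayIdx n) = Complex.exp (x + rayAngle n * I) := by
    rw [rayDir_rayIdx, Complex.exp_add, Complex.ofReal_exp]
  rw [hz₀] at hp hm hpm
  set z₀ := Complex.exp (x + rayAngle n * I) with hz₀'
  have hexp : Tendsto (fun z => expDiag (phase y z)) (𝓝 z₀) (𝓝 (expDiag (phase y z₀))) :=
    (differentiable_expDiag_phase y).continuous.tendsto _
  have hray := eventually_ray n x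
  rw [← hz₀'] at hray
  have h1 : Tendsto (unjumped r₁ r₂ y M) (𝓝[{ζ | 0 < (ζ / z₀).im}] z₀)
      (𝓝 (Mp * expDiag (phase y z₀) * (jumpProd r₁ r₂ (rayIdx n))⁻¹)) := by
    refine (((hp.mul (hexp.mono_left nhdsWithin_le_nhds)).mul_const _)).congr' ?_
    filter_upwards [nhdsWithin_le_nhds hray, self_mem_nhdsWithin] with z hz hz'
    exact (unjumped_eq (hz.1 hz')).symm
  have h2 : Tendsto (unjumped r₁ r₂ y M) (𝓝[{ζ | (ζ / z₀).im < 0}] z₀)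
      (𝓝 (Mm * expDiag (phase y z₀) * (jumpProd r₁ r₂ (rayIdx (n - 1)))⁻¹)) := by
    refine (((hm.mul (hexp.mono_left nhdsWithin_le_nhds)).mul_const _)).congr' ?_
    filter_upwards [nhdsWithin_le_nhds hray, self_mem_nhdsWithin] with z hz hz'
    exact (unjumped_eq (hz.2.1 hz')).symm
  have hQ : jumpConst r₁ r₂ (rayIdx n) * (jumpProd r₁ r₂ (rayIdx n))⁻¹ =
      (jumpProd r₁ r₂ (rayIdx (n - 1)))⁻¹ := by
    have e := jumpProd_eq hr n
    have e1 := jumpProd_mul_inv r₁ r₂ (rayIdx n)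
    have e2 := jumpProd_inv_mul r₁ r₂ (rayIdx (n - 1))
    calc _ = ((jumpProd r₁ r₂ (rayIdx (n - 1)))⁻¹ * jumpProd r₁ r₂ (rayIdx (n - 1))) *
          (jumpConst r₁ r₂ (rayIdx n) * (jumpProd r₁ r₂ (rayIdx n))⁻¹) := by rw [e2, one_mul]
      _ = (jumpProd r₁ r₂ (rayIdx (n - 1)))⁻¹ * ((jumpProd r₁ r₂ (rayIdx (n - 1)) *
          jumpConst r₁ r₂ (rayIdx n)) * (jumpProd r₁ r₂ (rayIdx n))⁻¹) := by
            simp only [mul_assoc]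
      _ = _ := by rw [← e, e1, mul_one]
  have heq : Mp * expDiag (phase y z₀) * (jumpProd r₁ r₂ (rayIdx n))⁻¹ =
      Mm * expDiag (phase y z₀) * (jumpProd r₁ r₂ (rayIdx (n - 1)))⁻¹ := by
    rw [hpm, jump_eq]
    calc _ = Mm * expDiag (phase y z₀) * (jumpConst r₁ r₂ (rayIdx n) *
          ((expDiag (-phase y z₀) * expDiag (phase y z₀)) *
            (jumpProd r₁ r₂ (rayIdx n))⁻¹)) := by simp only [mul_assoc]
      _ = _ := by rw [expDiag_neg_mul, one_mul, hQ]
  rw [heq] at h1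
  refine ⟨_, (h1.sup h2).mono_left ?_⟩
  rw [← nhdsWithin_union]
  refine nhdsWithin_le_iff.mpr ?_
  filter_upwards [nhdsWithin_le_nhds hray, self_mem_nhdsWithin] with z hz hz'
  rcases lt_trichotomy (z / z₀).im 0 with h | h | h
  · exact Or.inr h
  · exact absurd (hz.2.2 h) hz'
  · exact Or.inl h

theorem IsSolution.tendsto_unjumped (hM : IsSolution r₁ r₂ y M)
    (hr : (List.ofFn (jumpConst r₁ r₂)).prod = 1) {z : ℂ} (hz : z ≠ 0) :
    ∃ L, Tendsto (unjumped r₁ r₂ y M) (𝓝[contourᶜ] z) (𝓝 L) := by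
  by_cases hc : z ∈ contour
  · obtain ⟨n, x, rfl⟩ := (mem_contour_iff hz).mp hc
    exact hM.tendsto_unjumped_ray hr n x
  · exact ⟨_, ((hM.differentiableAt_unjumped hc).continuousAt.tendsto).mono_left nhdsWithin_le_nhds⟩

/-- The extension of `unjumped` to the rays. -/
noncomputable def glued (r₁ r₂ : ℂ) (y : ℝ) (M : ℂ → Mat) : ℂ → Mat :=
  extendFrom contourᶜ (unjumped r₁ r₂ y M)

theorem IsSolution.continuousOn_glued (hM : IsSolution r₁ r₂ y M)
    (hr : (List.ofFn (jumpConst r₁ r₂)).prod = 1) : ContinuousOn (glued r₁ r₂ y M) {0}ᶜ :=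
  continuousOn_extendFrom compl_zero_subset_closure fun _ hz => hM.tendsto_unjumped hr hz

theorem IsSolution.glued_eq (hM : IsSolution r₁ r₂ y M) {z : ℂ} (hz : z ∉ contour) :
    glued r₁ r₂ y M z = unjumped r₁ r₂ y M z :=
  extendFrom_extends (fun _ hw => (hM.differentiableAt_unjumped hw).continuousAt.continuousWithinAt)
    z hz

theorem IsSolution.differentiableAt_glued_of_not_mem (hM : IsSolution r₁ r₂ y M) {z : ℂ}
    (hz : z ∉ contour) : DifferentiableAt ℂ (glued r₁ r₂ y M) z := by
  refine (hM.differentiableAt_unjumped hz).congr_of_eventuallyEq ?_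
  filter_upwards [isOpen_compl_contour.mem_nhds hz] with w hw
  exact hM.glued_eq hw

/-- Division by the point `z₀` turns its ray into the real axis near `1`, where
`differentiableOn_ball_of_off_line` applies. -/
theorem IsSolution.differentiableAt_glued (hM : IsSolution r₁ r₂ y M)
    (hr : (List.ofFn (jumpConst r₁ r₂)).prod = 1) {z : ℂ} (hz : z ≠ 0) :
    DifferentiableAt ℂ (glued r₁ r₂ y M) z := by
  by_cases hc : z ∈ contour
  swap
  · exact hM.differentiableAt_glued_of_not_mem hc
  obtain ⟨n, x, rfl⟩ := (mem_contour_iff hz).mp hc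
  set z₀ := Complex.exp (x + rayAngle n * I) with hz₀
  have hray := eventually_ray n x
  rw [← hz₀] at hray
  have hcont : Tendsto (fun w : ℂ => w * z₀) (𝓝 1) (𝓝 z₀) := by
    have : Continuous fun w : ℂ => w * z₀ := by fun_prop
    simpa using this.tendsto 1
  obtain ⟨r, hr0, hball⟩ := Metric.eventually_nhds_iff_ball.mp
    ((hcont.eventually hray).and (hcont.eventually (isOpen_ne.mem_nhds hz)))
  have hd : DifferentiableOn ℂ (fun w => glued r₁ r₂ y M (w * z₀)) (Metric.ball 1 r) := by
    refine differentiableOn_ball_of_off_line ?_ fun w hw him => ?_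
    · exact (hM.continuousOn_glued hr).comp (by fun_prop) fun w hw => (hball w hw).2
    · obtain ⟨⟨h1, h2, -⟩, -⟩ := hball w hw
      rw [mul_div_cancel_right₀ _ hz] at h1 h2
      rw [one_im] at him
      have hnc : w * z₀ ∉ contour := by
        rcases lt_or_gt_of_ne him with h | h
        · obtain ⟨x', φ, h3, h4⟩ := h2 h
          rw [h4]; exact not_mem_contour h3
        · obtain ⟨x', φ, h3, h4⟩ := h1 h
          rw [h4]; exact not_mem_contour h3
      exact (hM.differentiableAt_glued_of_not_mem hnc).comp w (by fun_prop)
  have hd1 : DifferentiableAt ℂ (fun w => glued r₁ r₂ y M (w * z₀)) (z₀ / z₀) := by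
    rw [div_self hz]
    exact hd.differentiableAt (Metric.ball_mem_nhds _ hr0)
  have := hd1.comp z₀ (f := fun z => z / z₀) (by fun_prop)
  refine this.congr_of_eventuallyEq (Eventually.of_forall fun w => ?_)
  simp only [Function.comp_apply]
  rw [div_mul_cancel₀ _ hz]

theorem IsSolution.glued_bounded (hM : IsSolution r₁ r₂ y M)
    (hr : (List.ofFn (jumpConst r₁ r₂)).prod = 1) :
    ∃ B δ : ℝ, 0 < δ ∧ ∀ z, z ≠ 0 → ‖z‖ < δ → ‖glued r₁ r₂ y M z‖ ≤ B := by
  obtain ⟨C, δ, hδ, hC⟩ := hM.bounded_zero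
  obtain ⟨B, hB⟩ := (isCompact_closedBall (0 : ℂ) δ).exists_bound_of_continuousOn
    (differentiable_expDiag_phase y).continuous.continuousOn
  set Q := ∑ n : Fin 12, ‖(jumpProd r₁ r₂ n)⁻¹‖ with hQ
  have hoff : ∀ z ∉ contour, ‖z‖ < δ → ‖unjumped r₁ r₂ y M z‖ ≤ 3 * C * B * Q := fun z hz hzδ => by
    have h1 := norm_le_of_apply_le (hC z hz hzδ)
    have h2 := hB z (by simpa using hzδ.le)
    have h3 : ∀ n, ‖(jumpProd r₁ r₂ n)⁻¹‖ ≤ Q := fun n =>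
      Finset.single_le_sum (f := fun n => ‖(jumpProd r₁ r₂ n)⁻¹‖) (fun _ _ => norm_nonneg _)
        (Finset.mem_univ n)
    unfold unjumped
    refine (norm_mul_le _ _).trans ?_
    have h4 : 0 ≤ 3 * C := (norm_nonneg _).trans h1
    have h5 : 0 ≤ B := (norm_nonneg _).trans h2
    refine mul_le_mul ((norm_mul_le _ _).trans ?_) (h3 _) (norm_nonneg _) (by positivity)
    exact mul_le_mul h1 h2 (norm_nonneg _) h4
  refine ⟨3 * C * B * Q, δ, hδ, fun z hz hzδ => ?_⟩
  have hcl := compl_zero_subset_closure hz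
  obtain ⟨L, hL⟩ := hM.tendsto_unjumped hr hz
  have e : glued r₁ r₂ y M z = L := extendFrom_eq hcl hL
  rw [e]
  have : (𝓝[contourᶜ] z).NeBot := mem_closure_iff_nhdsWithin_neBot.mp hcl
  refine le_of_tendsto hL.norm ?_
  have hball : ∀ᶠ w in 𝓝 z, ‖w‖ < δ := continuous_norm.continuousAt.eventually_lt_const hzδ
  filter_upwards [nhdsWithin_le_nhds hball, self_mem_nhdsWithin] with w h1 h2
  exact hoff w h2 h1

/-- Boundedness of `M` near the origin makes the singularity there removable. -/
theorem IsSolution.exists_entire_glued (hM : IsSolution r₁ r₂ y M)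
    (hr : (List.ofFn (jumpConst r₁ r₂)).prod = 1) :
    ∃ Φ : ℂ → Mat, Differentiable ℂ Φ ∧ ∀ z ∉ contour, Φ z = unjumped r₁ r₂ y M z := by
  obtain ⟨B, δ, hδ, hB⟩ := hM.glued_bounded hr
  set f := glued r₁ r₂ y M with hf
  set Φ := Function.update f 0 (limUnder (𝓝[≠] 0) f) with hΦ
  have hne : ∀ z, z ≠ 0 → Φ z = f z := fun z hz => Function.update_of_ne hz _ _
  refine ⟨Φ, fun z => ?_, fun z hz => ?_⟩
  · by_cases hz : z = 0
    · rw [hz]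
      have := differentiableOn_update_limUnder_of_bddAbove (f := f) (c := 0)
        (Metric.ball_mem_nhds (0 : ℂ) hδ)
        (fun w hw => (hM.differentiableAt_glued hr hw.2).differentiableWithinAt)
        ⟨B, by
          rintro _ ⟨w, hw, rfl⟩
          exact hB w hw.2 (by simpa using hw.1)⟩
      exact this.differentiableAt (Metric.ball_mem_nhds (0 : ℂ) hδ)
    · refine (hM.differentiableAt_glued hr hz).congr_of_eventuallyEq ?_
      filter_upwards [isOpen_ne.mem_nhds hz] with w hw
      exact hne w hw
  · rw [hne z (fun h => hz (h ▸ zero_mem_contour)), hf, hM.glued_eq hz]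

/-- With the entire function `Φ` and the partial products `Pₙ` put `Nₙ = Φ Pₙ e^{-θ}`. All later
arguments use these continuations, so boundary values on the contour no longer occur. -/
theorem IsSolution.exists_entire (hM : IsSolution r₁ r₂ y M)
    (hr : (List.ofFn (jumpConst r₁ r₂)).prod = 1) :
    ∃ N : ℤ → ℂ → Mat, IsEntireSolution r₁ r₂ y N ∧ ∀ (n : ℤ) (x φ : ℝ),
      φ ∈ Ioo (rayAngle n) (rayAngle (n + 1)) →
        M (Complex.exp (x + φ * I)) = N n (Complex.exp (x + φ * I)) := by
  obtain ⟨Φ, hΦd, hΦ⟩ := hM.exists_entire_glued hr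
  set N : ℤ → ℂ → Mat := fun n z =>
    Φ z * jumpProd r₁ r₂ (rayIdx n) * expDiag (-phase y z) with hN
  have hMN : ∀ (n : ℤ) (x φ : ℝ), φ ∈ Ioo (rayAngle n) (rayAngle (n + 1)) →
      M (Complex.exp (x + φ * I)) = N n (Complex.exp (x + φ * I)) := fun n x φ hφ => by
    simp only [hN]
    rw [hΦ _ (not_mem_contour hφ), unjumped_eq ⟨x, φ, hφ, rfl⟩]
    set z := Complex.exp (x + φ * I)
    calc M z = M z * (expDiag (phase y z) * (((jumpProd r₁ r₂ (rayIdx n))⁻¹ *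
          jumpProd r₁ r₂ (rayIdx n)) * expDiag (-phase y z))) := by
            rw [jumpProd_inv_mul, one_mul, expDiag_mul_neg, mul_one]
      _ = _ := by simp only [mul_assoc]
  have hd : ∀ n, Differentiable ℂ (N n) := fun n =>
    (hΦd.mul_const _).mul (differentiable_expDiag_neg_phase y)
  refine ⟨N, ⟨hd, fun n => ?_, fun n z => ?_, fun ε hε => ?_⟩, hMN⟩
  · simp only [hN, rayIdx_add_twelve]
  · simp only [hN]
    rw [jumpProd_eq hr n, jump_eq]
    calc _ = Φ z * jumpProd r₁ r₂ (rayIdx (n - 1)) * (1 * jumpConst r₁ r₂ (rayIdx n)) *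
          expDiag (-phase y z) := by simp only [mul_assoc, one_mul]
      _ = _ := by
        rw [← expDiag_neg_mul (phase y z)]
        simp only [mul_assoc]
  · have h1 := (tendsto_iff_norm_sub_tendsto_zero.mp hM.normalized).eventually_le_const hε
    rw [atInfty, eventually_inf_principal, ← comap_norm_atTop, eventually_comap] at h1
    obtain ⟨R, hR⟩ := eventually_atTop.mp h1
    filter_upwards [Real.tendsto_exp_atTop.eventually_ge_atTop R] with x hx n φ hφ
    -- The normalization is known off the contour only; by continuity of `N n` it extends to the
    -- closed sector.
    have hcl : IsClosed {φ : ℝ | ‖N n (Complex.exp (x + φ * I)) - 1‖ ≤ ε} := by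
      have := (hd n).continuous
      exact isClosed_le (by fun_prop) continuous_const
    have hsub : Ioo (rayAngle n) (rayAngle (n + 1)) ⊆
        {φ : ℝ | ‖N n (Complex.exp (x + φ * I)) - 1‖ ≤ ε} := fun φ hφ => by
      rw [mem_ofPred_eq, ← hMN n x φ hφ]
      exact hR _ hx _ (norm_exp_add_mul_I x φ) (not_mem_contour hφ)
    have := hcl.closure_subset_iff.mpr hsub
    rw [closure_Ioo (rayAngle_strictMono (lt_add_one n)).ne] at this
    exact this hφ

end Continuation

open scoped Matrix.Norms.Operator

/-! ### Decay of the jumps -/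

theorem om_eq_exp : om = Complex.exp ((2 * Real.pi / 3 : ℝ) * I) := by
  unfold om; congr 1; push_cast; ring

/-- On the ray the argument of `d z⁵` is `σ = ±π/12` up to full turns. Turning `z` by at most `tilt
= π/60` changes it by at most `5π/60`, so it stays within `π/6` of zero, and `√3 cos(π/6) = 3/2`.
This dictates the size of `tilt`. -/
theorem three_halves_le_re {d : ℂ} {ψ σ : ℝ} {n l : ℤ}
    (hd : d = Real.sqrt 3 * Complex.exp (ψ * I)) (hσ : |σ| ≤ Real.pi / 12)
    (h : ψ + 5 * rayAngle n = σ + l * (2 * Real.pi)) {x φ : ℝ} (hφ : |φ - rayAngle n| ≤ tilt) :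
    3 / 2 * Real.exp x ^ 5 ≤ (d * Complex.exp (x + φ * I) ^ 5).re := by
  have e : d * Complex.exp (x + φ * I) ^ 5 = ((Real.sqrt 3 * Real.exp x ^ 5 : ℝ) : ℂ) *
      Complex.exp (((σ + 5 * (φ - rayAngle n) : ℝ) : ℂ) * I) := by
    have h1 : (((σ + 5 * (φ - rayAngle n) : ℝ) : ℂ)) * I + l * (2 * Real.pi * I) =
        ψ * I + 5 * (φ * I) := by
      have : ((ψ + 5 * rayAngle n : ℝ) : ℂ) = ((σ + l * (2 * Real.pi) : ℝ) : ℂ) := by rw [h]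
      push_cast at this ⊢
      linear_combination (-I) * this
    have h2 := Complex.exp_add ((((σ + 5 * (φ - rayAngle n) : ℝ) : ℂ)) * I) (l * (2 * Real.pi * I))
    rw [Complex.exp_int_mul_two_pi_mul_I, mul_one, h1] at h2
    rw [← h2, hd, Complex.exp_add, Complex.exp_add, mul_pow, ← Complex.exp_nat_mul (φ * I)]
    push_cast
    ring
  rw [e, Complex.re_ofReal_mul, Complex.exp_ofReal_mul_I_re]
  have hle : |σ + 5 * (φ - rayAngle n)| ≤ Real.pi / 6 := by
    refine (abs_add_le _ _).trans ?_
    rw [abs_mul, abs_of_pos (by norm_num : (0 : ℝ) < 5)]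
    unfold tilt at hφ
    linarith
  have hcos : Real.sqrt 3 / 2 ≤ Real.cos (σ + 5 * (φ - rayAngle n)) := by
    rw [← Real.cos_pi_div_six, ← Real.cos_abs (σ + _)]
    exact Real.cos_le_cos_of_nonneg_of_le_pi (abs_nonneg _) (by linarith [Real.pi_pos]) hle
  have h3 : Real.sqrt 3 * Real.sqrt 3 = 3 := Real.mul_self_sqrt (by norm_num)
  have h5 : 0 ≤ Real.exp x ^ 5 := by positivity
  calc 3 / 2 * Real.exp x ^ 5 = Real.sqrt 3 * Real.exp x ^ 5 * (Real.sqrt 3 / 2) := by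
        linear_combination (-(Real.exp x ^ 5) / 2) * h3
    _ ≤ _ := by gcongr

theorem om_sub_one : om - 1 = Real.sqrt 3 * Complex.exp ((5 * Real.pi / 6 : ℝ) * I) := by
  have h3 : Real.sqrt 3 * Real.sqrt 3 = 3 := Real.mul_self_sqrt (by norm_num)
  have e1 : 5 * Real.pi / 6 = Real.pi - Real.pi / 6 := by ring
  rw [om_eq_exp, exp_mul_I, exp_mul_I, ← ofReal_cos, ← ofReal_sin, ← ofReal_cos, ← ofReal_sin]
  have e2 : 2 * Real.pi / 3 = Real.pi - Real.pi / 3 := by ring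
  rw [e1, e2, Real.cos_pi_sub, Real.sin_pi_sub, Real.cos_pi_sub, Real.sin_pi_sub,
    Real.cos_pi_div_six, Real.sin_pi_div_six, Real.cos_pi_div_three, Real.sin_pi_div_three]
  apply Complex.ext <;> simp <;> nlinarith

theorem neg_sqrt_three_mul_exp {d : ℂ} {ψ : ℝ} (h : d = Real.sqrt 3 * Complex.exp (ψ * I)) :
    -d = Real.sqrt 3 * Complex.exp ((ψ + Real.pi : ℝ) * I) := by
  rw [h]; push_cast; rw [add_mul, Complex.exp_add, Complex.exp_pi_mul_I]; ring

theorem om_mul_sqrt_three_mul_exp {d : ℂ} {ψ : ℝ} (h : d = Real.sqrt 3 * Complex.exp (ψ * I)) :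
    om * d = Real.sqrt 3 * Complex.exp ((ψ + 2 * Real.pi / 3 : ℝ) * I) := by
  rw [h, om_eq_exp]; push_cast; rw [add_mul, Complex.exp_add]; ring

theorem jumpConst_eq (r₁ r₂ : ℂ) (m : Fin 12) : jumpConst r₁ r₂ m =
    1 + Matrix.single (![0, 1, 2, 0, 2, 0, 1, 2, 1, 2, 0, 1] m)
      (![1, 2, 1, 2, 0, 1, 0, 1, 2, 0, 2, 0] m)
      (![-r₁, -conj r₂, r₂, conj r₁, -r₁, -conj r₂, r₂, conj r₁, -r₁, -conj r₂, r₂, conj r₁] m) := by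
  fin_cases m <;> ext a b <;> fin_cases a <;> fin_cases b <;> simp [jumpConst, Matrix.single]

/-- The only off-diagonal entry of each jump sits at the position `(i, j)` for which `(λᵢ² - λⱼ²)
z⁵` points nearly in the positive direction on that ray. As this term enters the exponent `θᵢ - θⱼ`
with the factor `-9/5`, the jump decays. -/
theorem exists_single {r₁ r₂ : ℂ} (h₁ : ‖r₁‖ ≤ 1) (h₂ : ‖r₂‖ ≤ 1) (n : ℤ) :
    ∃ i j : Fin 3, ∃ c : ℂ, i ≠ j ∧ ‖c‖ ≤ 1 ∧
      jumpConst r₁ r₂ (rayIdx n) = 1 + Matrix.single i j c ∧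
      ∀ x φ : ℝ, |φ - rayAngle n| ≤ tilt →
        3 / 2 * Real.exp x ^ 5 ≤ ((lam i ^ 2 - lam j ^ 2) * Complex.exp (x + φ * I) ^ 5).re := by
  have h₁' : ‖conj r₁‖ ≤ 1 := by simpa using h₁
  have h₂' : ‖conj r₂‖ ≤ 1 := by simpa using h₂
  have h₁n : ‖-r₁‖ ≤ 1 := by simpa using h₁
  have h₂n : ‖-conj r₂‖ ≤ 1 := by simpa using h₂
  have hπ := Real.pi_pos
  have d12 := om_sub_one
  have d20 := om_mul_sqrt_three_mul_exp (om_mul_sqrt_three_mul_exp (d12))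
  have d01 := om_mul_sqrt_three_mul_exp d12
  have d21 := neg_sqrt_three_mul_exp d12
  have d02 := neg_sqrt_three_mul_exp d20
  have d10 := neg_sqrt_three_mul_exp d01
  have hω := om_cube
  have l0 : lam 0 ^ 2 = om ^ 2 := rfl
  have l1 : lam 1 ^ 2 = om := by
    change (om ^ 2) ^ 2 = om
    linear_combination om * hω
  have l2 : lam 2 ^ 2 = 1 := by simp [lam]
  obtain ⟨m, hm, k, rfl⟩ : ∃ m : ℤ, (0 ≤ m ∧ m < 12) ∧ ∃ k : ℤ, n = m + 12 * k :=
    ⟨n % 12, ⟨Int.emod_nonneg _ (by norm_num), Int.emod_lt_of_pos _ (by norm_num)⟩, n / 12,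
      (Int.emod_add_mul_ediv n 12).symm⟩
  have key : ∀ (i j : Fin 3) (ψ σ : ℝ) (l : ℤ),
      lam i ^ 2 - lam j ^ 2 = Real.sqrt 3 * Complex.exp (ψ * I) → |σ| ≤ Real.pi / 12 →
      ψ + 5 * ((2 * m + 1) * Real.pi / 12) = σ + l * (2 * Real.pi) →
      ∀ x φ : ℝ, |φ - rayAngle (m + 12 * k)| ≤ tilt →
        3 / 2 * Real.exp x ^ 5 ≤ ((lam i ^ 2 - lam j ^ 2) * Complex.exp (x + φ * I) ^ 5).re := by
    intro i j ψ σ l hd hσ h x φ hφ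
    refine three_halves_le_re (l := l + 5 * k) hd hσ ?_ hφ
    rw [rayAngle_add_mul, rayAngle]
    push_cast
    linear_combination h
  have sp : |Real.pi / 12| ≤ Real.pi / 12 := (abs_of_pos (by positivity)).le
  have sn : |-(Real.pi / 12)| ≤ Real.pi / 12 := by rw [abs_neg]; exact sp
  rw [rayIdx_add_mul]
  have e01 : lam 0 ^ 2 - lam 1 ^ 2 = om * (om - 1) := by rw [l0, l1]; ring
  have e10 : lam 1 ^ 2 - lam 0 ^ 2 = -(om * (om - 1)) := by rw [l0, l1]; ring
  have e12 : lam 1 ^ 2 - lam 2 ^ 2 = om - 1 := by rw [l2, l1]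
  have e21 : lam 2 ^ 2 - lam 1 ^ 2 = -(om - 1) := by rw [l2, l1]; ring
  have e20 : lam 2 ^ 2 - lam 0 ^ 2 = om * (om * (om - 1)) := by
    rw [l2, l0]; linear_combination -hω
  have e02 : lam 0 ^ 2 - lam 2 ^ 2 = -(om * (om * (om - 1))) := by
    rw [l2, l0]; linear_combination hω
  obtain ⟨hm0, hm1⟩ := hm
  interval_cases m
  -- In each of the twelve cases the direction of `λᵢ² - λⱼ²` plus five times the angle of the ray
  -- equals `±π/12` plus full turns; `sn` or `sp` selects the sign, and the number passed to `key`
  -- counts the turns.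
  · exact ⟨0, 1, -r₁, by decide, h₁n, jumpConst_eq r₁ r₂ 0,
      key _ _ _ _ 1 (e01.trans d01) sn (by push_cast; ring)⟩
  · exact ⟨1, 2, -conj r₂, by decide, h₂n, jumpConst_eq r₁ r₂ 1,
      key _ _ _ _ 1 (e12.trans d12) sp (by push_cast; ring)⟩
  · exact ⟨2, 1, r₂, by decide, h₂, jumpConst_eq r₁ r₂ 2,
      key _ _ _ _ 2 (e21.trans d21) sn (by push_cast; ring)⟩
  · exact ⟨0, 2, conj r₁, by decide, h₁', jumpConst_eq r₁ r₂ 3,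
      key _ _ _ _ 3 (e02.trans d02) sp (by push_cast; ring)⟩
  · exact ⟨2, 0, -r₁, by decide, h₁n, jumpConst_eq r₁ r₂ 4,
      key _ _ _ _ 3 (e20.trans d20) sn (by push_cast; ring)⟩
  · exact ⟨0, 1, -conj r₂, by decide, h₂n, jumpConst_eq r₁ r₂ 5,
      key _ _ _ _ 3 (e01.trans d01) sp (by push_cast; ring)⟩
  · exact ⟨1, 0, r₂, by decide, h₂, jumpConst_eq r₁ r₂ 6,
      key _ _ _ _ 4 (e10.trans d10) sn (by push_cast; ring)⟩
  · exact ⟨2, 1, conj r₁, by decide, h₁', jumpConst_eq r₁ r₂ 7,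
      key _ _ _ _ 4 (e21.trans d21) sp (by push_cast; ring)⟩
  · exact ⟨1, 2, -r₁, by decide, h₁n, jumpConst_eq r₁ r₂ 8,
      key _ _ _ _ 4 (e12.trans d12) sn (by push_cast; ring)⟩
  · exact ⟨2, 0, -conj r₂, by decide, h₂n, jumpConst_eq r₁ r₂ 9,
      key _ _ _ _ 5 (e20.trans d20) sp (by push_cast; ring)⟩
  · exact ⟨0, 2, r₂, by decide, h₂, jumpConst_eq r₁ r₂ 10,
      key _ _ _ _ 6 (e02.trans d02) sn (by push_cast; ring)⟩
  · exact ⟨1, 0, conj r₁, by decide, h₁', jumpConst_eq r₁ r₂ 11,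
      key _ _ _ _ 6 (e10.trans d10) sp (by push_cast; ring)⟩

theorem norm_lam (i : Fin 3) : ‖lam i‖ = 1 := by
  have h : ‖om‖ = 1 := by rw [om_eq_exp, norm_exp_ofReal_mul_I]
  fin_cases i <;> simp [lam, h]

/-- The constant in the estimates of the jumps. -/
noncomputable def decayConst (Y : ℝ) : ℝ := Real.exp ((2 * Y + 3) * (2 * Y + 4))

theorem decayConst_pos (Y : ℝ) : 0 < decayConst Y := Real.exp_pos _

theorem decayConst_mono {Y Z : ℝ} (hY : 0 ≤ Y) (h : Y ≤ Z) : decayConst Y ≤ decayConst Z := by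
  have : 0 ≤ 2 * Z + 3 := by linarith
  unfold decayConst; gcongr

/-- For `t ≤ 2Y + 4` the constant alone dominates; beyond that point `t⁵ ≥ (2Y + 4) t` wins. The
coefficient `27/10` is `9/5 · 3/2`, and the extra `2t` leaves room for changing `y` by at most one.
-/
theorem exp_quintic_le {Y t : ℝ} (hY : 0 ≤ Y) (ht : 0 ≤ t) :
    Real.exp (2 * Y * t + 2 * t - 27 / 10 * t ^ 5) ≤ decayConst Y * Real.exp (-t) := by
  rw [decayConst, ← Real.exp_add]
  refine Real.exp_le_exp.mpr ?_
  have h5 : 0 ≤ t ^ 5 := by positivity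
  rcases le_total t (2 * Y + 4) with h | h
  · have := mul_le_mul_of_nonneg_left h (by linarith : (0 : ℝ) ≤ 2 * Y + 3)
    nlinarith
  · have h4 : t ≤ t ^ 4 := le_self_pow₀ (by linarith) (by norm_num)
    have := mul_le_mul_of_nonneg_left (h.trans h4) ht
    nlinarith

/-- The jump is `1 + e s`, with a constant nilpotent `s` and the scalar `e = exp(θᵢ - θⱼ)` carrying
all dependence on `y` and `z`. In the Lipschitz estimate in `y`, the difference of phases
contributes a factor `|z|`, hence the weight with exponent one: just what `IsSectorial.norm_le`
requires. -/
theorem exists_jump_factor {r₁ r₂ : ℂ} (h₁ : ‖r₁‖ ≤ 1) (h₂ : ‖r₂‖ ≤ 1) (n : ℤ) :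
    ∃ (s : Mat) (e : ℝ → ℂ → ℂ), s * s = 0 ∧ ‖s‖ ≤ 3 ∧
      (∀ y z, jump r₁ r₂ (rayIdx n) y z = 1 + e y z • s) ∧
      (∀ y x φ : ℝ, |φ - rayAngle n| ≤ tilt →
        ‖e y (Complex.exp (x + φ * I))‖ ≤ decayConst |y| * expWeight 0 x) ∧
      (∀ y y' x φ : ℝ, |φ - rayAngle n| ≤ tilt → |y' - y| ≤ 1 →
        ‖e y' (Complex.exp (x + φ * I)) - e y (Complex.exp (x + φ * I))‖ ≤
          2 * decayConst |y| * |y' - y| * expWeight 1 x) := by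
  obtain ⟨i, j, c, hij, hc, hJ, hre⟩ := exists_single h₁ h₂ n
  have hl : ‖lam i - lam j‖ ≤ 2 := (norm_sub_le _ _).trans (by rw [norm_lam, norm_lam]; norm_num)
  have hb : ∀ y x φ : ℝ, |φ - rayAngle n| ≤ tilt →
      ‖Complex.exp (phase y (Complex.exp (x + φ * I)) i - phase y (Complex.exp (x + φ * I)) j)‖ ≤
        Real.exp (2 * |y| * Real.exp x - 27 / 10 * Real.exp x ^ 5) := fun y x φ h => by
    rw [Complex.norm_exp]
    refine Real.exp_le_exp.mpr ?_
    have h1 := hre x φ h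
    have hz := norm_exp_add_mul_I x φ
    set z := Complex.exp (x + φ * I)
    have e1 : phase y z i - phase y z j =
        (y * z * (lam i - lam j)) - ((9 / 5 : ℝ) : ℂ) * ((lam i ^ 2 - lam j ^ 2) * z ^ 5) := by
      unfold phase; push_cast; ring
    rw [e1, sub_re, re_ofReal_mul]
    have h2 : (y * z * (lam i - lam j)).re ≤ |y| * Real.exp x * 2 := by
      refine (re_le_norm _).trans ?_
      rw [norm_mul, norm_mul, hz, Complex.norm_real, Real.norm_eq_abs]
      gcongr
    linarith
  refine ⟨Matrix.single i j c, fun y z => Complex.exp (phase y z i - phase y z j), ?_, ?_, ?_, ?_,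
    ?_⟩
  · rw [Matrix.single_mul_single_of_ne]
    exact hij.symm
  · refine (norm_le_of_apply_le (C := 1) fun a b => ?_).trans (by norm_num)
    rw [Matrix.single_apply]
    split_ifs
    · exact hc
    · simp
  · intro y z
    rw [jump_eq, hJ, mul_add, add_mul, mul_one, expDiag_mul_neg]
    congr 1
    ext a b
    simp only [expDiag, Matrix.diagonal_mul, Matrix.mul_diagonal, Matrix.smul_apply,
      Matrix.single_apply, smul_eq_mul, Pi.neg_apply]
    split_ifs with h
    · obtain ⟨rfl, rfl⟩ := h
      rw [sub_eq_add_neg, Complex.exp_add]; ring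
    · simp
  · intro y x φ h
    refine (hb y x φ h).trans (le_trans ?_ (exp_quintic_le (abs_nonneg y) (Real.exp_pos x).le
      |>.trans_eq (by simp [expWeight])))
    refine Real.exp_le_exp.mpr ?_
    linarith [Real.exp_pos x]
  · intro y y' x φ h hy
    have h0 := hb y x φ h
    have hz := norm_exp_add_mul_I x φ
    set z := Complex.exp (x + φ * I)
    set w := ((y' - y : ℝ) : ℂ) * z * (lam i - lam j) with hw
    have hwn : ‖w‖ ≤ 2 * |y' - y| * Real.exp x := by
      rw [hw, norm_mul, norm_mul, hz, Complex.norm_real, Real.norm_eq_abs]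
      calc |y' - y| * Real.exp x * ‖lam i - lam j‖ ≤ |y' - y| * Real.exp x * 2 := by gcongr
        _ = _ := by ring
    have e1 : Complex.exp (phase y' z i - phase y' z j) =
        Complex.exp (phase y z i - phase y z j) * Complex.exp w := by
      rw [← Complex.exp_add, hw]
      congr 1; unfold phase; push_cast; ring
    have e2 : ‖Complex.exp w - 1‖ ≤ ‖w‖ * Real.exp ‖w‖ := by
      simpa using Complex.norm_exp_sub_sum_le_norm_mul_exp w 1
    have hw2 : ‖w‖ ≤ 2 * Real.exp x := hwn.trans (by nlinarith [Real.exp_pos x])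
    beta_reduce
    rw [e1, ← mul_sub_one, norm_mul]
    calc _ ≤ Real.exp (2 * |y| * Real.exp x - 27 / 10 * Real.exp x ^ 5) *
          (2 * |y' - y| * Real.exp x * Real.exp (2 * Real.exp x)) := by
          gcongr
          exact e2.trans (by gcongr)
      _ = 2 * |y' - y| * Real.exp x *
          Real.exp (2 * |y| * Real.exp x + 2 * Real.exp x - 27 / 10 * Real.exp x ^ 5) := by
          rw [show 2 * |y| * Real.exp x + 2 * Real.exp x - 27 / 10 * Real.exp x ^ 5 =
            2 * |y| * Real.exp x - 27 / 10 * Real.exp x ^ 5 + 2 * Real.exp x by ring,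
            Real.exp_add]
          ring
      _ ≤ 2 * |y' - y| * Real.exp x * (decayConst |y| * Real.exp (-Real.exp x)) := by
          gcongr
          exact exp_quintic_le (abs_nonneg y) (Real.exp_pos x).le
      _ = _ := by simp only [expWeight, pow_one]; ring

open scoped Matrix.Norms.Operator

/-! ### Bounds of the solution -/

/-- The closed sector between the rays `n + 1` and `n + 2`, without its vertex. -/
def sector (n : ℤ) : Set ℂ :=
  {z | ∃ x φ : ℝ, φ ∈ Icc (rayAngle n) (rayAngle (n + 1)) ∧ z = Complex.exp (x + φ * I)}

theorem mem_sector {n : ℤ} {x φ : ℝ} (h : φ ∈ Icc (rayAngle n) (rayAngle (n + 1))) :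
    Complex.exp (x + φ * I) ∈ sector n := ⟨x, φ, h, rfl⟩

theorem exists_mem_sector {z : ℂ} (hz : z ≠ 0) : ∃ n, z ∈ sector n := by
  obtain ⟨n, x, φ, h, rfl⟩ := exists_polar hz
  exact ⟨n, mem_sector ⟨h.1, h.2.le⟩⟩

theorem ne_zero_of_mem_sector {n : ℤ} {z : ℂ} (h : z ∈ sector n) : z ≠ 0 := by
  obtain ⟨x, φ, -, rfl⟩ := h
  exact Complex.exp_ne_zero _

theorem mem_sector_or {n : ℤ} {φ : ℝ} (h : |φ - rayAngle n| ≤ tilt) (x : ℝ) :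
    Complex.exp (x + φ * I) ∈ sector n ∨ Complex.exp (x + φ * I) ∈ sector (n - 1) := by
  have ht := tilt_pos
  have h' := abs_le.mp h
  rcases le_total (rayAngle n) φ with h1 | h1
  · exact Or.inl (mem_sector ⟨h1, by rw [rayAngle_succ]; linarith⟩)
  · refine Or.inr (mem_sector ⟨?_, by rwa [sub_add_cancel]⟩)
    have := rayAngle_succ (n - 1)
    rw [sub_add_cancel] at this
    linarith

/-- Liouville's theorem in sectorial form: without jumps the functions are one entire function, and
`IsSectorial.norm_le` with `A = 0` applies to its difference from `c`. The origin lies in no sector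
and is reached by continuity. -/
theorem eq_of_tendsto_sector {E : Type*} [NormedAddCommGroup E] [NormedSpace ℂ E]
    [CompleteSpace E] {g : ℤ → ℂ → E} {c : E} (hd : ∀ n, Differentiable ℂ (g n))
    (hj : ∀ n z, g n z = g (n - 1) z)
    (ht : ∀ ε > 0, ∀ᶠ x : ℝ in atTop, ∀ n, ∀ φ ∈ Icc (rayAngle n) (rayAngle (n + 1)),
      ‖g n (Complex.exp (x + φ * I)) - c‖ ≤ ε) (n : ℤ) (z : ℂ) : g n z = c := by
  have hj' : ∀ n, g n = g 0 := fun n => by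
    induction n using Int.induction_on with
    | zero => rfl
    | succ k ih => rw [← ih]; funext z; rw [hj (k + 1), add_sub_cancel_right]
    | pred k ih => rw [← ih]; funext z; rw [hj (-k)]
  have hg : IsSectorial (fun n z => g n z - c) fun x => 0 * expWeight 1 x :=
    ⟨fun n => (hd n).sub_const c, fun n => by simp only [hj'], ht, fun n x φ _ => by
      simp only [hj', sub_self, norm_zero, zero_mul, le_refl]⟩
  have hz : ∀ z, z ≠ 0 → g n z = c := fun z hz => by
    obtain ⟨m, x, φ, h, rfl⟩ := exists_mem_sector hz
    have := hg.norm_le (x := x) h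
    rw [zero_mul, norm_le_zero_iff, sub_eq_zero] at this
    rw [hj' n, ← hj' m, this]
  have := Continuous.ext_on (dense_compl_singleton (0 : ℂ)) (hd n).continuous
    (continuous_const (y := c)) fun z h => hz z h
  exact congrFun this z

theorem map_mod_twelve {α : Type*} {g : ℤ → α} (hp : ∀ n, g (n + 12) = g n) (n : ℤ) :
    ∃ m : Fin 12, g n = g (m : ℕ) := by
  have h : Function.Periodic g 12 := hp
  have h1 := h.int_mul (n / 12) (n % 12)
  have h2 : n % 12 + n / 12 * 12 = n := by
    have := Int.emod_add_mul_ediv n 12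
    linarith
  have h3 := Int.emod_nonneg n (by norm_num : (12 : ℤ) ≠ 0)
  have h4 := Int.emod_lt_of_pos n (by norm_num : (0 : ℤ) < 12)
  refine ⟨⟨(n % 12).toNat, by omega⟩, ?_⟩
  rw [show (((⟨(n % 12).toNat, by omega⟩ : Fin 12) : ℕ) : ℤ) = n % 12 by simpa using h3, ← h1]
  congr 1
  simpa using h2.symm

theorem exists_bound_of_eventually {E : Type*} [NormedAddCommGroup E] {g : ℤ → ℂ → E} {C : ℝ}
    (hc : ∀ n, Continuous (g n)) (hp : ∀ n, g (n + 12) = g n)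
    (h : ∀ᶠ x : ℝ in atTop, ∀ n, ∀ φ ∈ Icc (rayAngle n) (rayAngle (n + 1)),
      ‖g n (Complex.exp (x + φ * I))‖ ≤ C) : ∃ B, ∀ n, ∀ z ∈ sector n, ‖g n z‖ ≤ B := by
  obtain ⟨X, hX⟩ := eventually_atTop.mp h
  choose b hb using fun n : ℤ =>
    (isCompact_closedBall (0 : ℂ) (Real.exp X)).exists_bound_of_continuousOn (hc n).continuousOn
  refine ⟨|C| + ∑ m : Fin 12, |b (m : ℕ)|, fun n z hz => ?_⟩
  have hs : 0 ≤ ∑ m : Fin 12, |b (m : ℕ)| := Finset.sum_nonneg fun _ _ => abs_nonneg _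
  obtain ⟨x, φ, hφ, rfl⟩ := hz
  rcases le_total X x with hx | hx
  · have := hX x hx n φ hφ
    linarith [le_abs_self C]
  · obtain ⟨m, hm⟩ := map_mod_twelve hp n
    rw [hm]
    have h1 := hb (m : ℕ) (Complex.exp (x + φ * I)) (by
      rw [mem_closedBall_zero_iff, norm_exp_add_mul_I]
      exact Real.exp_le_exp.mpr hx)
    have h2 := Finset.single_le_sum (f := fun m : Fin 12 => |b (m : ℕ)|)
      (fun _ _ => abs_nonneg _) (Finset.mem_univ m)
    beta_reduce at h2
    linarith [le_abs_self (b (m : ℕ)), abs_nonneg C]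

theorem differentiable_adjugate {f : ℂ → Mat} (h : Differentiable ℂ f) :
    Differentiable ℂ fun z => (f z).adjugate := by
  have h' := differentiable_apply h
  refine differentiable_of_apply fun i j => ?_
  simp only [Matrix.adjugate_fin_three]
  fin_cases i <;> fin_cases j <;> simp <;> fun_prop

theorem norm_adjugate_le (A : Mat) : ‖A.adjugate‖ ≤ 6 * ‖A‖ ^ 2 := by
  have h2 : ∀ i j k l, ‖A i j * A k l‖ ≤ ‖A‖ ^ 2 := fun i j k l => by
    rw [norm_mul, sq]
    exact mul_le_mul (norm_apply_le A i j) (norm_apply_le A k l) (norm_nonneg _) (norm_nonneg _)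
  have h3 : ∀ i j k l i' j' k' l', ‖A i j * A k l - A i' j' * A k' l'‖ ≤ 2 * ‖A‖ ^ 2 :=
    fun i j k l i' j' k' l' => (norm_sub_le _ _).trans (by linarith [h2 i j k l, h2 i' j' k' l'])
  have h4 : ∀ i j k l i' j' k' l', ‖-(A i j * A k l) + A i' j' * A k' l'‖ ≤ 2 * ‖A‖ ^ 2 :=
    fun i j k l i' j' k' l' => (norm_add_le _ _).trans (by
      rw [norm_neg]; linarith [h2 i j k l, h2 i' j' k' l'])
  refine (norm_le_of_apply_le (C := 2 * ‖A‖ ^ 2) fun i j => ?_).trans (by linarith)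
  rw [Matrix.adjugate_fin_three]
  fin_cases i <;> fin_cases j <;> first | exact h3 _ _ _ _ _ _ _ _ | exact h4 _ _ _ _ _ _ _ _

/-- A common bound of a solution and its inverse in the sectors. -/
def SectorBound (M : ℤ → ℂ → Mat) (B : ℝ) : Prop :=
  ∀ n, ∀ z ∈ sector n, ‖M n z‖ ≤ B ∧ ‖(M n z).adjugate‖ ≤ B

section Fixed

variable {r₁ r₂ : ℂ} {y : ℝ} {M : ℤ → ℂ → Mat}

theorem det_jump (n : Fin 12) (z : ℂ) : (jump r₁ r₂ n y z).det = 1 := by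
  rw [jump_eq, Matrix.det_mul, Matrix.det_mul, det_jumpConst, mul_one, ← Matrix.det_mul,
    expDiag_mul_neg, Matrix.det_one]

theorem differentiable_det {f : ℂ → Mat} (h : Differentiable ℂ f) :
    Differentiable ℂ fun z => (f z).det := by
  have h' := differentiable_apply h
  simp only [Matrix.det_fin_three]
  fun_prop

theorem IsEntireSolution.eventually_of_nhds_one (hM : IsEntireSolution r₁ r₂ y M) {p : Mat → Prop}
    (hp : ∀ᶠ A in 𝓝 1, p A) : ∀ᶠ x : ℝ in atTop, ∀ n, ∀ φ ∈ Icc (rayAngle n) (rayAngle (n + 1)),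
      p (M n (Complex.exp (x + φ * I))) := by
  obtain ⟨ε, hε, h⟩ := Metric.eventually_nhds_iff.mp hp
  filter_upwards [hM.tendsto_one (ε / 2) (by positivity)] with x hx n φ hφ
  refine h ?_
  rw [dist_eq_norm]
  linarith [hx n φ hφ]

/-- The jumps have determinant one, so the determinant is a single entire function with limit `1`.
From here on the adjugate serves as the inverse; being polynomial in the entries it is visibly
entire. -/
theorem IsEntireSolution.det_eq_one (hM : IsEntireSolution r₁ r₂ y M) (n : ℤ) (z : ℂ) :
    (M n z).det = 1 := by
  refine eq_of_tendsto_sector (g := fun n z => (M n z).det)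
    (fun n => differentiable_det (hM.differentiable n)) (fun n z => ?_) (fun ε hε => ?_) n z
  · rw [hM.jump, Matrix.det_mul, det_jump, mul_one]
  · refine hM.eventually_of_nhds_one (p := fun A => ‖A.det - 1‖ ≤ ε) ?_
    have hc : Continuous fun A : Mat => ‖A.det - 1‖ := by fun_prop
    have := hc.tendsto 1
    simp only [Matrix.det_one, sub_self, norm_zero] at this
    exact this.eventually_le_const hε

theorem IsEntireSolution.mul_adjugate (hM : IsEntireSolution r₁ r₂ y M) (n : ℤ) (z : ℂ) :
    M n z * (M n z).adjugate = 1 := by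
  rw [Matrix.mul_adjugate, hM.det_eq_one, one_smul]

theorem IsEntireSolution.adjugate_mul (hM : IsEntireSolution r₁ r₂ y M) (n : ℤ) (z : ℂ) :
    (M n z).adjugate * M n z = 1 := by
  rw [Matrix.adjugate_mul, hM.det_eq_one, one_smul]

theorem IsEntireSolution.exists_sectorBound (hM : IsEntireSolution r₁ r₂ y M) :
    ∃ B, 1 ≤ B ∧ SectorBound M B := by
  obtain ⟨B, hB⟩ := exists_bound_of_eventually (g := M) (C := 2)
    (fun n => (hM.differentiable n).continuous) hM.periodic (by
      filter_upwards [hM.tendsto_one 1 one_pos] with x hx n φ hφ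
      have h1 := norm_le_norm_add_norm_sub' (M n (Complex.exp (x + φ * I))) 1
      have h2 := hx n φ hφ
      rw [norm_one] at h1
      linarith)
  have hB0 : 0 ≤ B := (norm_nonneg _).trans (hB 0 _ (mem_sector (x := 0) (φ := rayAngle 0)
    ⟨le_rfl, (rayAngle_strictMono (by norm_num)).le⟩))
  refine ⟨1 + B + 6 * B ^ 2, by nlinarith, fun n z hz => ?_⟩
  have h := hB n z hz
  refine ⟨by nlinarith, (norm_adjugate_le _).trans ?_⟩
  have : ‖M n z‖ ^ 2 ≤ B ^ 2 := by gcongr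
  nlinarith

theorem SectorBound.nonneg {B : ℝ} (h : SectorBound M B) : 0 ≤ B :=
  (norm_nonneg _).trans (h 0 _ (mem_sector (x := 0) (φ := rayAngle 0)
    ⟨le_rfl, (rayAngle_strictMono (by norm_num)).le⟩)).1

/-- `m` is the coefficient of `1 / z` in the expansion of `M` at infinity. -/
def HasMoment (M : ℤ → ℂ → Mat) (m : Mat) (K : ℝ) : Prop :=
  ∀ n, ∀ z ∈ sector n, ‖M n z - 1 - z⁻¹ • m‖ ≤ K * ‖z‖⁻¹ ^ 2

/-- A point near the ray may lie on either side, and `B` controls `M k` only in sector `k`. Since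
`s² = 0`, the products `Mₙ s` and `Mₙ₋₁ s` agree, so the jump can be written with whichever of the
two is controlled. -/
theorem IsEntireSolution.norm_jump_le (h₁ : ‖r₁‖ ≤ 1) (h₂ : ‖r₂‖ ≤ 1)
    (hM : IsEntireSolution r₁ r₂ y M) {B : ℝ} (hB : SectorBound M B) {n : ℤ} {x φ : ℝ}
    (h : |φ - rayAngle n| ≤ tilt) :
    ‖M n (Complex.exp (x + φ * I)) - M (n - 1) (Complex.exp (x + φ * I))‖ ≤
      3 * decayConst |y| * B * expWeight 0 x := by
  obtain ⟨s, e, hs, hs3, hJ, he, -⟩ := exists_jump_factor h₁ h₂ n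
  have hsec := mem_sector_or h x
  have h1 := he y x φ h
  set z := Complex.exp (x + φ * I)
  have hj := hM.jump n z
  rw [hJ] at hj
  have hB0 := hB.nonneg
  have key : ∀ k, z ∈ sector k → ‖e y z • (M k z * s)‖ ≤
      3 * decayConst |y| * B * expWeight 0 x := fun k hk => by
    rw [norm_smul]
    have h3 := norm_mul_le_of_le (hB k z hk).1 hs3
    calc _ ≤ (decayConst |y| * expWeight 0 x) * (B * 3) :=
          mul_le_mul h1 h3 (norm_nonneg _) ((norm_nonneg _).trans h1)
      _ = _ := by ring
  have e1 : M n z - M (n - 1) z = e y z • (M (n - 1) z * s) := by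
    rw [hj, mul_add, mul_one, add_sub_cancel_left, mul_smul_comm]
  rcases hsec with h | h
  · have e2 : M (n - 1) z * s = M n z * s := by
      rw [hj, mul_assoc, add_mul, one_mul, smul_mul_assoc, hs, smul_zero, add_zero]
    rw [e1, e2]
    exact key n h
  · rw [e1]
    exact key _ h

theorem IsEntireSolution.isSectorial (h₁ : ‖r₁‖ ≤ 1) (h₂ : ‖r₂‖ ≤ 1)
    (hM : IsEntireSolution r₁ r₂ y M) {B : ℝ} (hB : SectorBound M B) :
    IsSectorial (fun n z => M n z - 1) fun x => 3 * decayConst |y| * B * expWeight 0 x :=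
  ⟨fun n => (hM.differentiable n).sub_const 1, fun n => by simp only [hM.periodic],
    hM.tendsto_one, fun n x φ h => by
      simpa using hM.norm_jump_le h₁ h₂ hB h⟩

theorem IsEntireSolution.exists_hasMoment (h₁ : ‖r₁‖ ≤ 1) (h₂ : ‖r₂‖ ≤ 1)
    (hM : IsEntireSolution r₁ r₂ y M) {B : ℝ} (hB : SectorBound M B) :
    ∃ m, HasMoment M m (3 * decayConst |y| * B * momentConst) := by
  obtain ⟨m, hm⟩ := (hM.isSectorial h₁ h₂ hB).exists_moment
  refine ⟨m, fun n z hz => ?_⟩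
  obtain ⟨x, φ, hφ, rfl⟩ := hz
  refine (hm n x φ hφ).trans_eq ?_
  rw [norm_exp_add_mul_I, ← Real.exp_neg, ← Real.exp_nat_mul]
  congr 2
  push_cast; ring

theorem HasMoment.mono {m : Mat} {K K' : ℝ} (h : HasMoment M m K) (hK : K ≤ K') :
    HasMoment M m K' := fun n z hz => (h n z hz).trans (by gcongr)

theorem HasMoment.eq {m m' : Mat} {K K' : ℝ} (h : HasMoment M m K) (h' : HasMoment M m' K') :
    m = m' := by
  have e : ∀ x φ : ℝ, ‖Complex.exp (x + φ * I)‖⁻¹ ^ 2 = Real.exp (-2 * x) := fun x φ => by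
    rw [norm_exp_add_mul_I, ← Real.exp_neg, ← Real.exp_nat_mul]
    congr 1
    push_cast; ring
  have hr : rayAngle 0 ∈ Icc (rayAngle 0) (rayAngle (0 + 1)) :=
    ⟨le_rfl, (rayAngle_strictMono (by norm_num)).le⟩
  have hK : 0 ≤ max K K' := by
    have := (norm_nonneg _).trans (h 0 _ (mem_sector (x := 0) hr))
    rw [e] at this
    simp only [mul_zero, Real.exp_zero, mul_one] at this
    exact this.trans (le_max_left _ _)
  refine eq_of_norm_sub_inv_smul_le (C := max K K') (φ := rayAngle 0) (u := fun z => M 0 z - 1)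
    (v := fun z => M 0 z - 1) (fun x => ?_) (fun x => ?_) fun x => ?_
  · rw [← e x (rayAngle 0)]
    exact h.mono (le_max_left _ _) 0 _ (mem_sector hr)
  · rw [← e x (rayAngle 0)]
    exact h'.mono (le_max_right _ _) 0 _ (mem_sector hr)
  · rw [sub_self, norm_zero]; positivity

end Fixed

open scoped Matrix.Norms.Operator

/-! ### Uniform bounds near a point -/

section Ratio

variable {r₁ r₂ : ℂ} {y y' : ℝ} {M M' : ℤ → ℂ → Mat}

theorem ratio_mul (hM : IsEntireSolution r₁ r₂ y M) (n : ℤ) (z : ℂ) :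
    M' n z * (M n z).adjugate * M n z = M' n z := by
  rw [mul_assoc, hM.adjugate_mul, mul_one]

/-- For the quotient `M' M⁻¹` of solutions at two parameters, `(1 + e's)(1 - es) = 1 + (e' - e)s`,
so its jump contains only the difference of the scalar factors. The matrix `M' s M⁻¹` that
multiplies it has no jump itself and may be evaluated on either side. -/
theorem ratio_sub (hM : IsEntireSolution r₁ r₂ y M) {n : ℤ} {z : ℂ} {s : Mat} {e e' : ℂ}
    (hs : s * s = 0) (hj : M n z = M (n - 1) z * (1 + e • s))
    (hj' : M' n z = M' (n - 1) z * (1 + e' • s)) :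
    M' n z * (M n z).adjugate - M' (n - 1) z * (M (n - 1) z).adjugate =
      (e' - e) • (M' (n - 1) z * s * (M (n - 1) z).adjugate) ∧
    M' n z * s * (M n z).adjugate = M' (n - 1) z * s * (M (n - 1) z).adjugate := by
  have hinv : M (n - 1) z = M n z * (1 - e • s) := by
    rw [hj, mul_assoc]
    have : (1 + e • s) * (1 - e • s) = 1 := by
      rw [mul_sub, add_mul _ _ (e • s), smul_mul_smul_comm, hs, smul_zero]
      simp
    rw [this, mul_one]
  have hadj : (M n z).adjugate = (1 - e • s) * (M (n - 1) z).adjugate := by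
    calc (M n z).adjugate = (M n z).adjugate * (M (n - 1) z * (M (n - 1) z).adjugate) := by
          rw [hM.mul_adjugate, mul_one]
      _ = ((M n z).adjugate * M n z) * (1 - e • s) * (M (n - 1) z).adjugate := by
          conv_lhs => enter [2, 1]; rw [hinv]
          simp only [mul_assoc]
      _ = _ := by rw [hM.adjugate_mul, one_mul]
  have e1 : (1 + e' • s) * (1 - e • s) = 1 + (e' - e) • s := by
    rw [mul_sub, add_mul _ _ (e • s), smul_mul_smul_comm, hs, smul_zero, sub_smul, one_mul, mul_one]
    abel
  have e2 : (1 + e' • s) * s * (1 - e • s) = s := by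
    rw [add_mul, smul_mul_assoc, hs, smul_zero, add_zero, one_mul, mul_sub, mul_smul_comm, hs,
      smul_zero, sub_zero, mul_one]
  constructor
  · rw [hadj, hj']
    calc _ = M' (n - 1) z * ((1 + e' • s) * (1 - e • s)) * (M (n - 1) z).adjugate -
          M' (n - 1) z * (M (n - 1) z).adjugate := by simp only [mul_assoc]
      _ = _ := by
        rw [e1, mul_add, mul_one, add_mul, add_sub_cancel_left, mul_smul_comm, smul_mul_assoc]
  · rw [hadj, hj']
    calc _ = M' (n - 1) z * ((1 + e' • s) * s * (1 - e • s)) * (M (n - 1) z).adjugate := by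
          simp only [mul_assoc]
      _ = _ := by rw [e2]

/-- Writing `M' s M⁻¹ = (M' M⁻¹) M s M⁻¹` bounds the jump of the quotient by `S |y' - y|` times data
of `M` alone. No quantitative bound of `M'` is needed besides `S`. -/
theorem ratio_isSectorial (h₁ : ‖r₁‖ ≤ 1) (h₂ : ‖r₂‖ ≤ 1) (hM : IsEntireSolution r₁ r₂ y M)
    (hM' : IsEntireSolution r₁ r₂ y' M') {B S : ℝ} (hB : SectorBound M B)
    (hS : ∀ n, ∀ z ∈ sector n, ‖M' n z * (M n z).adjugate‖ ≤ S) (hy : |y' - y| ≤ 1) :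
    IsSectorial (fun n z => M' n z * (M n z).adjugate - 1)
      fun x => 6 * decayConst |y| * B ^ 2 * |y' - y| * S * expWeight 1 x := by
  refine ⟨fun n => ((hM'.differentiable n).mul
    (differentiable_adjugate (hM.differentiable n))).sub_const 1, fun n => by
      simp only [hM.periodic, hM'.periodic], fun ε hε => ?_, fun n x φ h => ?_⟩
  · have hc : Continuous fun p : Mat × Mat => p.1 * p.2.adjugate - 1 :=
      (continuous_fst.mul continuous_snd.matrix_adjugate).sub continuous_const
    have h1 := hc.norm.tendsto (1, 1)
    simp only [Matrix.adjugate_one, mul_one, sub_self, norm_zero] at h1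
    obtain ⟨δ, hδ, h2⟩ := Metric.eventually_nhds_iff.mp (h1.eventually_le_const hε)
    filter_upwards [hM.tendsto_one (δ / 2) (by positivity),
      hM'.tendsto_one (δ / 2) (by positivity)] with x hx hx' n φ hφ
    refine h2 (y := (M' n _, M n _)) ?_
    rw [dist_eq_norm, Prod.norm_def]
    have := hx n φ hφ
    have := hx' n φ hφ
    exact max_lt (by change ‖M' n _ - 1‖ < δ; linarith) (by change ‖M n _ - 1‖ < δ; linarith)
  · obtain ⟨s, e, hs, hs3, hJ, -, he⟩ := exists_jump_factor h₁ h₂ n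
    have hsec := mem_sector_or h x
    have h1 := he y y' x φ h hy
    set z := Complex.exp (x + φ * I)
    have hj := hM.jump n z
    have hj' := hM'.jump n z
    rw [hJ] at hj hj'
    obtain ⟨e1, e2⟩ := ratio_sub hM hs hj hj'
    rw [sub_sub_sub_cancel_right, e1]
    have hB0 := hB.nonneg
    have key : ∀ k, z ∈ sector k → ‖(e y' z - e y z) • (M' k z * s * (M k z).adjugate)‖ ≤
        6 * decayConst |y| * B ^ 2 * |y' - y| * S * expWeight 1 x := fun k hk => by
      rw [norm_smul, ← ratio_mul hM (M' := M')]
      have h3 := norm_mul_le_of_le (norm_mul_le_of_le (norm_mul_le_of_le (hS k z hk) (hB k z hk).1)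
        hs3) (hB k z hk).2
      calc _ ≤ (2 * decayConst |y| * |y' - y| * expWeight 1 x) * (S * B * 3 * B) :=
            mul_le_mul h1 h3 (norm_nonneg _) ((norm_nonneg _).trans h1)
        _ = _ := by ring
    rcases hsec with h | h
    · rw [← e2]; exact key n h
    · exact key _ h

/-- Bootstrap: the supremum `S` of the quotient is finite, since both solutions are bounded, and the
Cauchy estimate gives `S ≤ 1 + S/2`. The a priori bound of the second solution disappears from the
result. -/
theorem ratio_le_two (h₁ : ‖r₁‖ ≤ 1) (h₂ : ‖r₂‖ ≤ 1) (hM : IsEntireSolution r₁ r₂ y M)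
    (hM' : IsEntireSolution r₁ r₂ y' M') {B : ℝ} (hB : SectorBound M B) (hy : |y' - y| ≤ 1)
    (hsmall : 6 * decayConst |y| * B ^ 2 * |y' - y| *
      (12 * (sepConst⁻¹ * ∫ t, expWeight 1 t)) ≤ 1 / 2) :
    ∀ n, ∀ z ∈ sector n, ‖M' n z * (M n z).adjugate‖ ≤ 2 := by
  obtain ⟨B', -, hB'⟩ := hM'.exists_sectorBound
  set T : Set ℝ := {t | ∃ n, ∃ z ∈ sector n, t = ‖M' n z * (M n z).adjugate‖} with hT
  have hne : T.Nonempty := ⟨_, 0, _, mem_sector (x := 0) (φ := rayAngle 0)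
    ⟨le_rfl, (rayAngle_strictMono (by norm_num)).le⟩, rfl⟩
  have hbdd : BddAbove T := ⟨B' * B, by
    rintro _ ⟨n, z, hz, rfl⟩
    exact norm_mul_le_of_le (hB' n z hz).1 (hB n z hz).2⟩
  have hsec := ratio_isSectorial h₁ h₂ hM hM' hB (S := sSup T)
    (fun n z hz => le_csSup hbdd ⟨n, z, hz, rfl⟩) hy
  have hS0 : 0 ≤ sSup T := Real.sSup_nonneg (by rintro _ ⟨n, z, hz, rfl⟩; exact norm_nonneg _)
  have hle : sSup T ≤ 1 + sSup T / 2 := csSup_le hne (by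
    rintro _ ⟨n, _, ⟨x, φ, hφ, rfl⟩, rfl⟩
    have h1 := hsec.norm_le (x := x) hφ
    have h2 := norm_le_norm_add_norm_sub' (M' n (Complex.exp (x + φ * I)) *
      (M n (Complex.exp (x + φ * I))).adjugate) 1
    rw [norm_one] at h2
    nlinarith)
  intro n z hz
  have := le_csSup hbdd (show ‖M' n z * (M n z).adjugate‖ ∈ T from ⟨n, z, hz, rfl⟩)
  linarith

end Ratio

section Family

variable {r₁ r₂ : ℂ} {Y : Set ℝ} {N : ℝ → ℤ → ℂ → Mat}

theorem exists_uniform_sectorBound (h₁ : ‖r₁‖ ≤ 1) (h₂ : ‖r₂‖ ≤ 1)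
    (hN : ∀ y ∈ Y, IsEntireSolution r₁ r₂ y (N y)) {y₀ : ℝ} (hy₀ : y₀ ∈ Y) :
    ∃ B δ : ℝ, 0 < δ ∧ 1 ≤ B ∧ ∀ y ∈ Y, |y - y₀| < δ → SectorBound (N y) B := by
  obtain ⟨B, hB1, hB⟩ := (hN y₀ hy₀).exists_sectorBound
  set c := 6 * decayConst |y₀| * B ^ 2 * (12 * (sepConst⁻¹ * ∫ t, expWeight 1 t)) with hc
  have hc0 : 0 ≤ c := by
    have := decayConst_pos |y₀|
    have h1 : 0 ≤ ∫ t, expWeight 1 t := integral_nonneg fun t => expWeight_nonneg 1 t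
    have := sepConst_pos
    positivity
  -- The solution is bounded by `2B`, hence its adjugate by `6 (2B)² = 24 B²`. The choice of `δ`
  -- makes the Cauchy constant times `|y - y₀|` at most `1/2`.
  refine ⟨24 * B ^ 2, min 1 (1 / (2 * (c + 1))), by positivity, by nlinarith, fun y hy hd => ?_⟩
  have hd1 : |y - y₀| ≤ 1 := (hd.trans_le (min_le_left _ _)).le
  have hd2 : |y - y₀| * (2 * (c + 1)) ≤ 1 := by
    have := (hd.trans_le (min_le_right _ _)).le
    rwa [le_div_iff₀ (by positivity)] at this
  have hr := ratio_le_two h₁ h₂ (hN y₀ hy₀) (hN y hy) hB hd1 (by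
    have : c * |y - y₀| ≤ 1 / 2 := by nlinarith [abs_nonneg (y - y₀)]
    rw [hc] at this
    linarith)
  intro n z hz
  have h3 : ‖N y n z‖ ≤ 2 * B := by
    rw [← ratio_mul (hN y₀ hy₀) (M' := N y)]
    exact norm_mul_le_of_le (hr n z hz) (hB n z hz).1
  refine ⟨by nlinarith, (norm_adjugate_le _).trans ?_⟩
  have : ‖N y n z‖ ^ 2 ≤ (2 * B) ^ 2 := by gcongr
  nlinarith

theorem exists_uniform_hasMoment (h₁ : ‖r₁‖ ≤ 1) (h₂ : ‖r₂‖ ≤ 1)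
    (hN : ∀ y ∈ Y, IsEntireSolution r₁ r₂ y (N y)) {m : ℝ → Mat}
    (hm : ∀ y ∈ Y, ∃ K, HasMoment (N y) (m y) K) {y₀ : ℝ} (hy₀ : y₀ ∈ Y) :
    ∃ K δ : ℝ, 0 < δ ∧ 1 ≤ K ∧ ∀ y ∈ Y, |y - y₀| < δ →
      SectorBound (N y) K ∧ HasMoment (N y) (m y) K := by
  obtain ⟨B, δ, hδ, hB1, hB⟩ := exists_uniform_sectorBound h₁ h₂ hN hy₀
  set K := 3 * decayConst (|y₀| + 1) * B * momentConst
  refine ⟨max B K, min δ 1, by positivity, hB1.trans (le_max_left _ _), fun y hy hd => ?_⟩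
  have hBy := hB y hy (hd.trans_le (min_le_left _ _))
  refine ⟨fun n z hz => ⟨(hBy n z hz).1.trans (le_max_left _ _),
    (hBy n z hz).2.trans (le_max_left _ _)⟩, ?_⟩
  obtain ⟨m', hm'⟩ := (hN y hy).exists_hasMoment h₁ h₂ hBy
  obtain ⟨K', hK'⟩ := hm y hy
  rw [hK'.eq hm']
  refine hm'.mono (le_trans ?_ (le_max_right _ _))
  have h3 : |y| ≤ |y₀| + 1 := by
    have h4 := abs_sub_abs_le_abs_sub y y₀
    have h5 := hd.trans_le (min_le_right _ _)
    linarith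
  have := decayConst_mono (abs_nonneg y) h3
  have := momentConst_pos
  exact mul_le_mul_of_nonneg_right (by gcongr) this.le

end Family

open scoped Matrix.Norms.Operator

/-! ### Dependence on the parameter -/

/-- The matrix `e ^ {w Λ}`. -/
noncomputable def evol (w : ℂ) : Mat := expDiag fun i => w * lam i

theorem norm_diagonal_le {f : Fin 3 → ℂ} {C : ℝ} (h : ∀ i, ‖f i‖ ≤ C) :
    ‖(Matrix.diagonal f : Mat)‖ ≤ C := by
  have hC : 0 ≤ C := (norm_nonneg _).trans (h 0)
  rw [Matrix.linfty_opNorm_diagonal]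
  exact (pi_norm_le_iff_of_nonneg hC).mpr h

theorem evol_zero : evol 0 = 1 := by
  unfold evol
  simp only [zero_mul]
  exact expDiag_zero

theorem norm_evol_le (w : ℂ) : ‖evol w‖ ≤ Real.exp ‖w‖ :=
  norm_diagonal_le fun i => (Complex.norm_exp_le_exp_norm _).trans_eq (by
    rw [norm_mul, norm_lam, mul_one])

theorem norm_evol_sub_one_le (w : ℂ) : ‖evol w - 1‖ ≤ ‖w‖ * Real.exp ‖w‖ := by
  have e : evol w - 1 = Matrix.diagonal fun i => Complex.exp (w * lam i) - 1 := by
    rw [← Matrix.diagonal_one, evol, expDiag, Matrix.diagonal_sub]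
  rw [e]
  refine norm_diagonal_le fun i => ?_
  have := Complex.norm_exp_sub_sum_le_norm_mul_exp (w * lam i) 1
  simpa [norm_mul, norm_lam] using this

theorem norm_evol_sub_le (w : ℂ) : ‖evol w - 1 - w • Lam‖ ≤ ‖w‖ ^ 2 * Real.exp ‖w‖ := by
  have e : evol w - 1 - w • Lam =
      Matrix.diagonal fun i => Complex.exp (w * lam i) - 1 - w * lam i := by
    rw [← Matrix.diagonal_one, evol, expDiag, Lam, ← Matrix.diagonal_smul, Matrix.diagonal_sub,
      Matrix.diagonal_sub]
    rfl
  rw [e]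
  refine norm_diagonal_le fun i => ?_
  have := Complex.norm_exp_sub_sum_le_norm_mul_exp (w * lam i) 2
  simpa [norm_mul, norm_lam, Finset.sum_range_succ, sub_sub] using this

theorem differentiable_evol (d : ℂ) : Differentiable ℂ fun z => evol (d * z) :=
  differentiable_expDiag fun i => by fun_prop

theorem norm_Lam_le : ‖Lam‖ ≤ 1 := norm_diagonal_le fun i => (norm_lam i).le

theorem exp_one_le_three : Real.exp 1 ≤ 3 := Real.exp_one_lt_three.le

section Expansion

variable {F : ℂ → Mat} {m m' : Mat} {K : ℝ} {d : ℂ}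

/-- The remainder of first order of the transfer matrix. -/
noncomputable def remainder (F : ℂ → Mat) (m m' : Mat) (d z : ℂ) : Mat :=
  z • (F z - evol (d * z)) - (m' * evol (d * z) - evol (d * z) * m)

/-- On the circle `|z| = 1/|d|` both `1/z` and `d` are small while `e^{dzΛ}` is bounded. The
remainder is defined so that the first-order terms of the two expansions cancel; what is left is
`O(|d|²)`, multiplied by `|z|`. -/
theorem norm_remainder_le (hK : 1 ≤ K) (hd1 : ‖d‖ ≤ 1) (hm : ‖m‖ ≤ 3 * K)
    (hm' : ‖m'‖ ≤ 3 * K) {z : ℂ} (hz : ‖z‖ * ‖d‖ = 1) {a b : Mat}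
    (hF : F z = (1 + z⁻¹ • m' + a) * evol (d * z) * (1 - z⁻¹ • m + b))
    (ha : ‖a‖ ≤ K * ‖d‖ ^ 2) (hb : ‖b‖ ≤ 13 * K ^ 3 * ‖d‖ ^ 2) :
    ‖remainder F m m' d z‖ ≤ 234 * K ^ 4 * ‖d‖ := by
  have hz0 : z ≠ 0 := by rintro rfl; simp at hz
  have hzi : ‖z⁻¹‖ = ‖d‖ := by rw [norm_inv]; exact inv_eq_of_mul_eq_one_right hz
  have hE : ‖evol (d * z)‖ ≤ 3 := by
    refine (norm_evol_le _).trans ?_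
    rw [norm_mul, mul_comm, hz]; exact exp_one_le_three
  rw [remainder, hF]
  set E := evol (d * z)
  set t := ‖d‖ with ht
  have ht0 : 0 ≤ t := norm_nonneg _
  have hp : ‖z⁻¹ • m'‖ ≤ 3 * K * t := by
    rw [norm_smul, hzi, mul_comm]; gcongr
  have hq : ‖z⁻¹ • m‖ ≤ 3 * K * t := by
    rw [norm_smul, hzi, mul_comm]; gcongr
  have e : z • ((1 + z⁻¹ • m' + a) * E * (1 - z⁻¹ • m + b) - E) - (m' * E - E * m) =
      z • (a * E + E * b - (z⁻¹ • m') * E * (z⁻¹ • m) + (z⁻¹ • m') * E * b - a * E * (z⁻¹ • m) +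
        a * E * b) := by
    have h1 : m' * E - E * m = z • ((z⁻¹ • m') * E - E * (z⁻¹ • m)) := by
      rw [smul_mul_assoc, mul_smul_comm, ← smul_sub, smul_inv_smul₀ hz0]
    rw [h1, ← smul_sub]
    congr 1
    generalize z⁻¹ • m' = p, z⁻¹ • m = q
    noncomm_ring
  rw [e, norm_smul]
  have b1 := norm_mul_le_of_le ha hE
  have b2 := norm_mul_le_of_le hE hb
  have b3 := norm_mul_le_of_le (norm_mul_le_of_le hp hE) hq
  have b4 := norm_mul_le_of_le (norm_mul_le_of_le hp hE) hb
  have b5 := norm_mul_le_of_le (norm_mul_le_of_le ha hE) hq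
  have b6 := norm_mul_le_of_le (norm_mul_le_of_le ha hE) hb
  -- The six products contribute `3 + 39 + 27 + 117 + 9 + 39 = 234`.
  have hu : ‖a * E + E * b - (z⁻¹ • m') * E * (z⁻¹ • m) + (z⁻¹ • m') * E * b - a * E * (z⁻¹ • m) +
        a * E * b‖ ≤ 234 * (K ^ 4 * t ^ 2) := by
    refine (norm_add_le_of_le (norm_sub_le_of_le (norm_add_le_of_le (norm_sub_le_of_le
      (norm_add_le_of_le b1 b2) b3) b4) b5) b6).trans ?_
    have k1 : K ≤ K ^ 4 := le_self_pow₀ hK (by norm_num)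
    have k2 : K ^ 2 ≤ K ^ 4 := pow_le_pow_right₀ hK (by norm_num)
    have k3 : K ^ 3 ≤ K ^ 4 := pow_le_pow_right₀ hK (by norm_num)
    have t3 : t ^ 3 ≤ t ^ 2 := pow_le_pow_of_le_one ht0 hd1 (by norm_num)
    have t4 : t ^ 4 ≤ t ^ 2 := pow_le_pow_of_le_one ht0 hd1 (by norm_num)
    have u1 : K * t ^ 2 ≤ K ^ 4 * t ^ 2 := by gcongr
    have u2 : K ^ 3 * t ^ 2 ≤ K ^ 4 * t ^ 2 := by gcongr
    have u3 : K ^ 2 * t ^ 2 ≤ K ^ 4 * t ^ 2 := by gcongr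
    have u4 : K ^ 4 * t ^ 3 ≤ K ^ 4 * t ^ 2 := by gcongr
    have u5 : K ^ 2 * t ^ 3 ≤ K ^ 4 * t ^ 2 := by gcongr
    have u6 : K ^ 4 * t ^ 4 ≤ K ^ 4 * t ^ 2 := by gcongr
    linarith
  calc ‖z‖ * _ ≤ ‖z‖ * (234 * (K ^ 4 * t ^ 2)) := by gcongr
    _ = 234 * K ^ 4 * t * (‖z‖ * t) := by ring
    _ = _ := by rw [hz, mul_one]

/-- The core of the dependence on the parameter. The remainder is entire, so the maximum principle
extends its bound `O(|d|)` from the circle of radius `1/|d|` to the disc. Schwarz's lemma on this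
large disc gains another factor `|d|` for the difference from the value at `0`, namely `O(|d|²
|z|)`; division by `z` leaves an error quadratic in `d`. -/
theorem norm_transfer_sub_le (hF : Differentiable ℂ F) (hK : 1 ≤ K) (hd0 : d ≠ 0) (hd1 : ‖d‖ ≤ 1)
    (hm : ‖m‖ ≤ 3 * K) (hm' : ‖m'‖ ≤ 3 * K)
    (hFz : ∀ z, ‖z‖ * ‖d‖ = 1 → ∃ a b : Mat,
      F z = (1 + z⁻¹ • m' + a) * evol (d * z) * (1 - z⁻¹ • m + b) ∧
      ‖a‖ ≤ K * ‖d‖ ^ 2 ∧ ‖b‖ ≤ 13 * K ^ 3 * ‖d‖ ^ 2) {z : ℂ} (hz0 : z ≠ 0)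
    (hz : ‖z‖ * ‖d‖ < 1) :
    ‖F z - 1 - d • (z • Lam + (m * Lam - Lam * m))‖ ≤
      ‖d‖ ^ 2 * (3 * ‖z‖ ^ 2 + 1170 * K ^ 4 + 18 * K * ‖z‖) := by
  have ht : 0 < ‖d‖ := norm_pos_iff.mpr hd0
  set t := ‖d‖ with ht'
  set C := 234 * K ^ 4 * t with hC
  have hE := differentiable_evol d
  have hGd : Differentiable ℂ (remainder F m m' d) := by
    unfold remainder
    exact (differentiable_id.smul (hF.sub hE)).sub ((hE.const_mul _).sub (hE.mul_const _))
  have hG : ∀ z, ‖z‖ ≤ t⁻¹ → ‖remainder F m m' d z‖ ≤ C := fun z hz => by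
    have hfr : ∀ w ∈ frontier (Metric.ball (0 : ℂ) t⁻¹), ‖remainder F m m' d w‖ ≤ C := fun w hw => by
      rw [frontier_ball _ (inv_ne_zero ht.ne'), mem_sphere_zero_iff_norm] at hw
      have hw' : ‖w‖ * ‖d‖ = 1 := by rw [hw]; exact inv_mul_cancel₀ ht.ne'
      obtain ⟨a, b, h1, h2, h3⟩ := hFz w hw'
      exact norm_remainder_le hK hd1 hm hm' hw' h1 h2 h3
    refine Complex.norm_le_of_forall_mem_frontier_norm_le Metric.isBounded_ball hGd.diffContOnCl
      hfr ?_
    rw [closure_ball _ (inv_ne_zero ht.ne')]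
    simpa using hz
  -- The value at the centre is `m - m'`. Thus the maximum principle also yields Lipschitz control
  -- of the coefficient `m`, which was not assumed continuous in the parameter.
  have hG0 : remainder F m m' d 0 = -(m' - m) := by
    simp [remainder, evol_zero]
  have hdm : ‖m' - m‖ ≤ C := by
    have := hG 0 (by rw [norm_zero]; positivity)
    rwa [hG0, norm_neg] at this
  have hzt : ‖z‖ < t⁻¹ := by rwa [lt_inv_comm₀ (norm_pos_iff.mpr hz0) ht, ← one_div,
    lt_div_iff₀ (norm_pos_iff.mpr hz0), mul_comm]
  have hschwarz : ‖remainder F m m' d z - remainder F m m' d 0‖ ≤ 2 * C * t * ‖z‖ := by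
    have := Complex.dist_le_div_mul_dist_of_mapsTo_ball (f := remainder F m m' d) (c := 0)
      (R₁ := t⁻¹) (R₂ := 2 * C) (z := z) hGd.differentiableOn (fun w hw => by
        rw [mem_closedBall_iff_norm]
        have h1 := hG w (by simpa using (mem_ball_zero_iff.mp hw).le)
        have h2 := hG 0 (by rw [norm_zero]; positivity)
        exact (norm_sub_le_of_le h1 h2).trans (by linarith)) (by simpa using hzt)
    rwa [dist_eq_norm, dist_zero_right, div_inv_eq_mul] at this
  have hw : ‖d * z‖ ≤ 1 := by rw [norm_mul, mul_comm]; exact hz.le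
  have hexp : Real.exp ‖d * z‖ ≤ 3 := (Real.exp_le_exp.mpr hw).trans exp_one_le_three
  have hdz : ‖d * z‖ = t * ‖z‖ := norm_mul _ _
  set τ := evol (d * z) - 1 - (d * z) • Lam with hτ
  have hτn : ‖τ‖ ≤ 3 * t ^ 2 * ‖z‖ ^ 2 := by
    refine (norm_evol_sub_le _).trans ?_
    calc ‖d * z‖ ^ 2 * Real.exp ‖d * z‖ ≤ ‖d * z‖ ^ 2 * 3 := by gcongr
      _ = _ := by rw [hdz]; ring
  have hE1 : ‖evol (d * z) - 1‖ ≤ 3 * t * ‖z‖ := by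
    refine (norm_evol_sub_one_le _).trans ?_
    calc ‖d * z‖ * Real.exp ‖d * z‖ ≤ ‖d * z‖ * 3 := by gcongr
      _ = _ := by rw [hdz]; ring
  have e : F z - 1 - d • (z • Lam + (m * Lam - Lam * m)) =
      τ + z⁻¹ • ((remainder F m m' d z - remainder F m m' d 0) +
        (m' - m) * (evol (d * z) - 1) + (m * τ - τ * m)) := by
    have h1 : F z = evol (d * z) + z⁻¹ • (remainder F m m' d z +
        (m' * evol (d * z) - evol (d * z) * m)) := by
      rw [remainder, sub_add_cancel, inv_smul_smul₀ hz0, add_sub_cancel]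
    have h2 : evol (d * z) = 1 + τ + (d * z) • Lam := by rw [hτ]; abel
    have h3 : d • (m * Lam - Lam * m) = z⁻¹ • ((d * z) • (m * Lam - Lam * m)) := by
      rw [smul_smul]; congr 1; field_simp
    rw [h1, smul_add d, h3, smul_smul, hG0]
    generalize remainder F m m' d z = g
    rw [h2]
    have h4 : z⁻¹ • (g + (m' * (1 + τ + (d * z) • Lam) - (1 + τ + (d * z) • Lam) * m)) =
        z⁻¹ • (g - -(m' - m) + (m' - m) * (1 + τ + (d * z) • Lam - 1) + (m * τ - τ * m)) +
          z⁻¹ • ((d * z) • (m * Lam - Lam * m)) := by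
      rw [← smul_add]
      congr 1
      simp only [mul_add, add_mul, sub_mul, mul_sub, mul_smul_comm, smul_mul_assoc, smul_sub,
        mul_one, one_mul]
      abel
    rw [h4]
    abel
  rw [e]
  have hz0' : 0 < ‖z‖ := norm_pos_iff.mpr hz0
  have hcomm : ‖m * τ - τ * m‖ ≤ 2 * (3 * K * (3 * t ^ 2 * ‖z‖ ^ 2)) := by
    refine (norm_sub_le_of_le (norm_mul_le_of_le hm hτn) (norm_mul_le_of_le hτn hm)).trans
      (le_of_eq (by ring))
  have h2 := norm_add_le_of_le (norm_add_le_of_le hschwarz (norm_mul_le_of_le hdm hE1)) hcomm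
  refine (norm_add_le_of_le hτn (norm_smul_le _ _)).trans ?_
  rw [norm_inv]
  -- Here `1170 = (2 + 3) · 234`, from Schwarz's lemma and from the term with `m' - m`; the
  -- commutator with `τ` gives `18 K`.
  calc _ ≤ 3 * t ^ 2 * ‖z‖ ^ 2 + ‖z‖⁻¹ * (2 * C * t * ‖z‖ + C * (3 * t * ‖z‖) +
        2 * (3 * K * (3 * t ^ 2 * ‖z‖ ^ 2))) := by gcongr
    _ = _ := by
      rw [hC]; field_simp; ring

end Expansion

open scoped Matrix.Norms.Operator

/-! ### The transfer matrix -/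

section Moments

variable {M : ℤ → ℂ → Mat} {m : Mat} {K : ℝ}

theorem HasMoment.norm_le (hB : SectorBound M K) (hm : HasMoment M m K) (hK : 1 ≤ K) :
    ‖m‖ ≤ 3 * K := by
  have hmem := mem_sector (n := 0) (x := 0) (φ := rayAngle 0)
    ⟨le_rfl, (rayAngle_strictMono (by norm_num)).le⟩
  set z := Complex.exp ((0 : ℝ) + rayAngle 0 * I) with hz
  have hn : ‖z‖ = 1 := by rw [hz, norm_exp_add_mul_I, Real.exp_zero]
  have h1 := (hB 0 z hmem).1
  have h2 := hm 0 z hmem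
  rw [hn, inv_one, one_pow, mul_one] at h2
  have h3 : ‖m‖ = ‖z⁻¹ • m‖ := by rw [norm_smul, norm_inv, hn, inv_one, one_mul]
  have e : z⁻¹ • m = M 0 z - 1 - (M 0 z - 1 - z⁻¹ • m) := by abel
  rw [h3, e]
  refine (norm_sub_le_of_le (norm_sub_le_of_le h1 norm_one.le) h2).trans (by linarith)

theorem HasMoment.norm_sub_one_le (hB : SectorBound M K) (hm : HasMoment M m K) (hK : 1 ≤ K)
    {n : ℤ} {z : ℂ} (hz : z ∈ sector n) (hz1 : 1 ≤ ‖z‖) : ‖M n z - 1‖ ≤ 4 * K * ‖z‖⁻¹ := by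
  have h0 := hm.norm_le hB hK
  have h2 := hm n z hz
  set t := ‖z‖⁻¹ with ht
  have ht0 : 0 ≤ t := by positivity
  have ht1 : t ≤ 1 := inv_le_one_of_one_le₀ hz1
  have hzm : ‖z⁻¹ • m‖ ≤ t * (3 * K) := by
    rw [norm_smul, norm_inv]; gcongr
  have e : M n z - 1 = (M n z - 1 - z⁻¹ • m) + z⁻¹ • m := by abel
  rw [e]
  refine (norm_add_le_of_le h2 hzm).trans ?_
  have : t ^ 2 ≤ t := by nlinarith
  nlinarith

/-- Inverting the expansion: `M⁻¹ - 1 + m/z = -M⁻¹(M - 1 - m/z) + M⁻¹(M - 1)(m/z)`, where both terms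
are quadratically small. -/
theorem HasMoment.adjugate (hB : SectorBound M K) (hm : HasMoment M m K) (hK : 1 ≤ K)
    (hinv : ∀ n z, (M n z).adjugate * M n z = 1) {n : ℤ} {z : ℂ} (hz : z ∈ sector n)
    (hz1 : 1 ≤ ‖z‖) : ‖(M n z).adjugate - 1 + z⁻¹ • m‖ ≤ 13 * K ^ 3 * ‖z‖⁻¹ ^ 2 := by
  have h0 := hm.norm_le hB hK
  have h1 := (hB n z hz).2
  have h2 := hm n z hz
  set t := ‖z‖⁻¹ with ht
  have ht0 : 0 ≤ t := by positivity
  have ht1 : t ≤ 1 := inv_le_one_of_one_le₀ hz1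
  have hzm : ‖z⁻¹ • m‖ ≤ t * (3 * K) := by
    rw [norm_smul, norm_inv]; gcongr
  have h3 := hm.norm_sub_one_le hB hK hz hz1
  have e : (M n z).adjugate - 1 + z⁻¹ • m = -((M n z).adjugate * (M n z - 1 - z⁻¹ • m)) +
      (M n z).adjugate * (M n z - 1) * (z⁻¹ • m) := by
    simp only [mul_sub, sub_mul, hinv, mul_one, one_mul]
    abel
  rw [e]
  refine (norm_add_le_of_le ((norm_neg _).le.trans (norm_mul_le_of_le h1 h2))
    (norm_mul_le_of_le (norm_mul_le_of_le h1 h3) hzm)).trans ?_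
  have : K ^ 2 ≤ K ^ 3 := pow_le_pow_right₀ hK (by norm_num)
  have := mul_le_mul_of_nonneg_right this (sq_nonneg t)
  linarith

end Moments

section Transfer

variable {r₁ r₂ : ℂ} {Y : Set ℝ} {N : ℝ → ℤ → ℂ → Mat}

/-- The matrix `Ψ(y') Ψ(y)⁻¹`. -/
noncomputable def transfer (N : ℝ → ℤ → ℂ → Mat) (y' y : ℝ) (n : ℤ) (z : ℂ) : Mat :=
  N y' n z * evol (((y' - y : ℝ) : ℂ) * z) * (N y n z).adjugate

theorem evol_mul_expDiag_phase (y y' : ℝ) (z : ℂ) :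
    evol (((y' - y : ℝ) : ℂ) * z) * expDiag (phase y z) = expDiag (phase y' z) := by
  rw [evol, expDiag_mul]
  congr 1
  funext i
  simp only [Pi.add_apply, phase]
  push_cast; ring

theorem expDiag_neg_phase_mul_evol (y y' : ℝ) (z : ℂ) :
    expDiag (-phase y' z) * evol (((y' - y : ℝ) : ℂ) * z) = expDiag (-phase y z) := by
  rw [evol, expDiag_mul]
  congr 1
  funext i
  simp only [Pi.add_apply, Pi.neg_apply, phase]
  push_cast; ring

theorem jump_mul_evol (y y' : ℝ) (n : Fin 12) (z : ℂ) :
    jump r₁ r₂ n y' z * evol (((y' - y : ℝ) : ℂ) * z) =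
      evol (((y' - y : ℝ) : ℂ) * z) * jump r₁ r₂ n y z := by
  rw [jump_eq, jump_eq, mul_assoc, expDiag_neg_phase_mul_evol, ← evol_mul_expDiag_phase y y']
  simp only [mul_assoc]

/-- The jumps at `y` and `y'` are conjugates of one constant matrix, so `e^{(y' - y)zΛ}` intertwines
them and the jumps of the two outer factors cancel. -/
theorem transfer_sub_one {y y' : ℝ} (hy : IsEntireSolution r₁ r₂ y (N y))
    (hy' : IsEntireSolution r₁ r₂ y' (N y')) (n : ℤ) (z : ℂ) :
    transfer N y' y n z = transfer N y' y (n - 1) z := by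
  rw [transfer, hy.jump, hy'.jump, Matrix.adjugate_mul_distrib, transfer]
  have h : jump r₁ r₂ (rayIdx n) y z * (jump r₁ r₂ (rayIdx n) y z).adjugate = 1 := by
    rw [Matrix.mul_adjugate, det_jump, one_smul]
  calc _ = N y' (n - 1) z * (jump r₁ r₂ (rayIdx n) y' z * evol (((y' - y : ℝ) : ℂ) * z)) *
        ((jump r₁ r₂ (rayIdx n) y z).adjugate * (N y (n - 1) z).adjugate) := by
        simp only [mul_assoc]
    _ = N y' (n - 1) z * evol (((y' - y : ℝ) : ℂ) * z) * ((jump r₁ r₂ (rayIdx n) y z *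
        (jump r₁ r₂ (rayIdx n) y z).adjugate) * (N y (n - 1) z).adjugate) := by
        rw [jump_mul_evol]; simp only [mul_assoc]
    _ = _ := by rw [h, one_mul]

theorem eq_zero_of_eq_sub_one {α : Type*} {g : ℤ → α} (h : ∀ n, g n = g (n - 1)) (n : ℤ) :
    g n = g 0 := by
  induction n using Int.induction_on with
  | zero => rfl
  | succ k ih => rw [← ih, h (k + 1), add_sub_cancel_right]
  | pred k ih => rw [← ih, h (-k)]

theorem transfer_eq {y y' : ℝ} (hy : IsEntireSolution r₁ r₂ y (N y))
    (hy' : IsEntireSolution r₁ r₂ y' (N y')) (n : ℤ) (z : ℂ) :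
    transfer N y' y n z = transfer N y' y 0 z :=
  eq_zero_of_eq_sub_one (fun n => transfer_sub_one hy hy' n z) n

theorem differentiable_transfer {y y' : ℝ} (hy : IsEntireSolution r₁ r₂ y (N y))
    (hy' : IsEntireSolution r₁ r₂ y' (N y')) (n : ℤ) : Differentiable ℂ (transfer N y' y n) :=
  ((hy'.differentiable n).mul (differentiable_evol _)).mul
    (differentiable_adjugate (hy.differentiable n))

theorem transfer_self {y : ℝ} (hy : IsEntireSolution r₁ r₂ y (N y)) (n : ℤ) (z : ℂ) :
    transfer N y y n z = 1 := by
  rw [transfer, sub_self, ofReal_zero, zero_mul, evol_zero, mul_one, hy.mul_adjugate]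

/-- The uniform bounds near `y₀` supply a common `K`, and `δ ≤ 1/(2R)` puts the disc `|z| ≤ R`
inside the disc of radius `1/|d|`. The point `z = 0`, where the estimate divides by `z`, is reached
by continuity. -/
theorem exists_transfer_estimate (h₁ : ‖r₁‖ ≤ 1) (h₂ : ‖r₂‖ ≤ 1)
    (hN : ∀ y ∈ Y, IsEntireSolution r₁ r₂ y (N y)) {m : ℝ → Mat}
    (hm : ∀ y ∈ Y, ∃ K, HasMoment (N y) (m y) K) {y₀ : ℝ} (hy₀ : y₀ ∈ Y) {R : ℝ} (hR : 0 < R) :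
    ∃ C δ : ℝ, 0 < δ ∧ ∀ y ∈ Y, |y - y₀| < δ → ∀ z, ‖z‖ ≤ R →
      ‖transfer N y y₀ 0 z - 1 - ((y - y₀ : ℝ) : ℂ) • (z • Lam + (m y₀ * Lam - Lam * m y₀))‖ ≤
        C * |y - y₀| ^ 2 := by
  obtain ⟨K, δ, hδ, hK, hKδ⟩ := exists_uniform_hasMoment h₁ h₂ hN hm hy₀
  obtain ⟨hB₀, hm₀⟩ := hKδ y₀ hy₀ (by simpa using hδ)
  refine ⟨3 * R ^ 2 + 1170 * K ^ 4 + 18 * K * R, min δ (min 1 (1 / (2 * R))), by positivity,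
    fun y hy hd => ?_⟩
  obtain ⟨hB, hmy⟩ := hKδ y hy (hd.trans_le (min_le_left _ _))
  have hd1 : |y - y₀| ≤ 1 :=
    (hd.trans_le ((min_le_right _ _).trans (min_le_left _ _))).le
  have hd2 : R * |y - y₀| < 1 := by
    have h := (hd.trans_le ((min_le_right _ _).trans (min_le_right _ _))).le
    rw [le_div_iff₀ (by positivity)] at h
    linarith
  rcases eq_or_ne y y₀ with rfl | hne
  · intro z _
    rw [transfer_self (hN _ hy)]
    simp
  set d : ℂ := ((y - y₀ : ℝ) : ℂ) with hdef
  have hdn : ‖d‖ = |y - y₀| := by rw [hdef, Complex.norm_real, Real.norm_eq_abs]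
  have hd0 : d ≠ 0 := by rw [hdef]; exact_mod_cast sub_ne_zero.mpr hne
  have main : ∀ z : ℂ, z ≠ 0 → ‖z‖ ≤ R → _ := fun z hz0 hz =>
    norm_transfer_sub_le (F := transfer N y y₀ 0) (m := m y₀) (m' := m y) (d := d) (z := z)
      (differentiable_transfer (hN _ hy₀) (hN _ hy) 0) hK hd0 (hdn ▸ hd1) (hm₀.norm_le hB₀ hK)
      (hmy.norm_le hB hK) (fun w hw => by
        have hw0 : w ≠ 0 := by rintro rfl; simp at hw
        have hwi : ‖w‖⁻¹ = ‖d‖ := inv_eq_of_mul_eq_one_right hw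
        have hw1 : 1 ≤ ‖w‖ := by
          rw [← inv_inv ‖w‖, hwi]
          exact (one_le_inv₀ (norm_pos_iff.mpr hd0)).mpr (hdn ▸ hd1)
        obtain ⟨n, hn⟩ := exists_mem_sector hw0
        refine ⟨N y n w - 1 - w⁻¹ • m y, (N y₀ n w).adjugate - 1 + w⁻¹ • m y₀, ?_, ?_, ?_⟩
        · rw [← transfer_eq (hN _ hy₀) (hN _ hy) n, transfer]
          congr 2 <;> abel
        · rw [← hwi]; exact hmy n w hn
        · rw [← hwi]
          exact hm₀.adjugate hB₀ hK (hN _ hy₀).adjugate_mul hn hw1) hz0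
      ((mul_le_mul_of_nonneg_right hz (norm_nonneg _)).trans_lt (hdn ▸ hd2))
  have main' : ∀ z : ℂ, z ≠ 0 → ‖z‖ ≤ R → ‖transfer N y y₀ 0 z - 1 -
      d • (z • Lam + (m y₀ * Lam - Lam * m y₀))‖ ≤
        (3 * R ^ 2 + 1170 * K ^ 4 + 18 * K * R) * |y - y₀| ^ 2 := fun z hz0 hz => by
    refine (main z hz0 hz).trans ?_
    rw [mul_comm, hdn]
    gcongr
  intro z hz
  rcases eq_or_ne z 0 with rfl | hz0
  swap
  · exact main' z hz0 hz
  have hcont : Continuous fun z => ‖transfer N y y₀ 0 z - 1 -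
      d • (z • Lam + (m y₀ * Lam - Lam * m y₀))‖ := by
    have := (differentiable_transfer (hN _ hy₀) (hN _ hy) 0).continuous
    fun_prop
  refine le_of_tendsto ((hcont.tendsto 0).mono_left (nhdsWithin_le_nhds (s := {0}ᶜ))) ?_
  filter_upwards [self_mem_nhdsWithin, nhdsWithin_le_nhds (Metric.ball_mem_nhds (0 : ℂ) hR)]
    with w h1 h2
  exact main' w h1 (mem_ball_zero_iff.mp h2).le

theorem hasDerivAt_of_norm_sub_le {E : Type*} [NormedAddCommGroup E] [NormedSpace ℝ E]
    {f : ℝ → E} {a b : E} {y₀ C : ℝ} (h0 : f y₀ = a)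
    (h : ∀ᶠ y in 𝓝 y₀, ‖f y - a - (y - y₀) • b‖ ≤ C * |y - y₀| ^ 2) : HasDerivAt f b y₀ := by
  rw [hasDerivAt_iff_isLittleO]
  refine IsBigO.trans_isLittleO ?_ (isLittleO_pow_sub_sub y₀ one_lt_two)
  refine IsBigO.of_bound C ?_
  filter_upwards [h] with y hy
  rw [h0, norm_pow, norm_norm, Real.norm_eq_abs]
  exact hy

theorem hasDerivAt_transfer (h₁ : ‖r₁‖ ≤ 1) (h₂ : ‖r₂‖ ≤ 1) (hY : IsOpen Y)
    (hN : ∀ y ∈ Y, IsEntireSolution r₁ r₂ y (N y)) {m : ℝ → Mat}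
    (hm : ∀ y ∈ Y, ∃ K, HasMoment (N y) (m y) K) {y₀ : ℝ} (hy₀ : y₀ ∈ Y) (z : ℂ) :
    HasDerivAt (fun y => transfer N y y₀ 0 z) (z • Lam + (m y₀ * Lam - Lam * m y₀)) y₀ := by
  obtain ⟨C, δ, hδ, h⟩ := exists_transfer_estimate h₁ h₂ hN hm hy₀ (R := ‖z‖ + 1) (by positivity)
  refine hasDerivAt_of_norm_sub_le (C := C) (transfer_self (hN _ hy₀) 0 z) ?_
  filter_upwards [hY.mem_nhds hy₀, Metric.ball_mem_nhds y₀ hδ] with y hy hd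
  have := h y hy (by rwa [Metric.mem_ball, Real.dist_eq] at hd) z (by linarith)
  rwa [Complex.coe_smul] at this

/-- The quadratic estimate is uniform on discs in `z`, so Cauchy's estimate on the unit circle
around `z` transfers it to the `z`-derivative. No interchange of derivatives is needed. -/
theorem hasDerivAt_deriv_transfer (h₁ : ‖r₁‖ ≤ 1) (h₂ : ‖r₂‖ ≤ 1) (hY : IsOpen Y)
    (hN : ∀ y ∈ Y, IsEntireSolution r₁ r₂ y (N y)) {m : ℝ → Mat}
    (hm : ∀ y ∈ Y, ∃ K, HasMoment (N y) (m y) K) {y₀ : ℝ} (hy₀ : y₀ ∈ Y) (z : ℂ) :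
    HasDerivAt (fun y => deriv (transfer N y y₀ 0) z) Lam y₀ := by
  obtain ⟨C, δ, hδ, h⟩ := exists_transfer_estimate h₁ h₂ hN hm hy₀ (R := ‖z‖ + 1) (by positivity)
  have h0 : transfer N y₀ y₀ 0 = fun _ => 1 := funext fun z => transfer_self (hN _ hy₀) 0 z
  refine hasDerivAt_of_norm_sub_le (C := C) (a := 0) (by rw [h0]; exact deriv_const z (1 : Mat)) ?_
  filter_upwards [hY.mem_nhds hy₀, Metric.ball_mem_nhds y₀ hδ] with y hy hd
  have hd' := h y hy (by rwa [Metric.mem_ball, Real.dist_eq] at hd)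
  have hdiff := differentiable_transfer (hN _ hy₀) (hN _ hy) 0
  set d : ℂ := ((y - y₀ : ℝ) : ℂ) with hdef
  set U := m y₀ * Lam - Lam * m y₀
  have hf : Differentiable ℂ fun z => transfer N y y₀ 0 z - 1 - d • (z • Lam + U) := by fun_prop
  have hderiv : HasDerivAt (fun z => transfer N y y₀ 0 z - 1 - d • (z • Lam + U))
      (deriv (transfer N y y₀ 0) z - d • Lam) z := by
    have h1 : HasDerivAt (fun z : ℂ => d • (z • Lam + U)) (d • Lam) z := by
      have := (((hasDerivAt_id z).smul_const Lam).add_const U).const_smul d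
      rw [one_smul] at this
      exact this
    exact ((hdiff z).hasDerivAt.sub_const 1).sub h1
  have := Complex.norm_deriv_le_of_forall_mem_sphere_norm_le one_pos hf.diffContOnCl
    (c := z) (C := C * |y - y₀| ^ 2) fun w hw => hd' w (by
      have h1 := norm_le_norm_add_norm_sub' w z
      rw [mem_sphere_iff_norm.mp hw] at h1
      exact h1)
  rw [hderiv.deriv, div_one] at this
  rw [sub_zero]
  rwa [hdef, Complex.coe_smul] at this

end Transfer

open scoped Matrix.Norms.Operator

/-! ### The equation in the spectral parameter -/

section Lax

variable {r₁ r₂ : ℂ} {y : ℝ} {M : ℤ → ℂ → Mat}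

/-- The derivative of the exponent with respect to the spectral parameter. -/
noncomputable def dphase (y : ℝ) (z : ℂ) : Mat := (y : ℂ) • Lam - (9 * z ^ 4) • Lam ^ 2

/-- The wave function in the sectors. -/
noncomputable def sectorWave (M : ℤ → ℂ → Mat) (y : ℝ) (n : ℤ) (z : ℂ) : Mat :=
  M n z * expDiag (phase y z)

/-- The logarithmic derivative of the wave function. -/
noncomputable def lax (M : ℤ → ℂ → Mat) (y : ℝ) (n : ℤ) (z : ℂ) : Mat :=
  deriv (M n) z * (M n z).adjugate + M n z * dphase y z * (M n z).adjugate

theorem hasDerivAt_mat {f : ℂ → Mat} {f' : Mat} {z : ℂ}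
    (h : ∀ i j, HasDerivAt (fun z => f z i j) (f' i j) z) : HasDerivAt f f' z :=
  hasDerivAt_pi.mpr fun i => hasDerivAt_pi.mpr fun j => h i j

theorem hasDerivAt_expDiag_phase (y : ℝ) (z : ℂ) :
    HasDerivAt (fun z => expDiag (phase y z)) (dphase y z * expDiag (phase y z)) z := by
  refine hasDerivAt_mat fun i j => ?_
  have e : dphase y z = Matrix.diagonal fun i => y * lam i - 9 * z ^ 4 * lam i ^ 2 := by
    rw [dphase, Lam, Matrix.diagonal_pow, ← Matrix.diagonal_smul, ← Matrix.diagonal_smul,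
      Matrix.diagonal_sub]
    rfl
  rw [e]
  simp only [expDiag, Matrix.diagonal_mul_diagonal]
  rcases eq_or_ne i j with rfl | hij
  · simp only [Matrix.diagonal_apply_eq]
    have h : HasDerivAt (fun z => phase y z i) (y * lam i - 9 * z ^ 4 * lam i ^ 2) z := by
      unfold phase
      have h1 : HasDerivAt (fun z : ℂ => (y : ℂ) * z * lam i) (y * lam i) z := by
        simpa using ((hasDerivAt_id z).const_mul (y : ℂ)).mul_const (lam i)
      have h2 : HasDerivAt (fun z : ℂ => 9 * z ^ 5 / 5 * lam i ^ 2) (9 * z ^ 4 * lam i ^ 2) z :=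
        ((((hasDerivAt_pow 5 z).const_mul 9).div_const 5).mul_const (lam i ^ 2)).congr_deriv
          (by push_cast; ring)
      exact h1.sub h2
    exact h.cexp.congr_deriv (mul_comm _ _)
  · simp only [Matrix.diagonal_apply_ne _ hij]
    exact hasDerivAt_const _ _

theorem IsEntireSolution.hasDerivAt_sectorWave (hM : IsEntireSolution r₁ r₂ y M) (n : ℤ) (z : ℂ) :
    HasDerivAt (sectorWave M y n) (lax M y n z * sectorWave M y n z) z := by
  have h := (hM.differentiable n z).hasDerivAt.mul (hasDerivAt_expDiag_phase y z)
  have e : lax M y n z * sectorWave M y n z =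
      deriv (M n) z * expDiag (phase y z) + M n z * (dphase y z * expDiag (phase y z)) := by
    rw [lax, sectorWave]
    calc _ = (deriv (M n) z * ((M n z).adjugate * M n z) + M n z * dphase y z *
          ((M n z).adjugate * M n z)) * expDiag (phase y z) := by
            simp only [mul_assoc, add_mul]
      _ = _ := by rw [hM.adjugate_mul, mul_one, mul_one]; simp only [mul_assoc, add_mul]
  rw [e]
  exact h

theorem IsEntireSolution.sectorWave_mul (hM : IsEntireSolution r₁ r₂ y M) (n : ℤ) (z : ℂ) :
    sectorWave M y n z * (expDiag (-phase y z) * (M n z).adjugate) = 1 := by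
  rw [sectorWave]
  calc _ = M n z * (expDiag (phase y z) * expDiag (-phase y z)) * (M n z).adjugate := by
        simp only [mul_assoc]
    _ = _ := by rw [expDiag_mul_neg, mul_one, hM.mul_adjugate]

theorem IsEntireSolution.mul_sectorWave_cancel (hM : IsEntireSolution r₁ r₂ y M) {n : ℤ} {z : ℂ}
    {A B : Mat} (h : A * sectorWave M y n z = B * sectorWave M y n z) : A = B := by
  have := congrArg (· * (expDiag (-phase y z) * (M n z).adjugate)) h
  simpa only [mul_assoc, hM.sectorWave_mul, mul_one] using this

theorem IsEntireSolution.sectorWave_jump (hM : IsEntireSolution r₁ r₂ y M) (n : ℤ) (z : ℂ) :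
    sectorWave M y n z = sectorWave M y (n - 1) z * jumpConst r₁ r₂ (rayIdx n) := by
  rw [sectorWave, hM.jump, jump_eq, sectorWave]
  calc _ = M (n - 1) z * expDiag (phase y z) * jumpConst r₁ r₂ (rayIdx n) *
        (expDiag (-phase y z) * expDiag (phase y z)) := by simp only [mul_assoc]
    _ = _ := by rw [expDiag_neg_mul, mul_one]

/-- The wave functions of adjacent sectors differ by a right factor independent of `z`, which drops
out of `Ψ_z Ψ⁻¹`. -/
theorem IsEntireSolution.lax_sub_one (hM : IsEntireSolution r₁ r₂ y M) (n : ℤ) (z : ℂ) :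
    lax M y n z = lax M y (n - 1) z := by
  set J := jumpConst r₁ r₂ (rayIdx n)
  have e : sectorWave M y n = fun z => sectorWave M y (n - 1) z * J :=
    funext fun z => hM.sectorWave_jump n z
  have h1 : HasDerivAt (fun z => sectorWave M y (n - 1) z * J)
      (lax M y n z * sectorWave M y n z) z := by
    rw [← e]
    exact hM.hasDerivAt_sectorWave n z
  have h2 : HasDerivAt (fun z => sectorWave M y (n - 1) z * J)
      (lax M y (n - 1) z * sectorWave M y n z) z := by
    refine ((hM.hasDerivAt_sectorWave (n - 1) z).mul_const J).congr_deriv ?_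
    rw [hM.sectorWave_jump n, mul_assoc]
  exact hM.mul_sectorWave_cancel (h1.unique h2)

theorem IsEntireSolution.lax_eq (hM : IsEntireSolution r₁ r₂ y M) (n : ℤ) (z : ℂ) :
    lax M y n z = lax M y 0 z :=
  eq_zero_of_eq_sub_one (fun n => hM.lax_sub_one n z) n

theorem IsEntireSolution.differentiable_lax (hM : IsEntireSolution r₁ r₂ y M) (n : ℤ) :
    Differentiable ℂ (lax M y n) := by
  have h1 := hM.differentiable n
  have h2 := differentiable_adjugate h1
  have h3 : Differentiable ℂ (dphase y) := by unfold dphase; fun_prop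
  have h4 : Differentiable ℂ (deriv (M n)) := fun z =>
    ((h1.analyticAt z).deriv).differentiableAt
  exact (h4.mul h2).add ((h1.mul h3).mul h2)

/-- Cauchy's estimate for `ξ ↦ M(e^ξ)` on a disc of radius `tilt`: the solution is bounded in the
sector widened by `tilt`, where the jump estimate compares it with its neighbours. The chain rule
turns this into `M' = O(1/|z|)`. -/
theorem IsEntireSolution.norm_deriv_le (h₁ : ‖r₁‖ ≤ 1) (h₂ : ‖r₂‖ ≤ 1)
    (hM : IsEntireSolution r₁ r₂ y M) {B : ℝ} (hB : SectorBound M B) {n : ℤ} {z : ℂ}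
    (hz : z ∈ sector n) : ‖deriv (M n) z‖ * ‖z‖ ≤ (B + 3 * decayConst |y| * B) / tilt := by
  have ht := tilt_pos
  have hB0 := hB.nonneg
  have hwide : ∀ x φ : ℝ, φ ∈ Icc (rayAngle n - tilt) (rayAngle (n + 1) + tilt) →
      ‖M n (Complex.exp (x + φ * I))‖ ≤ B + 3 * decayConst |y| * B := fun x φ hφ => by
    have hw : 3 * decayConst |y| * B * expWeight 0 x ≤ 3 * decayConst |y| * B := by
      have := decayConst_pos |y|
      refine mul_le_of_le_one_right (by positivity) ?_
      simp only [expWeight, pow_zero, one_mul]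
      exact Real.exp_le_one_iff.mpr (by linarith [Real.exp_pos x])
    have hr := rayAngle_succ n
    rcases le_total φ (rayAngle n) with h1 | h1
    · have habs : |φ - rayAngle n| ≤ tilt := by rw [abs_le]; constructor <;> linarith [hφ.1]
      have hj := hM.norm_jump_le h₁ h₂ hB (x := x) habs
      have hs := (hB (n - 1) _ (mem_sector (x := x) (φ := φ) ⟨by
        have := rayAngle_succ (n - 1)
        rw [sub_add_cancel] at this
        linarith [hφ.1], by rwa [sub_add_cancel]⟩)).1
      have := norm_le_norm_add_norm_sub' (M n (Complex.exp (x + φ * I)))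
        (M (n - 1) (Complex.exp (x + φ * I)))
      linarith
    · rcases le_total φ (rayAngle (n + 1)) with h2 | h2
      · have := (hB n _ (mem_sector (x := x) ⟨h1, h2⟩)).1
        have := decayConst_pos |y|
        have : 0 ≤ 3 * decayConst |y| * B := by positivity
        linarith
      · have habs : |φ - rayAngle (n + 1)| ≤ tilt := by
          rw [abs_le]; constructor <;> linarith [hφ.2]
        have hj := hM.norm_jump_le h₁ h₂ hB (x := x) habs
        rw [add_sub_cancel_right] at hj
        have hs := (hB (n + 1) _ (mem_sector (x := x) (φ := φ) ⟨h2, by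
          have := rayAngle_succ (n + 1)
          linarith [hφ.2]⟩)).1
        have := norm_le_norm_add_norm_sub (M (n + 1) (Complex.exp (x + φ * I)))
          (M n (Complex.exp (x + φ * I)))
        linarith
  obtain ⟨x, φ, hφ, rfl⟩ := hz
  have hf : Differentiable ℂ fun ξ => M n (Complex.exp ξ) :=
    (hM.differentiable n).comp Complex.differentiable_exp
  have hderiv : HasDerivAt (fun ξ => M n (Complex.exp ξ))
      (Complex.exp (x + φ * I) • deriv (M n) (Complex.exp (x + φ * I))) (x + φ * I) :=
    HasDerivAt.scomp (x + φ * I : ℂ) (hM.differentiable n _).hasDerivAt (Complex.hasDerivAt_exp _)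
  have := Complex.norm_deriv_le_of_forall_mem_sphere_norm_le ht hf.diffContOnCl
    (c := (x + φ * I : ℂ)) (C := B + 3 * decayConst |y| * B) fun ξ hξ => by
      rw [mem_sphere_iff_norm] at hξ
      have him := (Complex.abs_im_le_norm (ξ - (x + φ * I))).trans_eq hξ
      have e1 : (ξ - (x + φ * I)).im = ξ.im - φ := by simp
      rw [e1, abs_le] at him
      have := hwide ξ.re ξ.im ⟨by linarith [hφ.1], by linarith [hφ.2]⟩
      rwa [Complex.re_add_im] at this
  rw [hderiv.deriv, norm_smul] at this
  rwa [mul_comm]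

end Lax

open scoped Matrix.Norms.Operator

/-! ### The polynomial form of the equation in the spectral parameter -/

theorem Lam_pow_three : Lam ^ 3 = 1 := by
  rw [Lam, Matrix.diagonal_pow, ← Matrix.diagonal_one]
  congr 1
  funext i
  have h := om_cube
  fin_cases i
  · exact h
  · change (om ^ 2) ^ 3 = 1
    linear_combination (om ^ 3 + 1) * h
  · simp [lam]

theorem trace_Lam : Lam.trace = 0 := by
  have h := om_sq_add
  simp only [Lam, Matrix.trace_diagonal, Fin.sum_univ_three, lam, Matrix.cons_val]
  linear_combination h

theorem trace_Lam_sq : (Lam ^ 2).trace = 0 := by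
  have h := om_sq_add
  have h3 := om_cube
  rw [Lam, Matrix.diagonal_pow]
  simp only [Matrix.trace_diagonal, Fin.sum_univ_three, lam, Pi.pow_apply, Matrix.cons_val]
  linear_combination h + om * h3

/-- As `Λ³ = 1` and `Λ`, `Λ²` are traceless, only the mixed term `-18 y z⁴ I` contributes. -/
theorem trace_dphase_sq (y : ℝ) (z : ℂ) :
    (dphase y z * dphase y z).trace = -(54 * y * z ^ 4) := by
  have e : dphase y z * dphase y z = ((y : ℂ) ^ 2) • Lam ^ 2 - (18 * y * z ^ 4) • (1 : Mat) +
      (81 * z ^ 8) • Lam := by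
    have h4 : Lam ^ 2 * Lam ^ 2 = Lam := by
      rw [← pow_add, show 2 + 2 = 3 + 1 from rfl, pow_succ, Lam_pow_three, one_mul]
    have h3 : Lam ^ 2 * Lam = 1 := by rw [← pow_succ, Lam_pow_three]
    have h3' : Lam * Lam ^ 2 = 1 := by rw [← pow_succ', Lam_pow_three]
    rw [dphase]
    simp only [mul_sub, sub_mul, smul_mul_assoc, mul_smul_comm, h4, h3, h3', ← sq Lam]
    module
  rw [e, Matrix.trace_add, Matrix.trace_sub, Matrix.trace_smul, Matrix.trace_smul,
    Matrix.trace_smul, trace_Lam, trace_Lam_sq, Matrix.trace_one]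
  simp
  ring

theorem norm_trace_le (A : Mat) : ‖A.trace‖ ≤ 3 * ‖A‖ := by
  rw [Matrix.trace]
  refine (norm_sum_le _ _).trans ((Finset.sum_le_sum fun i _ => norm_apply_le A i i).trans ?_)
  simp

theorem eq_zero_of_sum_range_eq_zero {n : ℕ} {c : ℕ → ℂ}
    (h : ∀ z : ℂ, ∑ k ∈ Finset.range n, z ^ k * c k = 0) {k : ℕ} (hk : k < n) : c k = 0 := by
  have hp : (∑ k ∈ Finset.range n, Polynomial.C (c k) * Polynomial.X ^ k) = 0 :=
    Polynomial.funext fun z => by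
      rw [Polynomial.eval_finsetSum, Polynomial.eval_zero, ← h z]
      exact Finset.sum_congr rfl fun k _ => by
        rw [Polynomial.eval_mul, Polynomial.eval_C, Polynomial.eval_pow, Polynomial.eval_X, mul_comm]
  have := congrArg (fun p => Polynomial.coeff p k) hp
  simpa [Polynomial.finsetSum_coeff, Polynomial.coeff_C_mul_X_pow, hk] using this

section Poly

variable {r₁ r₂ : ℂ} {y : ℝ} {M : ℤ → ℂ → Mat}

/-- For the leading term, `MΛ²M⁻¹ - Λ² = [M - 1, Λ²] M⁻¹ = O(1/z)`. For the trace, `A = X + Z`,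
where `X = M'M⁻¹ = O(1/z)` and `Z` is a conjugate of the phase derivative; `tr Z²` is explicit, and
the mixed term is `O(z³)`. Thus the `z⁴` coefficient of `tr A²` is known exactly. -/
theorem IsEntireSolution.exists_lax_growth (h₁ : ‖r₁‖ ≤ 1) (h₂ : ‖r₂‖ ≤ 1)
    (hM : IsEntireSolution r₁ r₂ y M) {m : Mat} {K : ℝ} (hK : 1 ≤ K) (hB : SectorBound M K)
    (hm : HasMoment M m K) : ∃ C, ∀ z, 1 ≤ ‖z‖ →
      ‖lax M y 0 z + (9 * z ^ 4) • Lam ^ 2‖ ≤ C * ‖z‖ ^ 3 ∧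
      ‖(lax M y 0 z * lax M y 0 z).trace + 54 * y * z ^ 4‖ ≤ C * ‖z‖ ^ 3 := by
  set D := (K + 3 * decayConst |y| * K) / tilt with hD
  have hK0 : 0 ≤ K := by linarith
  have hD0 : 0 ≤ D := by
    have := decayConst_pos |y|
    have := tilt_pos
    positivity
  have hL2 : ‖Lam ^ 2‖ ≤ 1 := by
    rw [sq]; exact (norm_mul_le_of_le norm_Lam_le norm_Lam_le).trans (by norm_num)
  refine ⟨max (D * K + |y| * (K * K) + 72 * K * K) (3 * (D * K) ^ 2 +
    6 * (D * K * (K * (|y| + 9) * K))), fun z hz1 => ?_⟩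
  have hz0 : z ≠ 0 := by rintro rfl; simp at hz1; linarith
  obtain ⟨n, hn⟩ := exists_mem_sector hz0
  rw [← hM.lax_eq n]
  have hM1 := hm.norm_sub_one_le hB hK hn hz1
  have hdM : ‖deriv (M n) z‖ ≤ D * ‖z‖⁻¹ := by
    rw [← div_eq_mul_inv, le_div_iff₀ (by linarith)]
    exact hM.norm_deriv_le h₁ h₂ hB hn
  obtain ⟨hB1, hB2⟩ := hB n z hn
  have hi := hM.mul_adjugate n z
  have hi' := hM.adjugate_mul n z
  set A := (M n z).adjugate
  set P := M n z
  set t := ‖z‖ with ht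
  have ht0 : 0 < t := by linarith
  have hti : t⁻¹ ≤ 1 := inv_le_one_of_one_le₀ hz1
  have h13 : 1 ≤ t ^ 3 := one_le_pow₀ hz1
  constructor
  · have e : lax M y n z + (9 * z ^ 4) • Lam ^ 2 = deriv (M n) z * A + (y : ℂ) • (P * Lam * A) -
        (9 * z ^ 4) • (((P - 1) * Lam ^ 2 - Lam ^ 2 * (P - 1)) * A) := by
      have e1 : ((P - 1) * Lam ^ 2 - Lam ^ 2 * (P - 1)) * A = P * Lam ^ 2 * A - Lam ^ 2 := by
        have : ((P - 1) * Lam ^ 2 - Lam ^ 2 * (P - 1)) * A =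
          P * Lam ^ 2 * A - Lam ^ 2 * (P * A) := by noncomm_ring
        rw [this, hi, mul_one]
      rw [e1, lax, dphase]
      simp only [mul_sub, sub_mul, smul_mul_assoc, mul_smul_comm, smul_sub]
      abel
    rw [e]
    have b1 := norm_mul_le_of_le hdM hB2
    have b2 := norm_mul_le_of_le (norm_mul_le_of_le hB1 norm_Lam_le) hB2
    have b3 := norm_mul_le_of_le (norm_sub_le_of_le (norm_mul_le_of_le hM1 hL2)
      (norm_mul_le_of_le hL2 hM1)) hB2
    have c2 : ‖(y : ℂ) • (P * Lam * A)‖ ≤ |y| * (K * 1 * K) := by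
      rw [norm_smul, Complex.norm_real, Real.norm_eq_abs]; gcongr
    have c3 : ‖(9 * z ^ 4) • (((P - 1) * Lam ^ 2 - Lam ^ 2 * (P - 1)) * A)‖ ≤
        9 * t ^ 4 * ((4 * K * t⁻¹ * 1 + 1 * (4 * K * t⁻¹)) * K) := by
      rw [norm_smul, norm_mul, norm_pow]
      have : ‖(9 : ℂ)‖ = 9 := by norm_num
      rw [this]; gcongr
    have c3' : 9 * t ^ 4 * ((4 * K * t⁻¹ * 1 + 1 * (4 * K * t⁻¹)) * K) = 72 * K * K * t ^ 3 := by
      field_simp; ring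
    rw [c3'] at c3
    refine (norm_sub_le_of_le (norm_add_le_of_le b1 c2) c3).trans ?_
    refine le_trans ?_ (mul_le_mul_of_nonneg_right (le_max_left _ _) (by positivity))
    have d1 : D * t⁻¹ * K ≤ D * K * t ^ 3 := by
      calc D * t⁻¹ * K ≤ D * 1 * K := by gcongr
        _ = D * K * 1 := by ring
        _ ≤ _ := by gcongr
    have d2 : |y| * (K * 1 * K) ≤ |y| * (K * K) * t ^ 3 := by
      rw [mul_one]; exact le_mul_of_one_le_right (by positivity) h13
    linarith
  · set X := deriv (M n) z * A with hX
    set Z := P * dphase y z * A with hZ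
    have e : (lax M y n z * lax M y n z).trace + 54 * y * z ^ 4 =
        (X * X).trace + 2 * (X * Z).trace := by
      have e1 : (Z * Z).trace = -(54 * y * z ^ 4) := by
        have : Z * Z = P * (dphase y z * dphase y z) * A := by
          rw [hZ]
          calc _ = P * dphase y z * (A * P) * dphase y z * A := by simp only [mul_assoc]
            _ = _ := by rw [hi', mul_one]; simp only [mul_assoc]
        rw [this, Matrix.trace_mul_comm, ← mul_assoc, hi', one_mul, trace_dphase_sq]
      have e2 : lax M y n z = X + Z := rfl
      rw [e2, add_mul, mul_add, mul_add, Matrix.trace_add, Matrix.trace_add, Matrix.trace_add, e1,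
        Matrix.trace_mul_comm Z X]
      ring
    rw [e]
    have bX : ‖X‖ ≤ D * K * t⁻¹ := (norm_mul_le_of_le hdM hB2).trans_eq (by ring)
    have bX' : ‖X‖ ≤ D * K := bX.trans (mul_le_of_le_one_right (by positivity) hti)
    have bd : ‖dphase y z‖ ≤ (|y| + 9) * t ^ 4 := by
      have g1 : ‖(y : ℂ) • Lam‖ ≤ |y| * 1 := by
        rw [norm_smul, Complex.norm_real, Real.norm_eq_abs]
        gcongr
        exact norm_Lam_le
      have g2 : ‖(9 * z ^ 4) • Lam ^ 2‖ ≤ 9 * t ^ 4 * 1 := by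
        rw [norm_smul, norm_mul, norm_pow]
        have : ‖(9 : ℂ)‖ = 9 := by norm_num
        rw [this]; gcongr
      refine (norm_sub_le_of_le g1 g2).trans ?_
      have : |y| * 1 ≤ |y| * t ^ 4 := by
        gcongr
        exact one_le_pow₀ hz1
      linarith
    have bZ : ‖Z‖ ≤ K * (|y| + 9) * K * t ^ 4 :=
      (norm_mul_le_of_le (norm_mul_le_of_le hB1 bd) hB2).trans_eq (by ring)
    have bXX := (norm_trace_le (X * X)).trans (mul_le_mul_of_nonneg_left
      (norm_mul_le_of_le bX' bX') (by norm_num))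
    have bXZ := (norm_trace_le (X * Z)).trans (mul_le_mul_of_nonneg_left
      (norm_mul_le_of_le bX bZ) (by norm_num))
    have b2 : ‖(2 : ℂ) * (X * Z).trace‖ ≤
        2 * (3 * (D * K * t⁻¹ * (K * (|y| + 9) * K * t ^ 4))) := by
      rw [norm_mul]
      have : ‖(2 : ℂ)‖ = 2 := by norm_num
      rw [this]; gcongr
    refine (norm_add_le_of_le bXX b2).trans ?_
    refine le_trans ?_ (mul_le_mul_of_nonneg_right (le_max_right _ _) (by positivity))
    have e3 : 2 * (3 * (D * K * t⁻¹ * (K * (|y| + 9) * K * t ^ 4))) =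
        6 * (D * K * (K * (|y| + 9) * K)) * t ^ 3 := by field_simp; ring
    rw [e3, add_mul]
    have : 3 * (D * K * (D * K)) ≤ 3 * (D * K) ^ 2 * t ^ 3 := by
      rw [← sq]; exact le_mul_of_one_le_right (by positivity) h13
    linarith

theorem IsEntireSolution.exists_lax_polynomial (h₁ : ‖r₁‖ ≤ 1) (h₂ : ‖r₂‖ ≤ 1)
    (hM : IsEntireSolution r₁ r₂ y M) {m : Mat} {K : ℝ} (hK : 1 ≤ K) (hB : SectorBound M K)
    (hm : HasMoment M m K) : ∃ a : ℕ → Mat,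
      (∀ z, lax M y 0 z = ∑ k ∈ Finset.range 5, z ^ k • a k) ∧ a 4 = (-9 : ℂ) • Lam ^ 2 ∧
      2 * (a 4 * a 0).trace + 2 * (a 3 * a 1).trace + (a 2 * a 2).trace = -(54 * y) := by
  obtain ⟨C, hC⟩ := hM.exists_lax_growth h₁ h₂ hK hB hm
  have hd := hM.differentiable_lax 0
  obtain ⟨b, hb⟩ := exists_polynomial_of_growth 3
    (f := fun z => lax M y 0 z + (9 * z ^ 4) • Lam ^ 2) (by fun_prop) fun z hz => (hC z hz).1
  obtain ⟨c, hc⟩ := exists_polynomial_of_growth 3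
    (f := fun z => (lax M y 0 z * lax M y 0 z).trace + 54 * y * z ^ 4) (by
      have h2 := differentiable_apply (hd.mul hd)
      simp only [Matrix.trace_fin_three]
      fun_prop) fun z hz => (hC z hz).2
  set a : ℕ → Mat := fun k => if k = 4 then (-9 : ℂ) • Lam ^ 2 else b k with ha
  have hA : ∀ z, lax M y 0 z = ∑ k ∈ Finset.range 5, z ^ k • a k := fun z => by
    have := hb z
    simp only [Finset.sum_range_succ, Finset.sum_range_zero, ha] at this ⊢
    simp only [OfNat.zero_ne_ofNat, OfNat.one_ne_ofNat, Nat.reduceEqDiff, if_false, if_true]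
    rw [eq_sub_of_add_eq this]
    module
  refine ⟨a, hA, by simp [ha], ?_⟩
  set t : ℕ → ℕ → ℂ := fun k l => (a k * a l).trace with ht
  have hsymm : ∀ k l, t k l = t l k := fun k l => Matrix.trace_mul_comm _ _
  -- The nine entries are the coefficients of `z⁰, …, z⁸` in the difference of two expressions for
  -- `tr A²`. The numbers `c k` are uncontrolled and affect only the first four; the entry of index
  -- four is the first integral.
  have hpoly : ∀ z : ℂ, ∑ k ∈ Finset.range 9, z ^ k *
      (![t 0 0 - c 0, 2 * t 0 1 - c 1, 2 * t 0 2 + t 1 1 - c 2, 2 * t 0 3 + 2 * t 1 2 - c 3,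
        2 * t 4 0 + 2 * t 3 1 + t 2 2 + 54 * y, 2 * t 4 1 + 2 * t 3 2, 2 * t 4 2 + t 3 3,
        2 * t 4 3, t 4 4] : Fin 9 → ℂ) (Fin.ofNat 9 k) = 0 := fun z => by
    have := hc z
    rw [hA z] at this
    simp only [Finset.sum_range_succ, Finset.sum_range_zero, zero_add, add_mul, mul_add,
      smul_mul_smul_comm, Matrix.trace_add, Matrix.trace_smul, smul_eq_mul] at this
    change ∀ k l, (a k * a l).trace = (a l * a k).trace at hsymm
    simp only [Finset.sum_range_succ, Finset.sum_range_zero, zero_add, ht]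
    rw [hsymm 0 1, hsymm 0 2, hsymm 0 3, hsymm 0 4, hsymm 1 2, hsymm 1 3, hsymm 1 4, hsymm 2 3,
      hsymm 2 4, hsymm 3 4] at this
    rw [hsymm 0 1, hsymm 0 2, hsymm 0 3, hsymm 1 2]
    change z ^ 0 * ((a 0 * a 0).trace - c 0) + z ^ 1 * (2 * (a 1 * a 0).trace - c 1) +
      z ^ 2 * (2 * (a 2 * a 0).trace + (a 1 * a 1).trace - c 2) +
      z ^ 3 * (2 * (a 3 * a 0).trace + 2 * (a 2 * a 1).trace - c 3) +
      z ^ 4 * (2 * (a 4 * a 0).trace + 2 * (a 3 * a 1).trace + (a 2 * a 2).trace + 54 * y) +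
      z ^ 5 * (2 * (a 4 * a 1).trace + 2 * (a 3 * a 2).trace) +
      z ^ 6 * (2 * (a 4 * a 2).trace + (a 3 * a 3).trace) + z ^ 7 * (2 * (a 4 * a 3).trace) +
      z ^ 8 * (a 4 * a 4).trace = 0
    linear_combination this
  have := eq_zero_of_sum_range_eq_zero (c := fun k => (![t 0 0 - c 0, 2 * t 0 1 - c 1,
    2 * t 0 2 + t 1 1 - c 2, 2 * t 0 3 + 2 * t 1 2 - c 3,
    2 * t 4 0 + 2 * t 3 1 + t 2 2 + 54 * y, 2 * t 4 1 + 2 * t 3 2, 2 * t 4 2 + t 3 3,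
    2 * t 4 3, t 4 4] : Fin 9 → ℂ) (Fin.ofNat 9 k)) hpoly (k := 4) (by norm_num)
  change 2 * (a 4 * a 0).trace + 2 * (a 3 * a 1).trace + (a 2 * a 2).trace + 54 * y = 0 at this
  linear_combination this

end Poly

open scoped Matrix.Norms.Operator

/-! ### Compatibility of the two equations -/

section Compatibility

variable {r₁ r₂ : ℂ} {Y : Set ℝ} {N : ℝ → ℤ → ℂ → Mat}

theorem transfer_mul_sectorWave {y y' : ℝ} (hy : IsEntireSolution r₁ r₂ y (N y)) (n : ℤ) (z : ℂ) :
    transfer N y' y n z * sectorWave (N y) y n z = sectorWave (N y') y' n z := by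
  rw [transfer, sectorWave, sectorWave]
  calc _ = N y' n z * evol (((y' - y : ℝ) : ℂ) * z) * ((N y n z).adjugate * N y n z) *
        expDiag (phase y z) := by simp only [mul_assoc]
    _ = _ := by rw [hy.adjugate_mul, mul_one, mul_assoc, evol_mul_expDiag_phase]

/-- Differentiate `Ψ(y') = T Ψ(y)` in `z` and cancel `Ψ(y)`. -/
theorem lax_mul_transfer {y y' : ℝ} (hy : IsEntireSolution r₁ r₂ y (N y))
    (hy' : IsEntireSolution r₁ r₂ y' (N y')) (z : ℂ) :
    lax (N y') y' 0 z * transfer N y' y 0 z =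
      deriv (transfer N y' y 0) z + transfer N y' y 0 z * lax (N y) y 0 z := by
  have e : sectorWave (N y') y' 0 = fun z => transfer N y' y 0 z * sectorWave (N y) y 0 z :=
    funext fun z => (transfer_mul_sectorWave hy 0 z).symm
  have h1 : HasDerivAt (fun z => transfer N y' y 0 z * sectorWave (N y) y 0 z)
      (lax (N y') y' 0 z * transfer N y' y 0 z * sectorWave (N y) y 0 z) z := by
    rw [← e, mul_assoc, transfer_mul_sectorWave hy]
    exact hy'.hasDerivAt_sectorWave 0 z
  have h2 : HasDerivAt (fun z => transfer N y' y 0 z * sectorWave (N y) y 0 z)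
      ((deriv (transfer N y' y 0) z + transfer N y' y 0 z * lax (N y) y 0 z) *
        sectorWave (N y) y 0 z) z := by
    refine ((differentiable_transfer hy hy' 0 z).hasDerivAt.mul
      (hy.hasDerivAt_sectorWave 0 z)).congr_deriv ?_
    rw [add_mul, mul_assoc]
    rfl
  exact hy.mul_sectorWave_cancel (h1.unique h2)

theorem hasDerivAt_ring_inverse {F : ℝ → Mat} {F' : Mat} {y₀ : ℝ} (h : HasDerivAt F F' y₀)
    (h1 : F y₀ = 1) : HasDerivAt (fun y => Ring.inverse (F y)) (-F') y₀ := by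
  have h2 := hasFDerivAt_ringInverse (𝕜 := ℝ) (1 : Matˣ)
  rw [Units.val_one, ← h1] at h2
  refine (h2.comp_hasDerivAt y₀ h).congr_deriv ?_
  simp

/-- Since `A(y) = (T_z + T A(y₀)) T⁻¹` with `T = 1` and `T_z = 0` at `y₀`, the derivatives of `T`
and `T_z` give `A_y = U_z + [U, A]` with `U = zΛ + [m, Λ]`. This is the zero-curvature equation. -/
theorem hasDerivAt_lax (h₁ : ‖r₁‖ ≤ 1) (h₂ : ‖r₂‖ ≤ 1) (hY : IsOpen Y)
    (hN : ∀ y ∈ Y, IsEntireSolution r₁ r₂ y (N y)) {m : ℝ → Mat}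
    (hm : ∀ y ∈ Y, ∃ K, HasMoment (N y) (m y) K) {y₀ : ℝ} (hy₀ : y₀ ∈ Y) (z : ℂ) :
    HasDerivAt (fun y => lax (N y) y 0 z)
      (Lam + ((z • Lam + (m y₀ * Lam - Lam * m y₀)) * lax (N y₀) y₀ 0 z -
        lax (N y₀) y₀ 0 z * (z • Lam + (m y₀ * Lam - Lam * m y₀)))) y₀ := by
  have hF := hasDerivAt_transfer h₁ h₂ hY hN hm hy₀ z
  have hFz := hasDerivAt_deriv_transfer h₁ h₂ hY hN hm hy₀ z
  have h1 := transfer_self (hN _ hy₀) 0 z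
  have hI := hasDerivAt_ring_inverse hF h1
  set X := z • Lam + (m y₀ * Lam - Lam * m y₀)
  set A := lax (N y₀) y₀ 0 z
  have h0 : deriv (transfer N y₀ y₀ 0) z = 0 := by
    have : transfer N y₀ y₀ 0 = fun _ => 1 := funext fun z => transfer_self (hN _ hy₀) 0 z
    rw [this]
    exact deriv_const z (1 : Mat)
  have key := (hFz.add (hF.mul_const A)).mul hI
  refine (key.congr_deriv ?_).congr_of_eventuallyEq ?_
  · simp only [Pi.add_apply, h0, h1, Ring.inverse_one, zero_add, one_mul, mul_one, mul_neg]
    abel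
  -- `Ring.inverse` is a true inverse only at units; `T` is one near `y₀` because it is continuous
  -- in `y` at `y₀` with value `1`.
  · have hu : ∀ᶠ y in 𝓝 y₀, IsUnit (transfer N y y₀ 0 z) := by
      refine hF.continuousAt.eventually ?_
      change ∀ᶠ A in 𝓝 (transfer N y₀ y₀ 0 z), IsUnit A
      rw [h1]
      exact Units.isOpen.mem_nhds isUnit_one
    filter_upwards [hY.mem_nhds hy₀, hu] with y hy huy
    have := lax_mul_transfer (hN _ hy₀) (hN _ hy) z
    simp only [Pi.mul_apply, Pi.add_apply]
    rw [← this, mul_assoc, Ring.mul_inverse_cancel _ huy, mul_one]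

/-- The coefficients of a polynomial of degree below `n` are fixed linear combinations of its values
at `0, …, n - 1`, by inverting the Vandermonde matrix, so they inherit differentiability from the
values. -/
theorem hasDerivAt_coeff {n : ℕ} {a : ℝ → ℕ → Mat} {b : ℕ → Mat} {y₀ : ℝ}
    (h : ∀ z : ℂ, HasDerivAt (fun y => ∑ k ∈ Finset.range n, z ^ k • a y k)
      (∑ k ∈ Finset.range n, z ^ k • b k) y₀) {k : ℕ} (hk : k < n) :
    HasDerivAt (fun y => a y k) (b k) y₀ := by
  set V : Matrix (Fin n) (Fin n) ℂ := Matrix.vandermonde fun i => ((i : ℕ) : ℂ) with hV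
  have hdet : IsUnit V.det := by
    rw [isUnit_iff_ne_zero, hV, Matrix.det_vandermonde_ne_zero_iff]
    intro i j hij
    have hij' : ((i : ℕ) : ℂ) = ((j : ℕ) : ℂ) := hij
    exact Fin.ext (by exact_mod_cast hij')
  have hinv := Matrix.nonsing_inv_mul V hdet
  have key : ∀ c : ℕ → Mat, c k = ∑ i : Fin n, V⁻¹ ⟨k, hk⟩ i •
      ∑ l ∈ Finset.range n, ((i : ℕ) : ℂ) ^ l • c l := fun c => by
    have h1 : ∀ i : Fin n, ∑ l ∈ Finset.range n, ((i : ℕ) : ℂ) ^ l • c l =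
        ∑ l : Fin n, V i l • c l := fun i => by
      rw [Finset.sum_range]
      rfl
    simp only [h1, Finset.smul_sum, smul_smul]
    rw [Finset.sum_comm]
    simp only [← Finset.sum_smul]
    have h2 : ∀ l : Fin n, ∑ i, V⁻¹ ⟨k, hk⟩ i * V i l = (1 : Matrix (Fin n) (Fin n) ℂ) ⟨k, hk⟩ l :=
      fun l => by rw [← hinv]; rfl
    simp only [h2, Matrix.one_apply, ite_smul, one_smul, zero_smul]
    simp
  have hs : HasDerivAt (fun y => ∑ i : Fin n, V⁻¹ ⟨k, hk⟩ i •
      ∑ l ∈ Finset.range n, ((i : ℕ) : ℂ) ^ l • a y l)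
      (∑ i : Fin n, V⁻¹ ⟨k, hk⟩ i • ∑ l ∈ Finset.range n, ((i : ℕ) : ℂ) ^ l • b l) y₀ :=
    HasDerivAt.fun_sum fun i _ => (h _).fun_const_smul _
  rw [← key b] at hs
  simpa only [← key] using hs

/-- The coefficients of the powers of `z` in the zero-curvature equation. As `A₄` is constant, the
`z⁴` coefficient is an algebraic relation, which will express `[m, Λ]` through `A₃`. -/
theorem exists_lax_system (h₁ : ‖r₁‖ ≤ 1) (h₂ : ‖r₂‖ ≤ 1) (hY : IsOpen Y)
    (hN : ∀ y ∈ Y, IsEntireSolution r₁ r₂ y (N y)) {m : ℝ → Mat}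
    (hm : ∀ y ∈ Y, ∃ K, HasMoment (N y) (m y) K) : ∃ a : ℝ → ℕ → Mat, ∀ y ∈ Y,
      (∀ z, lax (N y) y 0 z = ∑ k ∈ Finset.range 5, z ^ k • a y k) ∧
      a y 4 = (-9 : ℂ) • Lam ^ 2 ∧
      2 * (a y 4 * a y 0).trace + 2 * (a y 3 * a y 1).trace + (a y 2 * a y 2).trace =
        -(54 * y) ∧
      HasDerivAt (fun y => a y 0) (Lam + ((m y * Lam - Lam * m y) * a y 0 -
        a y 0 * (m y * Lam - Lam * m y))) y ∧
      (∀ k < 4, HasDerivAt (fun y => a y (k + 1)) (((m y * Lam - Lam * m y) * a y (k + 1) -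
        a y (k + 1) * (m y * Lam - Lam * m y)) + (Lam * a y k - a y k * Lam)) y) ∧
      ((m y * Lam - Lam * m y) * a y 4 - a y 4 * (m y * Lam - Lam * m y)) +
        (Lam * a y 3 - a y 3 * Lam) = 0 := by
  have hex : ∀ y, ∃ a : ℕ → Mat, y ∈ Y → (∀ z, lax (N y) y 0 z =
      ∑ k ∈ Finset.range 5, z ^ k • a k) ∧ a 4 = (-9 : ℂ) • Lam ^ 2 ∧
      2 * (a 4 * a 0).trace + 2 * (a 3 * a 1).trace + (a 2 * a 2).trace = -(54 * y) := fun y => by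
    by_cases hy : y ∈ Y
    · obtain ⟨K, δ, hδ, hK, hKδ⟩ := exists_uniform_hasMoment h₁ h₂ hN hm hy
      obtain ⟨hB, hmy⟩ := hKδ y hy (by simpa using hδ)
      obtain ⟨a, ha⟩ := (hN y hy).exists_lax_polynomial h₁ h₂ hK hB hmy
      exact ⟨a, fun _ => ha⟩
    · exact ⟨0, fun h => absurd h hy⟩
  choose a ha using hex
  refine ⟨a, fun y hy => ?_⟩
  obtain ⟨hpoly, h4, htr⟩ := ha y hy
  set U := m y * Lam - Lam * m y with hU
  set b : ℕ → Mat := fun k => match k with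
    | 0 => Lam + (U * a y 0 - a y 0 * U)
    | k + 1 => (U * a y (k + 1) - a y (k + 1) * U) + (Lam * a y k - a y k * Lam) with hb
  have hder : ∀ k < 5, HasDerivAt (fun y => a y k) (b k) y := fun k hk => by
    refine hasDerivAt_coeff (n := 5) (fun z => ?_) hk
    have h := hasDerivAt_lax h₁ h₂ hY hN hm hy z
    have hev : (fun y => ∑ k ∈ Finset.range 5, z ^ k • a y k) =ᶠ[𝓝 y] fun y => lax (N y) y 0 z := by
      filter_upwards [hY.mem_nhds hy] with y' hy'
      exact ((ha y' hy').1 z).symm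
    refine (h.congr_deriv ?_).congr_of_eventuallyEq hev
    -- The `z⁵` term must be absent for the right side to have degree four; it is, as `A₄` is a
    -- multiple of `Λ²`.
    have h4c : Lam * a y 4 - a y 4 * Lam = 0 := by
      rw [h4, mul_smul_comm, smul_mul_assoc, ← pow_succ, ← pow_succ', sub_self]
    rw [hpoly z]
    simp only [Finset.sum_range_succ, Finset.sum_range_zero, hb, zero_add]
    rw [← hU, ← sub_eq_zero]
    have e5 : (z ^ 5) • (Lam * a y 4 - a y 4 * Lam) = 0 := by rw [h4c, smul_zero]
    rw [← e5]
    simp only [add_mul, mul_add, mul_smul_comm, smul_mul_assoc]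
    module
  have h4' : b 4 = 0 := by
    refine (hder 4 (by norm_num)).unique ?_
    refine (hasDerivAt_const y ((-9 : ℂ) • Lam ^ 2)).congr_of_eventuallyEq ?_
    filter_upwards [hY.mem_nhds hy] with y' hy'
    exact (ha y' hy').2.1
  exact ⟨hpoly, h4, htr, hder 0 (by norm_num), fun k hk => hder (k + 1) (by omega), h4'⟩

end Compatibility

open scoped Matrix.Norms.Operator

/-! ### Uniqueness and symmetries -/

section Symmetry

variable {r₁ r₂ : ℂ} {y : ℝ} {M M' : ℤ → ℂ → Mat}

/-- The quotient `M' M⁻¹` has no jumps and tends to `1`. Every symmetry of the jumps thereby becomes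
a symmetry of the solution. -/
theorem IsEntireSolution.unique (h₁ : ‖r₁‖ ≤ 1) (h₂ : ‖r₂‖ ≤ 1)
    (hM : IsEntireSolution r₁ r₂ y M) (hM' : IsEntireSolution r₁ r₂ y M') (n : ℤ) (z : ℂ) :
    M' n z = M n z := by
  obtain ⟨B, -, hB⟩ := hM.exists_sectorBound
  obtain ⟨B', -, hB'⟩ := hM'.exists_sectorBound
  have hs := ratio_isSectorial h₁ h₂ hM hM' hB (S := B' * B)
    (fun n z hz => norm_mul_le_of_le (hB' n z hz).1 (hB n z hz).2) (by simp)
  have key := eq_of_tendsto_sector (g := fun n z => M' n z * (M n z).adjugate) (c := 1)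
    (fun n => (hM'.differentiable n).mul (differentiable_adjugate (hM.differentiable n)))
    (fun n z => by
      have h : PainleveModel.jump r₁ r₂ (rayIdx n) y z * (PainleveModel.jump r₁ r₂ (rayIdx n) y z).adjugate = 1 := by
        rw [Matrix.mul_adjugate, det_jump, one_smul]
      rw [hM.jump, hM'.jump, Matrix.adjugate_mul_distrib]
      calc _ = M' (n - 1) z * (PainleveModel.jump r₁ r₂ (rayIdx n) y z * (PainleveModel.jump r₁ r₂ (rayIdx n) y z).adjugate) *
            (M (n - 1) z).adjugate := by simp only [mul_assoc]
        _ = _ := by rw [h, mul_one]) hs.tendsto_zero n z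
  rw [← ratio_mul hM (M' := M'), key, one_mul]

theorem differentiable_submatrix {f : ℂ → Mat} (h : Differentiable ℂ f) (e : Fin 3 → Fin 3) :
    Differentiable ℂ fun z => (f z).submatrix e e :=
  differentiable_of_apply fun i j => differentiable_apply h (e i) (e j)

theorem norm_submatrix_le (A : Mat) (e : Fin 3 → Fin 3) : ‖A.submatrix e e‖ ≤ 3 * ‖A‖ :=
  norm_le_of_apply_le fun i j => norm_apply_le A (e i) (e j)

theorem norm_transpose_le (A : Mat) : ‖Aᵀ‖ ≤ 3 * ‖A‖ :=
  norm_le_of_apply_le fun i j => norm_apply_le A j i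

theorem rayAngle_add_four (n : ℤ) : rayAngle (n + 4) = rayAngle n + 2 * Real.pi / 3 := by
  unfold rayAngle; push_cast; ring

theorem rayAngle_add_six (n : ℤ) : rayAngle (n + 6) = rayAngle n + Real.pi := by
  unfold rayAngle; push_cast; ring

theorem rayAngle_reflect (n : ℤ) : rayAngle (-1 - n) = -rayAngle n := by
  unfold rayAngle; push_cast; ring

theorem om_mul_exp (x φ : ℝ) :
    om * Complex.exp (x + φ * I) = Complex.exp (x + (φ + 2 * Real.pi / 3 : ℝ) * I) := by
  rw [om_eq_exp, ← Complex.exp_add]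
  congr 1; push_cast; ring

theorem neg_exp_polar (x φ : ℝ) :
    -Complex.exp (x + φ * I) = Complex.exp (x + (φ + Real.pi : ℝ) * I) := by
  push_cast
  rw [add_mul, ← add_assoc, Complex.exp_add (_ + _), Complex.exp_pi_mul_I]; ring

theorem conj_exp_polar (x φ : ℝ) :
    conj (Complex.exp (x + φ * I)) = Complex.exp (x + (-φ : ℝ) * I) := by
  rw [← Complex.exp_conj]
  simp

theorem om_mul_mem_sector {n : ℤ} {z : ℂ} (h : z ∈ sector n) : om * z ∈ sector (n + 4) := by
  obtain ⟨x, φ, hφ, rfl⟩ := h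
  rw [om_mul_exp]
  refine mem_sector ⟨?_, ?_⟩
  · rw [rayAngle_add_four]; linarith [hφ.1]
  · rw [add_right_comm, rayAngle_add_four]; linarith [hφ.2]

theorem neg_mem_sector {n : ℤ} {z : ℂ} (h : z ∈ sector n) : -z ∈ sector (n + 6) := by
  obtain ⟨x, φ, hφ, rfl⟩ := h
  rw [neg_exp_polar]
  refine mem_sector ⟨?_, ?_⟩
  · rw [rayAngle_add_six]; linarith [hφ.1]
  · rw [add_right_comm, rayAngle_add_six]; linarith [hφ.2]

theorem conj_mem_sector {n : ℤ} {z : ℂ} (h : z ∈ sector n) : conj z ∈ sector (-2 - n) := by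
  obtain ⟨x, φ, hφ, rfl⟩ := h
  rw [conj_exp_polar]
  refine mem_sector ⟨?_, ?_⟩
  · rw [show -2 - n = -1 - (n + 1) by ring, rayAngle_reflect]; linarith [hφ.2]
  · rw [show -2 - n + 1 = -1 - n by ring, rayAngle_reflect]; linarith [hφ.1]

/-- A form of the normalization at infinity in terms of `‖z‖`. -/
theorem tendsto_one_iff : (∀ ε > 0, ∀ᶠ x : ℝ in atTop, ∀ n,
      ∀ φ ∈ Icc (rayAngle n) (rayAngle (n + 1)), ‖M n (Complex.exp (x + φ * I)) - 1‖ ≤ ε) ↔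
    ∀ ε > 0, ∃ R : ℝ, ∀ n, ∀ z ∈ sector n, R ≤ ‖z‖ → ‖M n z - 1‖ ≤ ε := by
  constructor
  · intro h ε hε
    obtain ⟨X, hX⟩ := eventually_atTop.mp (h ε hε)
    refine ⟨Real.exp X, fun n z hz hR => ?_⟩
    obtain ⟨x, φ, hφ, rfl⟩ := hz
    rw [norm_exp_add_mul_I] at hR
    exact hX x (Real.exp_le_exp.mp hR) n φ hφ
  · intro h ε hε
    obtain ⟨R, hR⟩ := h ε hε
    filter_upwards [Real.tendsto_exp_atTop.eventually_ge_atTop R] with x hx n φ hφ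
    exact hR n _ (mem_sector hφ) (by rwa [norm_exp_add_mul_I])

/-- The cyclic shift of the indices. -/
def shift : Fin 3 ≃ Fin 3 := Equiv.addRight 2

theorem om_mul_lam_shift (i : Fin 3) : om * lam (shift i) = lam i := by
  have h := om_cube
  fin_cases i
  · change om * 1 = om
    ring
  · change om * om = om ^ 2
    ring
  · change om * om ^ 2 = 1
    linear_combination h

theorem phase_rotate (y : ℝ) (z : ℂ) (i : Fin 3) : phase y (om * z) (shift i) = phase y z i := by
  have h := om_cube
  unfold phase
  rw [← om_mul_lam_shift i]
  linear_combination (-(9 * z ^ 5 / 5 * om ^ 2 * lam (shift i) ^ 2)) * h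

theorem jumpConst_rotate (r₁ r₂ : ℂ) (n : ℤ) :
    (jumpConst r₁ r₂ (rayIdx (n + 4))).submatrix shift shift = jumpConst r₁ r₂ (rayIdx n) := by
  obtain ⟨m, hm⟩ := map_mod_twelve (g := fun n : ℤ => (rayIdx (n + 4), rayIdx n)) (fun n => by
    rw [add_right_comm, rayIdx_add_twelve, rayIdx_add_twelve]) n
  obtain ⟨e1, e2⟩ := Prod.mk.inj hm
  rw [e1, e2]
  fin_cases m <;>
  · ext i j
    fin_cases i <;> fin_cases j <;> rfl

theorem expDiag_submatrix (f : Fin 3 → ℂ) :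
    (expDiag f).submatrix shift shift = expDiag (f ∘ shift) :=
  Matrix.submatrix_diagonal_equiv _ shift

theorem submatrix_mul_shift (A B : Mat) :
    (A * B).submatrix shift shift = A.submatrix shift shift * B.submatrix shift shift :=
  (Matrix.submatrix_mul_equiv A B shift shift shift).symm

/-- Multiplication by `ω` moves four rays ahead and permutes the eigenvalues of `Λ` cyclically;
relabelling the indices restores both the phases and the jumps. -/
theorem IsEntireSolution.rotate (hM : IsEntireSolution r₁ r₂ y M) :
    IsEntireSolution r₁ r₂ y fun n z => (M (n + 4) (om * z)).submatrix shift shift := by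
  have hp1 : ∀ z, phase y (om * z) ∘ shift = phase y z := fun z =>
    funext fun i => phase_rotate y z i
  have hp2 : ∀ z, (-phase y (om * z)) ∘ shift = -phase y z := fun z =>
    funext fun i => congrArg Neg.neg (phase_rotate y z i)
  refine ⟨fun n => ?_, fun n => ?_, fun n z => ?_, (tendsto_one_iff
    (M := fun n z => (M (n + 4) (om * z)).submatrix shift shift)).mpr fun ε hε => ?_⟩
  · have h : Differentiable ℂ fun z => M (n + 4) (om * z) :=
      (hM.differentiable (n + 4)).comp (differentiable_id.const_mul om)
    exact differentiable_submatrix h shift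
  · rw [add_right_comm, hM.periodic]
  · rw [hM.jump, submatrix_mul_shift, add_sub_right_comm]
    congr 1
    rw [jump_eq, submatrix_mul_shift, submatrix_mul_shift, jumpConst_rotate, expDiag_submatrix,
      expDiag_submatrix, hp1, hp2, jump_eq]
  · obtain ⟨R, hR⟩ := tendsto_one_iff.mp hM.tendsto_one (ε / 3) (by positivity)
    refine ⟨R, fun n z hz hzR => ?_⟩
    have h := hR _ _ (om_mul_mem_sector hz) (by
      rw [norm_mul, om_eq_exp, Complex.norm_exp_ofReal_mul_I, one_mul]; exact hzR)
    have e : (M (n + 4) (om * z)).submatrix shift shift - 1 =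
        (M (n + 4) (om * z) - 1).submatrix shift shift := by
      rw [Matrix.submatrix_sub, Pi.sub_apply, Pi.sub_apply, Matrix.submatrix_one_equiv]
    rw [e]
    exact (norm_submatrix_le _ _).trans (by linarith)

theorem Lam_mul_Lam_sq : Lam * Lam ^ 2 = 1 := by rw [← pow_succ', Lam_pow_three]

theorem Lam_sq_mul_Lam : Lam ^ 2 * Lam = 1 := by rw [← pow_succ, Lam_pow_three]

/-- Opposite rays carry their entry at transposed positions. Inversion and transposition match the
positions, and conjugation by `Λ` produces the power of `ω` that `r₁ = ω² r₂` compensates. This is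
the only symmetry that needs this relation. -/
theorem jumpConst_transpose {r₁ r₂ : ℂ} (h : r₁ = om ^ 2 * r₂) (n : ℤ) :
    Lam * (jumpConst r₁ r₂ (rayIdx (n + 6))).adjugateᵀ * Lam ^ 2 = jumpConst r₁ r₂ (rayIdx n) := by
  obtain ⟨m, hm⟩ := map_mod_twelve (g := fun n : ℤ => (rayIdx (n + 6), rayIdx n)) (fun n => by
    rw [add_right_comm, rayIdx_add_twelve, rayIdx_add_twelve]) n
  obtain ⟨e1, e2⟩ := Prod.mk.inj hm
  rw [e1, e2]
  have hc := om_cube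
  have h' : conj r₁ = om * conj r₂ := by
    rw [h, map_mul, map_pow, conj_om]
    linear_combination om * conj r₂ * hc
  have key : ∀ i j, lam i * (jumpConst r₁ r₂ (m + 6)).adjugate j i *
      (![om ^ 2, om, 1] : Fin 3 → ℂ) j = jumpConst r₁ r₂ m i j := by
    have h1 : om * om ^ 2 = 1 := by linear_combination hc
    have h2 : om ^ 2 * om = 1 := by linear_combination hc
    fin_cases m <;> intro i j <;> fin_cases i <;> fin_cases j <;>
      simp [jumpConst, lam, Matrix.adjugate_fin_three, h1, h2] <;> (try rw [h']) <;>
      (try rw [h]) <;> first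
        | ring1
        | linear_combination r₂ * hc
        | linear_combination conj r₂ * hc
        | linear_combination (r₂ * (om ^ 3 + 1)) * hc
        | linear_combination (om * conj r₂) * hc
  have hL : Lam ^ 2 = Matrix.diagonal ![om ^ 2, om, 1] := by
    rw [Lam, Matrix.diagonal_pow]
    congr 1
    funext i
    fin_cases i
    · rfl
    · change (om ^ 2) ^ 2 = om
      linear_combination om * hc
    · exact one_pow 2
  have e3 : rayIdx ((m : ℕ) + 6) = m + 6 := by fin_cases m <;> rfl
  have e4 : rayIdx (m : ℕ) = m := by fin_cases m <;> rfl
  rw [e3, e4, hL]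
  ext i j
  rw [Matrix.mul_diagonal, Lam, Matrix.diagonal_mul, Matrix.transpose_apply]
  exact key i j

end Symmetry

open scoped Matrix.Norms.Operator

section Symmetry

variable {r₁ r₂ : ℂ} {y : ℝ} {M : ℤ → ℂ → Mat}

theorem adjugate_jump (n : Fin 12) (z : ℂ) : (jump r₁ r₂ n y z).adjugate =
    expDiag (phase y z) * (jumpConst r₁ r₂ n).adjugate * expDiag (-phase y z) := by
  set X := expDiag (phase y z) * (jumpConst r₁ r₂ n).adjugate * expDiag (-phase y z)
  have h1 : jump r₁ r₂ n y z * X = 1 := by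
    rw [jump_eq]
    calc _ = expDiag (phase y z) * (jumpConst r₁ r₂ n * ((expDiag (-phase y z) *
          expDiag (phase y z)) * (jumpConst r₁ r₂ n).adjugate)) * expDiag (-phase y z) := by
          simp only [X, mul_assoc]
      _ = _ := by
        rw [expDiag_neg_mul, one_mul, Matrix.mul_adjugate, det_jumpConst, one_smul, mul_one,
          expDiag_mul_neg]
  calc _ = (jump r₁ r₂ n y z).adjugate * (jump r₁ r₂ n y z * X) := by rw [h1, mul_one]
    _ = X := by rw [← mul_assoc, Matrix.adjugate_mul, det_jump, one_smul, one_mul]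

theorem phase_neg (y : ℝ) (z : ℂ) : phase y (-z) = -phase y z := by
  funext i; simp only [phase, Pi.neg_apply]; ring

theorem expDiag_transpose (f : Fin 3 → ℂ) : (expDiag f)ᵀ = expDiag f :=
  Matrix.diagonal_transpose _

theorem Lam_mul_expDiag (f : Fin 3 → ℂ) : Lam * expDiag f = expDiag f * Lam := by
  rw [Lam, expDiag, Matrix.diagonal_mul_diagonal, Matrix.diagonal_mul_diagonal]
  congr 1; funext i; ring

theorem expDiag_mul_Lam_sq (f : Fin 3 → ℂ) : expDiag f * Lam ^ 2 = Lam ^ 2 * expDiag f := by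
  rw [sq, ← mul_assoc, ← Lam_mul_expDiag, mul_assoc, ← Lam_mul_expDiag, mul_assoc]

theorem jump_transpose (h : r₁ = om ^ 2 * r₂) (n : ℤ) (z : ℂ) :
    Lam * (jump r₁ r₂ (rayIdx (n + 6)) y (-z)).adjugateᵀ * Lam ^ 2 =
      jump r₁ r₂ (rayIdx n) y z := by
  rw [adjugate_jump, phase_neg, neg_neg, Matrix.transpose_mul, Matrix.transpose_mul,
    expDiag_transpose, expDiag_transpose, jump_eq, ← jumpConst_transpose h n]
  simp only [← mul_assoc]
  rw [Lam_mul_expDiag]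
  simp only [mul_assoc]
  rw [expDiag_mul_Lam_sq]

/-- The phase is odd in `z`, so the inverse transpose at `-z` carries the same exponentials as the
solution at `z`. -/
theorem IsEntireSolution.transpose (h : r₁ = om ^ 2 * r₂) (hM : IsEntireSolution r₁ r₂ y M) :
    IsEntireSolution r₁ r₂ y fun n z => Lam * (M (n + 6) (-z)).adjugateᵀ * Lam ^ 2 := by
  obtain ⟨B, hB1, hB⟩ := hM.exists_sectorBound
  refine ⟨fun n => ?_, fun n => ?_, fun n z => ?_, (tendsto_one_iff
    (M := fun n z => Lam * (M (n + 6) (-z)).adjugateᵀ * Lam ^ 2)).mpr fun ε hε => ?_⟩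
  · have h1 : Differentiable ℂ fun z => (M (n + 6) (-z)).adjugate :=
      (differentiable_adjugate (hM.differentiable (n + 6))).comp differentiable_neg
    have h2 : Differentiable ℂ fun z => (M (n + 6) (-z)).adjugateᵀ :=
      differentiable_of_apply fun i j => differentiable_apply h1 j i
    exact (h2.const_mul Lam).mul_const (Lam ^ 2)
  · rw [add_right_comm, hM.periodic]
  · rw [hM.jump, Matrix.adjugate_mul_distrib, Matrix.transpose_mul, ← jump_transpose h n z,
      add_sub_right_comm]
    generalize (M (n - 1 + 6) (-z)).adjugateᵀ = A
    generalize (PainleveModel.jump r₁ r₂ (rayIdx (n + 6)) y (-z)).adjugateᵀ = B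
    calc _ = Lam * A * (1 * B) * Lam ^ 2 := by simp only [mul_assoc, one_mul]
      _ = _ := by rw [← Lam_sq_mul_Lam]; simp only [mul_assoc]
  · obtain ⟨R, hR⟩ := tendsto_one_iff.mp hM.tendsto_one (ε / (3 * B)) (by positivity)
    refine ⟨R, fun n z hz hzR => ?_⟩
    have hz' := neg_mem_sector hz
    have h1 := hR _ _ hz' (by rwa [norm_neg])
    have h2 := (hB _ _ hz').2
    have h3 := hM.adjugate_mul (n + 6) (-z)
    set P := M (n + 6) (-z)
    have h4 : ‖P.adjugate - 1‖ ≤ B * (ε / (3 * B)) := by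
      have e : P.adjugate - 1 = -(P.adjugate * (P - 1)) := by
        rw [mul_sub, h3, mul_one]; abel
      rw [e, norm_neg]
      exact norm_mul_le_of_le h2 h1
    have e : Lam * P.adjugateᵀ * Lam ^ 2 - 1 = Lam * (P.adjugate - 1)ᵀ * Lam ^ 2 := by
      rw [Matrix.transpose_sub, Matrix.transpose_one, mul_sub, sub_mul, mul_one, Lam_mul_Lam_sq]
    have hL2 : ‖Lam ^ 2‖ ≤ 1 := by
      rw [sq]; exact (norm_mul_le_of_le norm_Lam_le norm_Lam_le).trans (by norm_num)
    rw [e]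
    refine (norm_mul_le_of_le (norm_mul_le_of_le norm_Lam_le
      ((norm_transpose_le _).trans (mul_le_mul_of_nonneg_left h4 (by norm_num)))) hL2).trans ?_
    have : B ≠ 0 := by linarith
    refine le_of_eq ?_
    field_simp

/-- The permutation of the indices that corresponds to complex conjugation. -/
def flip : Fin 3 ≃ Fin 3 := Equiv.swap 0 1

/-- The conjugate of a matrix, with the first two indices exchanged. -/
noncomputable def conjFlip (A : Mat) : Mat := (A.map conj).submatrix flip flip

theorem conjFlip_mul (A B : Mat) : conjFlip (A * B) = conjFlip A * conjFlip B := by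
  rw [conjFlip, Matrix.map_mul, conjFlip, conjFlip, Matrix.submatrix_mul_equiv]

theorem conj_lam_flip (i : Fin 3) : conj (lam (flip i)) = lam i := by
  have hc := om_cube
  fin_cases i
  · change conj (om ^ 2) = om
    rw [map_pow, conj_om]
    linear_combination om * hc
  · change conj om = om ^ 2
    exact conj_om
  · change conj (1 : ℂ) = 1
    exact map_one _

theorem conjFlip_expDiag (f : Fin 3 → ℂ) :
    conjFlip (expDiag f) = expDiag fun i => conj (f (flip i)) := by
  rw [conjFlip, expDiag, Matrix.diagonal_map (map_zero _)]
  refine (Matrix.submatrix_diagonal_equiv _ flip).trans ?_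
  rw [expDiag]
  congr 1
  funext i
  exact (Complex.exp_conj _).symm

theorem conj_phase_flip (y : ℝ) (z : ℂ) (i : Fin 3) :
    conj (phase y (conj z) (flip i)) = phase y z i := by
  rw [phase, phase, ← conj_lam_flip i]
  simp only [map_sub, map_mul, map_div₀, map_pow, Complex.conj_conj, Complex.conj_ofReal,
    map_ofNat]

/-- Reflection in the real axis interchanges the two sides of an outward ray, which is why the
inverse of the reflected jump appears. Conjugation also exchanges `ω` and `ω²`, undone by `flip`. -/
theorem jumpConst_conj (r₁ r₂ : ℂ) (n : ℤ) :
    conjFlip (jumpConst r₁ r₂ (rayIdx (-1 - n))) * jumpConst r₁ r₂ (rayIdx n) = 1 := by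
  obtain ⟨m, hm⟩ := map_mod_twelve (g := fun n : ℤ => (rayIdx (-1 - n), rayIdx n)) (fun n => by
    rw [rayIdx_add_twelve, ← rayIdx_add_twelve (-1 - (n + 12))]
    rw [show (-1 - (n + 12) + 12 : ℤ) = -1 - n by ring]) n
  obtain ⟨e1, e2⟩ := Prod.mk.inj hm
  have e3 : rayIdx (-1 - (m : ℕ)) = -1 - m := by fin_cases m <;> rfl
  have e4 : rayIdx (m : ℕ) = m := by fin_cases m <;> rfl
  rw [e1, e2, e3, e4]
  have hs : ∀ (i j : Fin 3) (c : ℂ), conjFlip (1 + Matrix.single i j c) =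
      1 + Matrix.single (flip i) (flip j) (conj c) := fun i j c => by
    ext a b
    simp only [conjFlip, Matrix.submatrix_apply, Matrix.map_apply, Matrix.add_apply, map_add,
      Matrix.single_apply, Matrix.one_apply, flip.injective.eq_iff, apply_ite conj, map_one,
      map_zero]
    have : ∀ a b : Fin 3, a = flip b ↔ flip a = b := by decide
    simp only [this]
  have hmul : ∀ (i j i' j' : Fin 3) (c c' : ℂ), i ≠ j → i' = i → j' = j → c' = -c →
      ((1 : Mat) + Matrix.single i' j' c') * (1 + Matrix.single i j c) = 1 := by
    rintro _ _ i' j' c _ hij rfl rfl rfl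
    have h0 : Matrix.single i' j' (-c) * Matrix.single i' j' c = 0 := by
      rw [Matrix.single_mul_single_of_ne]
      exact hij.symm
    rw [mul_add, mul_one, add_mul, h0, one_mul, add_zero, add_assoc, ← Matrix.single_add]
    simp
  rw [jumpConst_eq, jumpConst_eq, hs]
  refine hmul _ _ _ _ _ _ (by clear * -; revert m; decide) (by clear * -; revert m; decide)
    (by clear * -; revert m; decide) ?_
  fin_cases m
  all_goals first
    | (change conj (conj r₁) = -(-r₁); rw [conj_conj, neg_neg])
    | (change conj r₂ = -(-conj r₂); rw [neg_neg])
    | (change conj (-conj r₂) = -r₂; rw [map_neg, conj_conj])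
    | (change conj (-r₁) = -conj r₁; rw [map_neg])

theorem conjFlip_one : conjFlip 1 = 1 := by
  rw [conjFlip, Matrix.map_one _ (map_zero _) (map_one _), Matrix.submatrix_one_equiv]

theorem conjFlip_sub (A B : Mat) : conjFlip (A - B) = conjFlip A - conjFlip B := by
  ext i j
  exact map_sub conj _ _

theorem norm_conjFlip_le (A : Mat) : ‖conjFlip A‖ ≤ 3 * ‖A‖ :=
  norm_le_of_apply_le fun i j => by
    change ‖conj (A (flip i) (flip j))‖ ≤ _
    rw [Complex.norm_conj]
    exact norm_apply_le A _ _

theorem conjFlip_jump (n : ℤ) (z : ℂ) :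
    conjFlip (jump r₁ r₂ (rayIdx (-1 - n)) y (conj z)) * jump r₁ r₂ (rayIdx n) y z = 1 := by
  have h1 : conjFlip (expDiag (phase y (conj z))) = expDiag (phase y z) := by
    rw [conjFlip_expDiag]; congr 1; funext i; exact conj_phase_flip y z i
  have h2 : conjFlip (expDiag (-phase y (conj z))) = expDiag (-phase y z) := by
    rw [conjFlip_expDiag]; congr 1; funext i
    simp only [Pi.neg_apply, map_neg, conj_phase_flip]
  rw [jump_eq, conjFlip_mul, conjFlip_mul, h1, h2, jump_eq]
  calc _ = expDiag (phase y z) * (conjFlip (jumpConst r₁ r₂ (rayIdx (-1 - n))) *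
        ((expDiag (-phase y z) * expDiag (phase y z)) * jumpConst r₁ r₂ (rayIdx n))) *
        expDiag (-phase y z) := by simp only [mul_assoc]
    _ = _ := by rw [expDiag_neg_mul, one_mul, jumpConst_conj, mul_one, expDiag_mul_neg]

theorem IsEntireSolution.conj (hM : IsEntireSolution r₁ r₂ y M) :
    IsEntireSolution r₁ r₂ y fun n z => conjFlip (M (-2 - n) (conj z)) := by
  refine ⟨fun n => differentiable_of_apply fun i j z => ?_, fun n => ?_, fun n z => ?_,
    (tendsto_one_iff (M := fun n z => conjFlip (M (-2 - n) (starRingEnd ℂ z)))).mpr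
      fun ε hε => ?_⟩
  · have h := (differentiable_apply (hM.differentiable (-2 - n)) (flip i) (flip j)
      (starRingEnd ℂ z)).conj_conj
    rwa [Complex.conj_conj] at h
  · rw [← hM.periodic (-2 - (n + 12)), show (-2 - (n + 12) + 12 : ℤ) = -2 - n by ring]
  · have h1 := hM.jump (-1 - n) (starRingEnd ℂ z)
    rw [show (-1 - n - 1 : ℤ) = -2 - n by ring] at h1
    rw [show (-2 - (n - 1) : ℤ) = -1 - n by ring, h1, conjFlip_mul, mul_assoc, conjFlip_jump,
      mul_one]
  · obtain ⟨R, hR⟩ := tendsto_one_iff.mp hM.tendsto_one (ε / 3) (by positivity)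
    refine ⟨R, fun n z hz hzR => ?_⟩
    have h := hR _ _ (conj_mem_sector hz) (by rwa [Complex.norm_conj])
    rw [← conjFlip_one, ← conjFlip_sub]
    exact (norm_conjFlip_le _).trans (by linarith)

/-! ### Symmetries of the coefficients -/

theorem HasMoment.rotate {m : Mat} {K : ℝ} (hm : HasMoment M m K) :
    HasMoment (fun n z => (M (n + 4) (om * z)).submatrix shift shift)
      (om ^ 2 • m.submatrix shift shift) (3 * K) := fun n z hz => by
  have h := hm _ _ (om_mul_mem_sector hz)
  have hc := om_cube
  have hn : ‖om * z‖ = ‖z‖ := by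
    rw [norm_mul, om_eq_exp, Complex.norm_exp_ofReal_mul_I, one_mul]
  have hi : (om * z)⁻¹ = z⁻¹ * om ^ 2 := by
    rw [mul_inv, inv_eq_of_mul_eq_one_right (b := om ^ 2) (by linear_combination hc), mul_comm]
  rw [hn, hi] at h
  have e : (M (n + 4) (om * z)).submatrix shift shift - 1 - z⁻¹ • om ^ 2 • m.submatrix shift shift =
      (M (n + 4) (om * z) - 1 - (z⁻¹ * om ^ 2) • m).submatrix shift shift := by
    ext i j
    simp only [Matrix.submatrix_apply, Matrix.sub_apply, Matrix.smul_apply, smul_smul,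
      Matrix.one_apply, shift.injective.eq_iff]
  rw [e]
  exact (norm_submatrix_le _ _).trans (by linarith)

theorem HasMoment.conj {m : Mat} {K : ℝ} (hm : HasMoment M m K) :
    HasMoment (fun n z => conjFlip (M (-2 - n) (starRingEnd ℂ z))) (conjFlip m) (3 * K) :=
  fun n z hz => by
    have h := hm _ _ (conj_mem_sector hz)
    rw [Complex.norm_conj] at h
    have e : conjFlip (M (-2 - n) (starRingEnd ℂ z)) - 1 - z⁻¹ • conjFlip m =
        conjFlip (M (-2 - n) (starRingEnd ℂ z) - 1 - (starRingEnd ℂ z)⁻¹ • m) := by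
      rw [conjFlip_sub, conjFlip_sub, conjFlip_one]
      congr 1
      ext i j
      simp only [conjFlip, Matrix.submatrix_apply, Matrix.map_apply, Matrix.smul_apply,
        smul_eq_mul, map_mul, map_inv₀, Complex.conj_conj]
    rw [e]
    exact (norm_conjFlip_le _).trans (by linarith)

theorem HasMoment.transpose {m : Mat} {K : ℝ} (hM : IsEntireSolution r₁ r₂ y M) (hK : 1 ≤ K)
    (hB : SectorBound M K) (hm : HasMoment M m K) :
    HasMoment (fun n z => Lam * (M (n + 6) (-z)).adjugateᵀ * Lam ^ 2)
      (Lam * mᵀ * Lam ^ 2) (39 * K ^ 3) := fun n z hz => by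
  have hz' := neg_mem_sector hz
  have hadj : ‖(M (n + 6) (-z)).adjugate - 1 + (-z)⁻¹ • m‖ ≤ 13 * K ^ 3 * ‖z‖⁻¹ ^ 2 := by
    rw [← norm_neg z]
    -- The expansion of the inverse is available for `|z| ≥ 1`. For smaller `|z|` the claimed error
    -- `|z|⁻²` already exceeds every term.
    rcases le_total 1 ‖-z‖ with h1 | h1
    · exact hm.adjugate hB hK hM.adjugate_mul hz' h1
    · have hz0 := norm_pos_iff.mpr (ne_zero_of_mem_sector hz')
      set t := ‖-z‖⁻¹ with ht
      have ht1 : 1 ≤ t := (one_le_inv₀ hz0).mpr h1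
      have h2 : ‖(-z)⁻¹ • m‖ ≤ t * (3 * K) := by
        rw [norm_smul, norm_inv, ← ht]
        gcongr
        exact hm.norm_le hB hK
      refine (norm_add_le_of_le (norm_sub_le_of_le (hB _ _ hz').2 norm_one.le) h2).trans ?_
      have h3 : K ≤ K ^ 3 := le_self_pow₀ hK (by norm_num)
      have h4 : t ≤ t ^ 2 := le_self_pow₀ ht1 (by norm_num)
      have h5 : K * t ^ 2 ≤ K ^ 3 * t ^ 2 := by gcongr
      have h6 : K * t ≤ K * t ^ 2 := by gcongr
      nlinarith
  have e : Lam * (M (n + 6) (-z)).adjugateᵀ * Lam ^ 2 - 1 - z⁻¹ • (Lam * mᵀ * Lam ^ 2) =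
      Lam * ((M (n + 6) (-z)).adjugate - 1 + (-z)⁻¹ • m)ᵀ * Lam ^ 2 := by
    rw [Matrix.transpose_add, Matrix.transpose_sub, Matrix.transpose_smul, Matrix.transpose_one,
      inv_neg, mul_add, add_mul, mul_sub, sub_mul, mul_one, Lam_mul_Lam_sq, mul_smul_comm,
      smul_mul_assoc, neg_smul]
    abel
  have hL2 : ‖Lam ^ 2‖ ≤ 1 := by
    rw [sq]; exact (norm_mul_le_of_le norm_Lam_le norm_Lam_le).trans (by norm_num)
  rw [e]
  refine (norm_mul_le_of_le (norm_mul_le_of_le norm_Lam_le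
    ((norm_transpose_le _).trans (mul_le_mul_of_nonneg_left hadj (by norm_num)))) hL2).trans ?_
  linarith

theorem moment_symmetries (h₁ : ‖r₁‖ ≤ 1) (h₂ : ‖r₂‖ ≤ 1) (h : r₁ = om ^ 2 * r₂)
    (hM : IsEntireSolution r₁ r₂ y M) {m : Mat} {K : ℝ} (hK : 1 ≤ K) (hB : SectorBound M K)
    (hm : HasMoment M m K) :
    m = om ^ 2 • m.submatrix shift shift ∧ m = Lam * mᵀ * Lam ^ 2 ∧ m = conjFlip m := by
  have hu : ∀ {M'}, IsEntireSolution r₁ r₂ y M' → M' = M := fun hM' =>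
    funext fun n => funext fun z => hM.unique h₁ h₂ hM' n z
  have e1 := hm.rotate
  have e2 := hm.transpose hM hK hB
  have e3 := hm.conj
  rw [hu hM.rotate] at e1
  rw [hu (hM.transpose h)] at e2
  rw [hu hM.conj] at e3
  exact ⟨hm.eq e1, hm.eq e2, hm.eq e3⟩

end Symmetry

/-! ### Symmetries of the Lax matrix -/

open scoped Matrix.Norms.Operator

section LaxSymmetry

variable {r₁ r₂ : ℂ} {y : ℝ} {M : ℤ → ℂ → Mat}

theorem hasDerivAt_submatrix {f : ℂ → Mat} {f' : Mat} {z : ℂ} (h : HasDerivAt f f' z)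
    (e : Fin 3 → Fin 3) : HasDerivAt (fun z => (f z).submatrix e e) (f'.submatrix e e) z :=
  hasDerivAt_mat fun i j => hasDerivAt_pi.mp (hasDerivAt_pi.mp h (e i)) (e j)

theorem hasDerivAt_transpose {f : ℂ → Mat} {f' : Mat} {z : ℂ} (h : HasDerivAt f f' z) :
    HasDerivAt (fun z => (f z)ᵀ) f'ᵀ z :=
  hasDerivAt_mat fun i j => hasDerivAt_pi.mp (hasDerivAt_pi.mp h j) i

theorem IsEntireSolution.lax_rotate (h₁ : ‖r₁‖ ≤ 1) (h₂ : ‖r₂‖ ≤ 1)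
    (hM : IsEntireSolution r₁ r₂ y M) (z : ℂ) :
    lax M y 0 z = om • (lax M y 0 (om * z)).submatrix shift shift := by
  have hw : sectorWave M y 0 = fun z => (sectorWave M y 4 (om * z)).submatrix shift shift := by
    funext z
    rw [sectorWave, sectorWave, submatrix_mul_shift, expDiag_submatrix]
    have h1 := hM.unique h₁ h₂ hM.rotate 0 z
    rw [zero_add] at h1
    rw [h1]
    congr 2
    exact funext fun i => (phase_rotate y z i).symm
  have h1 := hM.hasDerivAt_sectorWave 0 z
  have h2 : HasDerivAt (fun z => sectorWave M y 4 (om * z))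
      (om • (lax M y 4 (om * z) * sectorWave M y 4 (om * z))) z :=
    HasDerivAt.scomp z (hM.hasDerivAt_sectorWave 4 (om * z))
      (by simpa using (hasDerivAt_id z).const_mul om)
  have h3 : HasDerivAt (sectorWave M y 0)
      ((om • (lax M y 4 (om * z)).submatrix shift shift) * sectorWave M y 0 z) z := by
    rw [hw]
    refine (hasDerivAt_submatrix h2 shift).congr_deriv ?_
    rw [smul_mul_assoc, ← submatrix_mul_shift]
    rfl
  rw [← hM.lax_eq 4 (om * z)]
  exact hM.mul_sectorWave_cancel (h1.unique h3)

/-- The transposition symmetry says that `Ψ(-z)ᵀ Λ² Ψ(z)` is the constant `Λ²`; differentiating this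
in `z` and cancelling the wave functions gives the claim. -/
theorem IsEntireSolution.lax_transpose (h₁ : ‖r₁‖ ≤ 1) (h₂ : ‖r₂‖ ≤ 1) (h : r₁ = om ^ 2 * r₂)
    (hM : IsEntireSolution r₁ r₂ y M) (z : ℂ) :
    lax M y 0 z = Lam * (lax M y 0 (-z))ᵀ * Lam ^ 2 := by
  have hw : ∀ z, (sectorWave M y 6 (-z))ᵀ * Lam ^ 2 * sectorWave M y 0 z = Lam ^ 2 := fun z => by
    have h1 := hM.unique h₁ h₂ (hM.transpose h) 0 z
    rw [zero_add] at h1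
    have h2 := hM.adjugate_mul 6 (-z)
    have h3 : (M 6 (-z))ᵀ * (M 6 (-z)).adjugateᵀ = 1 := by
      rw [← Matrix.transpose_mul, h2, Matrix.transpose_one]
    rw [sectorWave, sectorWave, Matrix.transpose_mul, expDiag_transpose, ← h1, phase_neg]
    calc _ = expDiag (-phase y z) * ((M 6 (-z))ᵀ * ((Lam ^ 2 * Lam) *
          (M 6 (-z)).adjugateᵀ)) * (Lam ^ 2 * expDiag (phase y z)) := by simp only [mul_assoc]
      _ = _ := by
        rw [Lam_sq_mul_Lam, one_mul, h3, mul_one, ← expDiag_mul_Lam_sq, ← mul_assoc,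
          expDiag_neg_mul, one_mul]
  have h1 := hM.hasDerivAt_sectorWave 0 z
  have h2 : HasDerivAt (fun z => sectorWave M y 6 (-z))
      ((-1 : ℂ) • (lax M y 6 (-z) * sectorWave M y 6 (-z))) z :=
    HasDerivAt.scomp z (hM.hasDerivAt_sectorWave 6 (-z)) (hasDerivAt_neg z)
  have h3 := ((hasDerivAt_transpose h2).mul_const (Lam ^ 2)).mul h1
  have h4 : HasDerivAt (fun z => (sectorWave M y 6 (-z))ᵀ * Lam ^ 2 * sectorWave M y 0 z) 0 z := by
    have : (fun z => (sectorWave M y 6 (-z))ᵀ * Lam ^ 2 * sectorWave M y 0 z) =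
      fun _ => Lam ^ 2 := funext hw
    rw [this]
    exact hasDerivAt_const z (Lam ^ 2)
  have h5 := h3.unique h4
  rw [← hM.lax_eq 6 (-z)]
  set W := sectorWave M y 0 z
  set V := sectorWave M y 6 (-z) with hV
  set A := lax M y 0 z
  set B := lax M y 6 (-z)
  have hinv : (expDiag (-phase y (-z)) * (M 6 (-z)).adjugate)ᵀ * Vᵀ = 1 := by
    rw [← Matrix.transpose_mul, hV, hM.sectorWave_mul, Matrix.transpose_one]
  set X := (expDiag (-phase y (-z)) * (M 6 (-z)).adjugate)ᵀ
  have h6 : Vᵀ * (Lam ^ 2 * A * W) = Vᵀ * (Bᵀ * Lam ^ 2 * W) := by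
    rw [← sub_eq_zero, ← h5, Matrix.transpose_smul, Matrix.transpose_mul]
    simp only [neg_smul, one_smul, neg_mul, mul_assoc]
    abel
  have h7 : Lam ^ 2 * A * W = Bᵀ * Lam ^ 2 * W := by
    have := congrArg (X * ·) h6
    simpa only [← mul_assoc, hinv, one_mul] using this
  have h8 := hM.mul_sectorWave_cancel h7
  rw [mul_assoc, ← h8, ← mul_assoc, Lam_mul_Lam_sq, one_mul]

theorem coeff_unique {n : ℕ} {a b : ℕ → Mat}
    (h : ∀ z : ℂ, ∑ k ∈ Finset.range n, z ^ k • a k = ∑ k ∈ Finset.range n, z ^ k • b k) {k : ℕ}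
    (hk : k < n) : a k = b k := by
  ext i j
  rw [← sub_eq_zero]
  refine eq_zero_of_sum_range_eq_zero (n := n) (c := fun k => a k i j - b k i j) (fun z => ?_) hk
  have := congrFun (congrFun (h z) i) j
  simp only [Matrix.sum_apply, Matrix.smul_apply, smul_eq_mul] at this
  simp only [mul_sub, Finset.sum_sub_distrib]
  rw [this, sub_self]

theorem coeff_symmetries (h₁ : ‖r₁‖ ≤ 1) (h₂ : ‖r₂‖ ≤ 1) (h : r₁ = om ^ 2 * r₂)
    (hM : IsEntireSolution r₁ r₂ y M) {a : ℕ → Mat}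
    (ha : ∀ z, lax M y 0 z = ∑ k ∈ Finset.range 5, z ^ k • a k) {k : ℕ} (hk : k < 5) :
    a k = om ^ (k + 1) • (a k).submatrix shift shift ∧
    a k = (-1 : ℂ) ^ k • (Lam * (a k)ᵀ * Lam ^ 2) := by
  constructor
  · refine coeff_unique (n := 5)
      (b := fun k => om ^ (k + 1) • (a k).submatrix shift shift) (fun z => ?_) hk
    rw [← ha z, hM.lax_rotate h₁ h₂, ha]
    ext i j
    simp only [Matrix.smul_apply, Matrix.submatrix_apply, Matrix.sum_apply, smul_eq_mul,
      Finset.mul_sum]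
    exact Finset.sum_congr rfl fun k _ => by ring
  · refine coeff_unique (n := 5)
      (b := fun k => (-1 : ℂ) ^ k • (Lam * (a k)ᵀ * Lam ^ 2)) (fun z => ?_) hk
    rw [← ha z, hM.lax_transpose h₁ h₂ h, ha, Matrix.transpose_sum, Finset.mul_sum,
      Finset.sum_mul]
    refine Finset.sum_congr rfl fun k _ => ?_
    rw [Matrix.transpose_smul, mul_smul_comm, smul_mul_assoc, smul_smul, neg_pow, mul_comm]

end LaxSymmetry

open scoped Matrix.Norms.Operator

/-! ### The coefficients of the Lax matrix -/

/-- The cyclic shift has three orbits on index pairs: the diagonal and two off-diagonal ones, which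
transposition interchanges. So one diagonal and one off-diagonal entry determine the matrix, and the
diagonal entry vanishes when `ε = -1`. -/
theorem eq_of_symmetries {A : Mat} {ρ ε : ℂ} (h1 : A = ρ • A.submatrix shift shift)
    (h2 : A = ε • (Lam * Aᵀ * Lam ^ 2)) :
    A = !![A 0 0, A 0 1, ε * om * ρ ^ 2 * A 0 1;
      ρ * (ε * om * ρ ^ 2 * A 0 1), ρ * A 0 0, ρ * A 0 1;
      ρ ^ 2 * A 0 1, ρ ^ 2 * (ε * om * ρ ^ 2 * A 0 1), ρ ^ 2 * A 0 0] ∧ A 0 0 = ε * A 0 0 := by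
  have r : ∀ i j, A i j = ρ * A (i + 2) (j + 2) := fun i j => congrFun (congrFun h1 i) j
  have t : ∀ i j, A i j = ε * (lam i * A j i * lam j ^ 2) := fun i j => by
    have := congrFun (congrFun h2 i) j
    rwa [Lam, Matrix.diagonal_pow, Matrix.smul_apply, Matrix.mul_diagonal,
      Matrix.diagonal_mul] at this
  have hc := om_cube
  have e11 : A 1 1 = ρ * A 0 0 := r 1 1
  have e22 : A 2 2 = ρ * A 1 1 := r 2 2
  have e12 : A 1 2 = ρ * A 0 1 := r 1 2
  have e20 : A 2 0 = ρ * A 1 2 := r 2 0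
  have e10 : A 1 0 = ρ * A 0 2 := r 1 0
  have e21 : A 2 1 = ρ * A 1 0 := r 2 1
  have e02 : A 0 2 = ε * om * A 2 0 := by
    rw [t 0 2]; change ε * (om * A 2 0 * 1 ^ 2) = _; ring
  have e00 : A 0 0 = ε * A 0 0 := by
    have := t 0 0
    change A 0 0 = ε * (om * A 0 0 * om ^ 2) at this
    linear_combination this + ε * A 0 0 * hc
  refine ⟨?_, e00⟩
  rw [e12] at e20
  rw [e20] at e02
  rw [e02] at e10
  rw [e10] at e21
  rw [e11] at e22
  rw [A.eta_fin_three, e02, e10, e11, e12, e20, e21, e22]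
  simp only [Matrix.cons_val, Matrix.of_apply]
  congr! 2 <;> ring_nf

/-- Jacobi's formula for `det M = 1`, together with the tracelessness of `Λ` and `Λ²`. It is needed
for the diagonal of `A₂`, which the symmetries do not remove. -/
theorem IsEntireSolution.trace_lax {r₁ r₂ : ℂ} {y : ℝ} {M : ℤ → ℂ → Mat}
    (hM : IsEntireSolution r₁ r₂ y M) (n : ℤ) (z : ℂ) : (lax M y n z).trace = 0 := by
  have h : ∀ i j, HasDerivAt (fun z => M n z i j) (deriv (M n) z i j) z := fun i j =>
    hasDerivAt_pi.mp (hasDerivAt_pi.mp (hM.differentiable n z).hasDerivAt i) j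
  have hd : (fun z => (M n z).det) = fun _ => 1 := funext fun z => hM.det_eq_one n z
  simp only [Matrix.det_fin_three] at hd
  have h1 := ((((((h 0 0).mul (h 1 1)).mul (h 2 2)).sub (((h 0 0).mul (h 1 2)).mul (h 2 1))).sub
    (((h 0 1).mul (h 1 0)).mul (h 2 2))).add (((h 0 1).mul (h 1 2)).mul (h 2 0))).add
    (((h 0 2).mul (h 1 0)).mul (h 2 1)) |>.sub (((h 0 2).mul (h 1 1)).mul (h 2 0))
  have h2 := h1.unique ((hasDerivAt_const z (1 : ℂ)).congr_of_eventuallyEq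
    (Filter.Eventually.of_forall fun z => congrFun hd z))
  have h3 : (M n z * dphase y z * (M n z).adjugate).trace = 0 := by
    rw [Matrix.trace_mul_comm, ← mul_assoc, hM.adjugate_mul, one_mul, dphase, Matrix.trace_sub,
      Matrix.trace_smul, Matrix.trace_smul, trace_Lam, trace_Lam_sq, smul_zero, smul_zero, sub_zero]
  rw [lax, Matrix.trace_add, h3, add_zero, Matrix.adjugate_fin_three, Matrix.trace_fin_three]
  simp only [Matrix.mul_apply, Fin.sum_univ_three, Matrix.of_apply, Matrix.cons_val]
  simp only [Pi.mul_apply] at h2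
  linear_combination h2

open scoped Matrix.Norms.Operator

/-! ### The fourth-order equation for the moment -/

section ScalarEquation

variable {r₁ r₂ : ℂ} {y : ℝ} {M : ℤ → ℂ → Mat}

/-- The diagonals of `A₁` and `A₃` vanish by the sign in the transposition symmetry, that of `A₂` by
its trace, since there the shift factor is `ω³ = 1`. The diagonal of `A₀` survives and is later
removed by the first integral. -/
theorem coeff_explicit (h₁ : ‖r₁‖ ≤ 1) (h₂ : ‖r₂‖ ≤ 1) (h : r₁ = om ^ 2 * r₂)
    (hM : IsEntireSolution r₁ r₂ y M) {a : ℕ → Mat}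
    (ha : ∀ z, lax M y 0 z = ∑ k ∈ Finset.range 5, z ^ k • a k) :
    a 0 = !![a 0 0 0, a 0 0 1, a 0 0 1; om * a 0 0 1, om * a 0 0 0, om * a 0 0 1;
      om ^ 2 * a 0 0 1, om ^ 2 * a 0 0 1, om ^ 2 * a 0 0 0] ∧
    a 1 = !![0, a 1 0 1, -om ^ 2 * a 1 0 1; -om * a 1 0 1, 0, om ^ 2 * a 1 0 1;
      om * a 1 0 1, -a 1 0 1, 0] ∧
    a 2 = !![0, a 2 0 1, om * a 2 0 1; om * a 2 0 1, 0, a 2 0 1; a 2 0 1, om * a 2 0 1, 0] ∧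
    a 3 = !![0, a 3 0 1, -a 3 0 1; -om * a 3 0 1, 0, om * a 3 0 1;
      om ^ 2 * a 3 0 1, -om ^ 2 * a 3 0 1, 0] := by
  have hc := om_cube
  have hs := fun k hk => coeff_symmetries h₁ h₂ h hM ha (k := k) hk
  have s0 := eq_of_symmetries (hs 0 (by norm_num)).1 (hs 0 (by norm_num)).2
  have s1 := eq_of_symmetries (hs 1 (by norm_num)).1 (hs 1 (by norm_num)).2
  have s2 := eq_of_symmetries (hs 2 (by norm_num)).1 (hs 2 (by norm_num)).2
  have s3 := eq_of_symmetries (hs 3 (by norm_num)).1 (hs 3 (by norm_num)).2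
  have d1 : a 1 0 0 = 0 := by linear_combination s1.2 / 2
  have d3 : a 3 0 0 = 0 := by linear_combination s3.2 / 2
  have d2 : a 2 0 0 = 0 := by
    have t : (a 2).trace = 0 := by
      refine eq_zero_of_sum_range_eq_zero (n := 5) (c := fun k => (a k).trace) (fun z => ?_)
        (k := 2) (by norm_num)
      rw [← hM.trace_lax 0 z, ha, Matrix.trace_sum]
      simp only [Matrix.trace_smul, smul_eq_mul]
    rw [s2.1, Matrix.trace_fin_three] at t
    simp only [Matrix.of_apply, Matrix.cons_val] at t
    linear_combination t / 3 - a 2 0 0 / 3 * (om ^ 3 + 2) * hc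
  have p4 : om ^ 4 = om := by linear_combination om * hc
  have p5 : om ^ 5 = om ^ 2 := by linear_combination om ^ 2 * hc
  have p6 : om ^ 6 = 1 := by linear_combination (om ^ 3 + 1) * hc
  refine ⟨s0.1.trans ?_, s1.1.trans ?_, s2.1.trans ?_, s3.1.trans ?_⟩
  · congr! 2 <;> grind
  · rw [d1]; congr! 2 <;> grind
  · rw [d2]; congr! 2 <;> grind
  · rw [d3]; congr! 2 <;> grind

theorem moment_explicit {m : Mat} (hm : m = om ^ 2 • m.submatrix shift shift ∧
    m = Lam * mᵀ * Lam ^ 2 ∧ m = conjFlip m) :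
    m * Lam - Lam * m = m 0 2 • !![0, 1 - om ^ 2, 1 - om; 1 - om, 0, 1 - om ^ 2;
      1 - om ^ 2, 1 - om, 0] ∧ conj (m 0 2) = m 0 2 := by
  have hc := om_cube
  have s := (eq_of_symmetries (ε := 1) hm.1 (by rw [one_smul]; exact hm.2.1)).1
  have e02 : m 0 2 = om ^ 2 * m 0 1 := by
    have : m 0 2 = 1 * om * (om ^ 2) ^ 2 * m 0 1 := congrFun (congrFun s 0) 2
    linear_combination this + om ^ 2 * m 0 1 * hc
  have e12 : m 1 2 = om ^ 2 * m 0 1 := congrFun (congrFun s 1) 2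
  constructor
  · have e : m = !![m 0 0, om * m 0 2, m 0 2; om ^ 2 * m 0 2, om ^ 2 * m 0 0, m 0 2;
        om ^ 2 * m 0 2, om * m 0 2, om * m 0 0] := by
      refine s.trans ?_
      congr! 2 <;> grind
    rw [e, Lam]
    ext i j
    rw [Matrix.sub_apply, Matrix.mul_diagonal, Matrix.diagonal_mul]
    fin_cases i <;> fin_cases j <;> simp [lam] <;> grind
  · have : m 1 2 = conj (m 0 2) := congrFun (congrFun hm.2.2 1) 2
    rw [← this, e12, e02]

end ScalarEquation

open scoped Matrix.Norms.Operator

section ScalarEquation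

theorem hasDerivAt_apply {f : ℝ → Mat} {f' : Mat} {y : ℝ} (h : HasDerivAt f f' y) (i j : Fin 3) :
    HasDerivAt (fun y => f y i j) (f' i j) y :=
  hasDerivAt_pi.mp (hasDerivAt_pi.mp h i) j

theorem commutator_zero_one (A B : Mat) : (A * B - B * A) 0 1 =
    A 0 0 * B 0 1 + A 0 1 * B 1 1 + A 0 2 * B 2 1 -
      (B 0 0 * A 0 1 + B 0 1 * A 1 1 + B 0 2 * A 2 1) := by
  simp [Matrix.mul_apply, Fin.sum_univ_three]

/-- The first integral is solved for the diagonal entry `d` of `A₀` in terms of `f₀, …, f₂`, and `d`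
is substituted into the last compatibility equation. The explicit `y` of the fourth-order equation
enters through `tr A²`. -/
theorem scalar_identity {w f₀ f₁ f₂ f₃ b₀ b₁ b₂ b₃ d y : ℂ} (hw : w ^ 2 + w + 1 = 0)
    (c₀ : b₀ = w * (f₃ - 2 * f₁ ^ 2 - f₀ * f₂ - 2 * (f₀ ^ 2 * f₁)))
    (c₁ : b₁ = (2 + w) * (2 * (f₀ * f₁) - f₂)) (c₂ : b₂ = 3 * w * (f₀ ^ 2 - f₁))
    (c₃ : b₃ = (6 + 3 * w) * f₀)
    (h : -54 * w ^ 2 * d - 12 * w * b₃ * b₁ + 6 * w * b₂ ^ 2 = -54 * y) :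
    -(w ^ 2 * (f₀ * (d + b₀))) + 5 * f₁ * f₂ + f₀ * f₃ + 4 * f₀ * f₁ ^ 2 + 2 * f₀ ^ 2 * f₂ =
      5 * f₀ * f₁ ^ 2 + 5 * f₁ * f₂ - y * f₀ + 5 * f₀ ^ 2 * f₂ - f₀ ^ 5 := by
  have hd : w ^ 2 * d = y - 2 * f₀ * f₂ + 2 * f₀ ^ 2 * f₁ + f₁ ^ 2 + f₀ ^ 4 := by
    rw [c₁, c₂, c₃] at h
    linear_combination -h / 54 - (2 / 9) * (f₀ * (2 * (f₀ * f₁) - f₂)) * (9 + 3 * w) * hw +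
      (f₀ ^ 2 - f₁) ^ 2 * (w - 1) * hw
  have hb : w ^ 2 * b₀ = f₃ - 2 * f₁ ^ 2 - f₀ * f₂ - 2 * (f₀ ^ 2 * f₁) := by
    rw [c₀]
    linear_combination (w - 1) * (f₃ - 2 * f₁ ^ 2 - f₀ * f₂ - 2 * (f₀ ^ 2 * f₁)) * hw
  linear_combination -f₀ * hd - f₀ * hb

theorem commutator_Lam_zero_one (B : Mat) : (Lam * B - B * Lam) 0 1 = (om - om ^ 2) * B 0 1 := by
  rw [Lam, Matrix.sub_apply, Matrix.mul_diagonal, Matrix.diagonal_mul]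
  change om * B 0 1 - B 0 1 * om ^ 2 = _
  ring

variable {r₁ r₂ : ℂ} {Y : Set ℝ} {N : ℝ → ℤ → ℂ → Mat}

/-- The compatibility equations form a chain: the derivative of the off-diagonal entry of `A₃`
contains that of `A₂`, and so on down to `A₀`. Solving for the lower entries defines `f₁, f₂, f₃` as
polynomials in the entries, so differentiability of `m` follows from that of `A₃` and is not
assumed. -/
theorem exists_successive_derivatives (h₁ : ‖r₁‖ ≤ 1) (h₂ : ‖r₂‖ ≤ 1) (h : r₁ = om ^ 2 * r₂)
    (hN : ∀ y ∈ Y, IsEntireSolution r₁ r₂ y (N y)) {m : ℝ → Mat} {a : ℝ → ℕ → Mat}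
    (hm : ∀ y ∈ Y, m y = om ^ 2 • (m y).submatrix shift shift ∧ m y = Lam * (m y)ᵀ * Lam ^ 2 ∧
      m y = conjFlip (m y)) (hY : IsOpen Y)
    (ha : ∀ y ∈ Y, (∀ z, lax (N y) y 0 z = ∑ k ∈ Finset.range 5, z ^ k • a y k) ∧
      a y 4 = (-9 : ℂ) • Lam ^ 2 ∧
      2 * (a y 4 * a y 0).trace + 2 * (a y 3 * a y 1).trace + (a y 2 * a y 2).trace = -(54 * y) ∧
      HasDerivAt (fun y => a y 0) (Lam + ((m y * Lam - Lam * m y) * a y 0 -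
        a y 0 * (m y * Lam - Lam * m y))) y ∧
      (∀ k < 4, HasDerivAt (fun y => a y (k + 1)) (((m y * Lam - Lam * m y) * a y (k + 1) -
        a y (k + 1) * (m y * Lam - Lam * m y)) + (Lam * a y k - a y k * Lam)) y) ∧
      ((m y * Lam - Lam * m y) * a y 4 - a y 4 * (m y * Lam - Lam * m y)) +
        (Lam * a y 3 - a y 3 * Lam) = 0) :
    ∃ f₁ f₂ f₃ : ℝ → ℂ, ∀ y ∈ Y, HasDerivAt (fun y => 3 * m y 0 2) (f₁ y) y ∧
      HasDerivAt f₁ (f₂ y) y ∧ HasDerivAt f₂ (f₃ y) y ∧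
      HasDerivAt f₃ (5 * (3 * m y 0 2) * f₁ y ^ 2 + 5 * f₁ y * f₂ y - y * (3 * m y 0 2) +
        5 * (3 * m y 0 2) ^ 2 * f₂ y - (3 * m y 0 2) ^ 5) y := by
  have hw := om_sq_add
  set f₀ : ℝ → ℂ := fun y => (1 - om) / 9 * a y 3 0 1 with hf₀
  set f₁ : ℝ → ℂ := fun y => f₀ y ^ 2 - om ^ 2 / 3 * a y 2 0 1 with hf₁
  set f₂ : ℝ → ℂ := fun y => 2 * (f₀ y * f₁ y) - (1 - om) / 3 * a y 1 0 1 with hf₂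
  set f₃ : ℝ → ℂ := fun y => om ^ 2 * a y 0 0 1 + 2 * f₁ y ^ 2 + f₀ y * f₂ y +
    2 * (f₀ y ^ 2 * f₁ y) with hf₃
  have key : ∀ y ∈ Y, 3 * m y 0 2 = f₀ y ∧ HasDerivAt f₀ (f₁ y) y ∧ HasDerivAt f₁ (f₂ y) y ∧
      HasDerivAt f₂ (f₃ y) y ∧ HasDerivAt f₃ (5 * f₀ y * f₁ y ^ 2 + 5 * f₁ y * f₂ y - y * f₀ y +
        5 * f₀ y ^ 2 * f₂ y - f₀ y ^ 5) y := fun y hy => by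
    obtain ⟨hpoly, h4, htr, hd0, hd, hlast⟩ := ha y hy
    obtain ⟨e0, e1, e2, e3⟩ := coeff_explicit h₁ h₂ h (hN y hy) hpoly
    obtain ⟨hU, -⟩ := moment_explicit (hm y hy)
    have gl := congrFun (congrFun hlast 0) 1
    set b₃ := a y 3 0 1
    set b₂ := a y 2 0 1
    set b₁ := a y 1 0 1
    set b₀ := a y 0 0 1
    set d := a y 0 0 0
    set u := m y 0 2
    -- The algebraic `z⁴` relation identifies the entry of `A₃` with a multiple of the moment.
    have l₃ : b₃ = 9 * u * (1 - om ^ 2) := by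
      rw [Matrix.add_apply, commutator_zero_one, commutator_Lam_zero_one, hU, h4, Lam,
        Matrix.diagonal_pow] at gl
      simp [lam] at gl
      grind
    have k₃ : HasDerivAt (fun y => a y 3 0 1) (3 * u * b₃ + (om - om ^ 2) * b₂) y := by
      refine (hasDerivAt_apply (hd 2 (by norm_num)) 0 1).congr_deriv ?_
      rw [Matrix.add_apply, commutator_zero_one, commutator_Lam_zero_one, hU, e3]
      simp
      grind
    have k₂ : HasDerivAt (fun y => a y 2 0 1) ((om - om ^ 2) * b₁) y := by
      refine (hasDerivAt_apply (hd 1 (by norm_num)) 0 1).congr_deriv ?_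
      rw [Matrix.add_apply, commutator_zero_one, commutator_Lam_zero_one, hU, e2]
      simp
      grind
    have k₁ : HasDerivAt (fun y => a y 1 0 1) (-3 * u * b₁ + (om - om ^ 2) * b₀) y := by
      refine (hasDerivAt_apply (hd 0 (by norm_num)) 0 1).congr_deriv ?_
      rw [Matrix.add_apply, commutator_zero_one, commutator_Lam_zero_one, hU, e1]
      simp
      grind
    have k₀ : HasDerivAt (fun y => a y 0 0 1) (-3 * u * (d + b₀)) y := by
      refine (hasDerivAt_apply hd0 0 1).congr_deriv ?_
      rw [Matrix.add_apply, commutator_zero_one, hU, e0, Lam]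
      simp
      grind
    -- The first integral in the remaining scalars; this is the only relation that determines `d`.
    have htr' : -54 * om ^ 2 * d - 12 * om * b₃ * b₁ + 6 * om * b₂ ^ 2 = -54 * y := by
      rw [e0, e1, e2, e3, h4, Lam, Matrix.diagonal_pow] at htr
      simp [Matrix.trace_fin_three, Matrix.mul_apply, Fin.sum_univ_three, lam] at htr
      grind
    have q₀ : 3 * u = f₀ y := by
      simp only [hf₀]
      grind
    have D₀ : HasDerivAt f₀ (f₁ y) y := by
      refine (k₃.const_mul ((1 - om) / 9)).congr_deriv ?_
      simp only [hf₁, ← q₀]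
      grind
    have D₁ : HasDerivAt f₁ (f₂ y) y := by
      refine ((D₀.pow 2).sub (k₂.const_mul (om ^ 2 / 3))).congr_deriv ?_
      simp only [hf₂]
      grind
    have D₂ : HasDerivAt f₂ (f₃ y) y := by
      refine (((D₀.mul D₁).const_mul 2).sub (k₁.const_mul ((1 - om) / 3))).congr_deriv ?_
      simp only [hf₃]
      have : b₁ = (2 + om) * (2 * (f₀ y * f₁ y) - f₂ y) := by simp only [hf₂]; grind
      grind
    refine ⟨q₀, D₀, D₁, D₂, ?_⟩
    refine ((((k₀.const_mul (om ^ 2)).add ((D₁.pow 2).const_mul 2)).add (D₀.mul D₂)).add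
      (((D₀.pow 2).mul D₁).const_mul 2)).congr_deriv ?_
    have c₁ : b₁ = (2 + om) * (2 * (f₀ y * f₁ y) - f₂ y) := by simp only [hf₂]; grind
    have c₂ : b₂ = 3 * om * (f₀ y ^ 2 - f₁ y) := by simp only [hf₁]; grind
    have c₃ : b₃ = (6 + 3 * om) * f₀ y := by simp only [hf₀]; grind
    have c₀ : b₀ = om * (f₃ y - 2 * f₁ y ^ 2 - f₀ y * f₂ y - 2 * (f₀ y ^ 2 * f₁ y)) := by
      simp only [hf₃]; grind
    have := scalar_identity hw c₀ c₁ c₂ c₃ htr'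
    clear_value f₀ f₁ f₂ f₃
    simp only [Pi.pow_apply]
    linear_combination this - om ^ 2 * (d + b₀) * q₀
  refine ⟨f₁, f₂, f₃, fun y hy => ?_⟩
  obtain ⟨q, D₀, D₁, D₂, D₃⟩ := key y hy
  rw [q]
  refine ⟨D₀.congr_of_eventuallyEq ?_, D₁, D₂, D₃⟩
  filter_upwards [hY.mem_nhds hy] with y' hy'
  exact (key y' hy').1

end ScalarEquation

/-! ### Passage to the real function `p(s) = -q(-s)` -/

open scoped Matrix.Norms.Operator

section RealEquation

theorem contDiffOn_succ_of_hasDerivAt {S : Set ℝ} (hS : IsOpen S) {f f' : ℝ → ℝ} {n : ℕ}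
    (h : ∀ s ∈ S, HasDerivAt f (f' s) s) (hf' : ContDiffOn ℝ n f' S) :
    ContDiffOn ℝ (n + 1 : ℕ) f S := by
  push_cast
  rw [contDiffOn_succ_iff_deriv_of_isOpen hS]
  exact ⟨fun s hs => (h s hs).differentiableAt.differentiableWithinAt, by simp,
    hf'.congr fun s hs => (h s hs).deriv⟩

theorem iteratedDeriv_succ_of_hasDerivAt {S : Set ℝ} (hS : IsOpen S) {f f' : ℝ → ℝ}
    (h : ∀ s ∈ S, HasDerivAt f (f' s) s) (n : ℕ) {s : ℝ} (hs : s ∈ S) :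
    iteratedDeriv (n + 1) f s = iteratedDeriv n f' s := by
  rw [iteratedDeriv_succ']
  refine Filter.EventuallyEq.iteratedDeriv_eq n ?_
  filter_upwards [hS.mem_nhds hs] with t ht
  exact (h t ht).deriv

theorem im_eq_zero_of_hasDerivAt {Y : Set ℝ} (hY : IsOpen Y) {f f' : ℝ → ℂ}
    (h : ∀ y ∈ Y, HasDerivAt f (f' y) y) (hf : ∀ y ∈ Y, (f y).im = 0) {y : ℝ} (hy : y ∈ Y) :
    (f' y).im = 0 := by
  have h1 : HasDerivAt (fun y => (f y).im) (f' y).im y :=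
    (Complex.imCLM.hasFDerivAt.comp_hasDerivAt y (h y hy))
  refine h1.unique ((hasDerivAt_const y (0 : ℝ)).congr_of_eventuallyEq ?_)
  filter_upwards [hY.mem_nhds hy] with t ht
  exact hf t ht

theorem hasDerivAt_re_comp_neg {f : ℝ → ℂ} {f' : ℂ} {s : ℝ} (h : HasDerivAt f f' (-s)) :
    HasDerivAt (fun s => (f (-s)).re) (-f'.re) s := by
  have h1 : HasDerivAt (fun y => (f y).re) f'.re (-s) :=
    Complex.reCLM.hasFDerivAt.comp_hasDerivAt (-s) h
  exact (h1.comp s (hasDerivAt_neg s)).congr_deriv (mul_neg_one _)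

/-- The substitution `s = -y` alternates the signs of the successive derivatives and turns `-y q`
into `s p`. Derivatives of a function that is real on an open set of the line are real, which allows
taking real parts inside products; the right side contains only `q, f₁, f₂`, so no more is needed.
-/
theorem solvesFXVIII_of_hasDerivAt {Y : Set ℝ} (hY : IsOpen Y) {q f₁ f₂ f₃ : ℝ → ℂ}
    (hq : ∀ y ∈ Y, (q y).im = 0)
    (h : ∀ y ∈ Y, HasDerivAt q (f₁ y) y ∧ HasDerivAt f₁ (f₂ y) y ∧ HasDerivAt f₂ (f₃ y) y ∧
      HasDerivAt f₃ (5 * q y * f₁ y ^ 2 + 5 * f₁ y * f₂ y - y * q y + 5 * q y ^ 2 * f₂ y -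
        q y ^ 5) y) :
    SolvesFXVIII (fun s => -(q (-s)).re) {s | -s ∈ Y} := by
  have hS : IsOpen {s : ℝ | -s ∈ Y} := hY.preimage continuous_neg
  have i₁ : ∀ y ∈ Y, (f₁ y).im = 0 := fun y hy =>
    im_eq_zero_of_hasDerivAt hY (fun y hy => (h y hy).1) hq hy
  have i₂ : ∀ y ∈ Y, (f₂ y).im = 0 := fun y hy =>
    im_eq_zero_of_hasDerivAt hY (fun y hy => (h y hy).2.1) i₁ hy
  set p : ℝ → ℝ := fun s => -(q (-s)).re with hp
  set p₁ : ℝ → ℝ := fun s => (f₁ (-s)).re with hp₁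
  set p₂ : ℝ → ℝ := fun s => -(f₂ (-s)).re with hp₂
  set p₃ : ℝ → ℝ := fun s => (f₃ (-s)).re with hp₃
  have d₀ : ∀ s ∈ {s : ℝ | -s ∈ Y}, HasDerivAt p (p₁ s) s := fun s hs =>
    (hasDerivAt_re_comp_neg (h _ hs).1).neg.congr_deriv (neg_neg _)
  have d₁ : ∀ s ∈ {s : ℝ | -s ∈ Y}, HasDerivAt p₁ (p₂ s) s := fun s hs =>
    hasDerivAt_re_comp_neg (h _ hs).2.1
  have d₂ : ∀ s ∈ {s : ℝ | -s ∈ Y}, HasDerivAt p₂ (p₃ s) s := fun s hs =>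
    (hasDerivAt_re_comp_neg (h _ hs).2.2.1).neg.congr_deriv (neg_neg _)
  have d₃ : ∀ s ∈ {s : ℝ | -s ∈ Y}, HasDerivAt p₃ (5 * p s * p₁ s ^ 2 + 5 * p₁ s * p₂ s +
      s * p s + 5 * p s ^ 2 * p₂ s - p s ^ 5) s := fun s hs => by
    refine (hasDerivAt_re_comp_neg (h _ hs).2.2.2).congr_deriv ?_
    have e₀ : q (-s) = ((-p s : ℝ) : ℂ) := Complex.ext (by simp [hp]) (by simpa using hq _ hs)
    have e₁ : f₁ (-s) = ((p₁ s : ℝ) : ℂ) := Complex.ext (by simp [hp₁]) (by simpa using i₁ _ hs)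
    have e₂ : f₂ (-s) = ((-p₂ s : ℝ) : ℂ) := Complex.ext (by simp [hp₂]) (by simpa using i₂ _ hs)
    rw [e₀, e₁, e₂]
    norm_cast
    ring
  have c : ∀ {f f' : ℝ → ℝ}, (∀ s ∈ {s : ℝ | -s ∈ Y}, HasDerivAt f (f' s) s) →
      ContinuousOn f {s : ℝ | -s ∈ Y} := fun hf s hs =>
    (hf s hs).continuousAt.continuousWithinAt
  have c₀ := c d₀
  have c₁ := c d₁
  have c₂ := c d₂
  constructor
  · refine contDiffOn_succ_of_hasDerivAt (n := 3) hS d₀ (contDiffOn_succ_of_hasDerivAt hS d₁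
      (contDiffOn_succ_of_hasDerivAt hS d₂ (contDiffOn_succ_of_hasDerivAt (n := 0) hS d₃
        (contDiffOn_zero.mpr ?_))))
    fun_prop
  · intro s hs
    rw [iteratedDeriv_succ_of_hasDerivAt hS d₀ 3 hs, iteratedDeriv_succ_of_hasDerivAt hS d₁ 2 hs,
      iteratedDeriv_succ_of_hasDerivAt hS d₂ 1 hs, iteratedDeriv_succ_of_hasDerivAt hS d₃ 0 hs,
      iteratedDeriv_succ_of_hasDerivAt hS d₀ 1 hs, iteratedDeriv_succ_of_hasDerivAt hS d₁ 0 hs,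
      (d₀ s hs).deriv, iteratedDeriv_zero, iteratedDeriv_zero]

end RealEquation

open scoped Matrix.Norms.Operator

/-! ### Back to the Riemann-Hilbert problem -/

/-- The function `M` off the contour is given by the entire functions `N` of the sectors. -/
def RestrictsTo (N : ℤ → ℂ → Mat) (M : ℂ → Mat) : Prop :=
  ∀ (n : ℤ) (x φ : ℝ), φ ∈ Ioo (rayAngle n) (rayAngle (n + 1)) →
    M (Complex.exp (x + φ * I)) = N n (Complex.exp (x + φ * I))

theorem HasMoment.isBigO {M : ℂ → Mat} {N : ℤ → ℂ → Mat} (h : RestrictsTo N M) {m : Mat} {K : ℝ}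
    (hm : HasMoment N m K) (i j : Fin 3) :
    (fun z : ℂ => (M z - 1 - z⁻¹ • m) i j) =O[atInfty] fun z : ℂ => z⁻¹ ^ 2 := by
  refine IsBigO.of_bound K ?_
  have hc : ∀ᶠ z in atInfty, z ∈ contourᶜ :=
    Filter.mem_of_superset (mem_inf_of_right (mem_principal_self _)) fun _ hz => hz
  filter_upwards [hc] with z hz
  obtain ⟨n, x, φ, hφ, rfl⟩ := exists_polar_of_not_mem_contour hz
  rw [h n x φ hφ]
  refine (norm_apply_le _ i j).trans ((hm n _ (mem_sector (Ioo_subset_Icc_self hφ))).trans_eq ?_)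
  rw [norm_pow, norm_inv]

section WaveFunction

variable {r₁ r₂ : ℂ} {Y : Set ℝ} {M : ℝ → ℂ → Mat} {N : ℝ → ℤ → ℂ → Mat}

theorem hasDerivAt_sectorWave_param (h₁ : ‖r₁‖ ≤ 1) (h₂ : ‖r₂‖ ≤ 1) (hY : IsOpen Y)
    (hN : ∀ y ∈ Y, IsEntireSolution r₁ r₂ y (N y)) {m : ℝ → Mat}
    (hm : ∀ y ∈ Y, ∃ K, HasMoment (N y) (m y) K) {y : ℝ} (hy : y ∈ Y) (n : ℤ) (z : ℂ) :
    HasDerivAt (fun s => sectorWave (N s) s n z)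
      ((z • Lam + (m y * Lam - Lam * m y)) * sectorWave (N y) y n z) y := by
  refine ((hasDerivAt_transfer h₁ h₂ hY hN hm hy z).mul_const _).congr_of_eventuallyEq ?_
  filter_upwards [hY.mem_nhds hy] with s hs
  rw [← transfer_eq (hN y hy) (hN s hs) n, transfer_mul_sectorWave (hN y hy)]

theorem hasDerivAt_wave_param (h₁ : ‖r₁‖ ≤ 1) (h₂ : ‖r₂‖ ≤ 1) (hY : IsOpen Y)
    (hN : ∀ y ∈ Y, IsEntireSolution r₁ r₂ y (N y)) (hMN : ∀ y ∈ Y, RestrictsTo (N y) (M y))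
    {m : ℝ → Mat} (hm : ∀ y ∈ Y, ∃ K, HasMoment (N y) (m y) K) {y : ℝ} (hy : y ∈ Y) {z : ℂ}
    (hz : z ∈ contourᶜ) (i j : Fin 3) : HasDerivAt (fun s : ℝ => wave M s z i j)
      (((z • Lam + (m y * Lam - Lam * m y)) * wave M y z) i j) y := by
  obtain ⟨n, x, φ, hφ, rfl⟩ := exists_polar_of_not_mem_contour hz
  set z := Complex.exp (x + φ * I)
  have e : ∀ s ∈ Y, wave M s z = sectorWave (N s) s n z := fun s hs => by
    rw [wave, hMN s hs n x φ hφ]; rfl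
  have h := hasDerivAt_apply (hasDerivAt_sectorWave_param h₁ h₂ hY hN hm hy n z) i j
  rw [e y hy]
  refine h.congr_of_eventuallyEq ?_
  filter_upwards [hY.mem_nhds hy] with s hs
  rw [e s hs]

theorem hasDerivAt_wave {y : ℝ} (hN : IsEntireSolution r₁ r₂ y (N y))
    (hMN : RestrictsTo (N y) (M y)) {z : ℂ} (hz : z ∈ contourᶜ) (i j : Fin 3) :
    HasDerivAt (fun ζ : ℂ => wave M y ζ i j) ((lax (N y) y 0 z * wave M y z) i j) z := by
  obtain ⟨n, x, φ, hφ, rfl⟩ := exists_polar_of_not_mem_contour hz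
  have e : ∀ x φ : ℝ, φ ∈ Ioo (rayAngle n) (rayAngle (n + 1)) →
      wave M y (Complex.exp (x + φ * I)) = sectorWave (N y) y n (Complex.exp (x + φ * I)) :=
    fun x φ hφ => by rw [wave, hMN n x φ hφ]; rfl
  rw [e x φ hφ, ← hN.lax_eq n]
  refine (hasDerivAt_pi.mp (hasDerivAt_pi.mp (hN.hasDerivAt_sectorWave n _) i)
    j).congr_of_eventuallyEq ?_
  filter_upwards [eventually_sector hφ] with ζ ⟨x', φ', hφ', hζ⟩
  rw [hζ, e x' φ' hφ']

theorem exists_moment_and_lax_pair (h₁ : ‖r₁‖ < 1) (h₂ : ‖r₂‖ < 1) (hr : Relations r₁ r₂)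
    (h : r₁ = om ^ 2 * r₂) (hY : IsOpen Y) (hM : ∀ y ∈ Y, IsSolution r₁ r₂ y (M y)) :
    ∃ M₁ : ℝ → Mat,
      (∀ y ∈ Y, ∀ i j : Fin 3,
        (fun z : ℂ => (M y z - 1 - z⁻¹ • M₁ y) i j) =O[atInfty] fun z : ℂ => z⁻¹ ^ 2) ∧
      (∀ y ∈ Y, ∃ A : Fin 5 → Mat, A 4 = (-9 : ℂ) • Lam ^ 2 ∧ ∀ z ∈ contourᶜ, ∀ i j : Fin 3,
        HasDerivAt (fun s : ℝ => wave M s z i j)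
          (((z • Lam + (M₁ y * Lam - Lam * M₁ y)) * wave M y z) i j) y ∧
        HasDerivAt (fun ζ : ℂ => wave M y ζ i j)
          (((∑ k : Fin 5, z ^ (k : ℕ) • A k) * wave M y z) i j) z) ∧
      (∀ y ∈ Y, (3 * M₁ y 0 2).im = 0) ∧
      SolvesFXVIII (fun s : ℝ => -(3 * M₁ (-s) 0 2).re) {s : ℝ | -s ∈ Y} := by
  have hp := (prod_jumpConst_eq_one_iff r₁ r₂).mpr ((relations_iff h₁ h₂).mp hr)
  have hex : ∀ y, ∃ (N : ℤ → ℂ → Mat) (m : Mat) (K : ℝ), y ∈ Y → IsEntireSolution r₁ r₂ y N ∧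
      RestrictsTo N (M y) ∧ 1 ≤ K ∧ SectorBound N K ∧ HasMoment N m K := fun y => by
    by_cases hy : y ∈ Y
    · obtain ⟨N, hN, hMN⟩ := (hM y hy).exists_entire hp
      obtain ⟨B, hB1, hB⟩ := hN.exists_sectorBound
      obtain ⟨m, hm⟩ := hN.exists_hasMoment h₁.le h₂.le hB
      -- The uniform statement for a one-point parameter set merely supplies a single constant `K ≥
      -- 1` for both the bound and the expansion.
      obtain ⟨K, δ, hδ, hK, hKδ⟩ := exists_uniform_hasMoment (Y := {y}) (N := fun _ => N)
        (m := fun _ => m) h₁.le h₂.le (by rintro _ rfl; exact hN) (by rintro _ rfl; exact ⟨_, hm⟩)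
        rfl
      exact ⟨N, m, K, fun _ => ⟨hN, hMN, hK, hKδ y rfl (by simpa using hδ)⟩⟩
    · exact ⟨0, 0, 0, fun h => absurd h hy⟩
  choose N m K hNK using hex
  have hN := fun y hy => (hNK y hy).1
  have hMN := fun y hy => (hNK y hy).2.1
  have hm : ∀ y ∈ Y, ∃ K, HasMoment (N y) (m y) K := fun y hy => ⟨K y, (hNK y hy).2.2.2.2⟩
  have hs := fun y (hy : y ∈ Y) => moment_symmetries h₁.le h₂.le h (hN y hy) (hNK y hy).2.2.1
    (hNK y hy).2.2.2.1 (hNK y hy).2.2.2.2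
  obtain ⟨a, ha⟩ := exists_lax_system h₁.le h₂.le hY hN hm
  obtain ⟨f₁, f₂, f₃, hf⟩ := exists_successive_derivatives h₁.le h₂.le h hN hs hY ha
  have hreal : ∀ y ∈ Y, (3 * m y 0 2).im = 0 := fun y hy => by
    have := Complex.conj_eq_iff_im.mp (moment_explicit (hs y hy)).2
    simp [Complex.mul_im, this]
  refine ⟨m, fun y hy i j => (hNK y hy).2.2.2.2.isBigO (hMN y hy) i j, fun y hy =>
    ⟨fun k => a y k, (ha y hy).2.1, fun z hz i j =>
      ⟨hasDerivAt_wave_param h₁.le h₂.le hY hN hMN hm hy hz i j, ?_⟩⟩, hreal,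
    solvesFXVIII_of_hasDerivAt hY hreal hf⟩
  have := hasDerivAt_wave (hN y hy) (hMN y hy) hz i j
  rwa [(ha y hy).1 z, ← Fin.sum_univ_eq_sum_range (fun k => z ^ k • a y k) 5] at this

end WaveFunction

end PainleveModel

theorem mainTheorem5 :
    -- consistency of the jumps is equivalent to the relations
    (∀ r₁ r₂ : ℂ, ‖r₁‖ < 1 → ‖r₂‖ < 1 → ∀ (y : ℝ) (z : ℂ),
      (PainleveModel.JumpsConsistent r₁ r₂ y z ↔ PainleveModel.Relations r₁ r₂)) ∧
    -- the reflection coefficients at `0` of a real Schwartz potential satisfy the hypotheses below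
    (∀ w : 𝓢(ℝ, ℝ),
      (∃ r₁ r₂ : ℂ, PainleveModel.IsReflection₁ w 0 r₁ ∧ PainleveModel.IsReflection₂ w 0 r₂) ∧
      ∀ r₁ r₂ : ℂ, PainleveModel.IsReflection₁ w 0 r₁ → PainleveModel.IsReflection₂ w 0 r₂ →
        ‖r₁‖ < 1 ∧ ‖r₂‖ < 1 ∧ PainleveModel.Relations r₁ r₂ ∧ r₁ = PainleveModel.om ^ 2 * r₂) ∧
    -- expansion at infinity, Lax pair, reality and the fourth-order equation
    (∀ r₁ r₂ : ℂ, ‖r₁‖ < 1 → ‖r₂‖ < 1 → PainleveModel.Relations r₁ r₂ →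
      r₁ = PainleveModel.om ^ 2 * r₂ →
      ∀ (Y : Set ℝ) (M : ℝ → ℂ → Matrix (Fin 3) (Fin 3) ℂ), IsOpen Y →
        (∀ y ∈ Y, PainleveModel.IsSolution r₁ r₂ y (M y)) →
        ∃ M₁ : ℝ → Matrix (Fin 3) (Fin 3) ℂ,
          (∀ y ∈ Y, ∀ i j : Fin 3,
            (fun z : ℂ => (M y z - 1 - z⁻¹ • M₁ y) i j)
              =O[PainleveModel.atInfty] fun z : ℂ => z⁻¹ ^ 2) ∧
          (∀ y ∈ Y, ∃ A : Fin 5 → Matrix (Fin 3) (Fin 3) ℂ,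
            A 4 = (-9 : ℂ) • PainleveModel.Lam ^ 2 ∧
            ∀ z ∈ PainleveModel.contourᶜ, ∀ i j : Fin 3,
              HasDerivAt (fun s : ℝ => PainleveModel.wave M s z i j)
                (((z • PainleveModel.Lam +
                    (M₁ y * PainleveModel.Lam - PainleveModel.Lam * M₁ y)) *
                  PainleveModel.wave M y z) i j) y ∧
              HasDerivAt (fun ζ : ℂ => PainleveModel.wave M y ζ i j)
                (((∑ k : Fin 5, z ^ (k : ℕ) • A k) * PainleveModel.wave M y z) i j) z) ∧
          (∀ y ∈ Y, (3 * M₁ y 0 2).im = 0) ∧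
          PainleveModel.SolvesFXVIII (fun s : ℝ => -(3 * M₁ (-s) 0 2).re) {s : ℝ | -s ∈ Y}) := by
  refine ⟨fun r₁ r₂ h₁ h₂ y z => PainleveModel.jumpsConsistent_iff_relations h₁ h₂ y z,
    fun w => ⟨PainleveModel.exists_reflection_zero w, fun r₁ r₂ hr₁ hr₂ =>
      PainleveModel.reflection_zero hr₁ hr₂⟩, fun r₁ r₂ h₁ h₂ hr h Y M hY hM =>
        PainleveModel.exists_moment_and_lax_pair h₁ h₂ hr h hY hM⟩
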